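/- Let $p$ be an odd prime, $f\ge 1$, $q=p^f$, let $k=\mathbb F_q$ with quadratic extension $\ell=\mathbb F_{q^2}$, and let $\mathbb F$ be a field with an embedding $\sigma_0':\ell\hookrightarrow\mathbb F$; put $\sigma_j'(x)=\sigma_0'(x^{p^j})$. Let $$U_{1,1}(k)=\{g\in GL_2(\ell): (g^{(q)})^{\top}\Phi_2\,g=\Phi_2\},\qquad \Phi_2=\begin{pmatrix}0&1\\-1&0\end{pmatrix},$$ where $g^{(q)}$ is obtained by raising the entries to the $q$-th power. **Weights.** Put $\mathcal J=\{0,\dots,f-1\}$ (indices modulo $f$), $X^*(T_H)=\mathbb Z^4/\mathbb Z(1,-1,-1,1)$, $X^*(\underline T)=X^*(T_H)^{\mathcal J}$ and $X^*(\underline T_U)=(\mathbb Z^2)^{\mathcal J}$, embedded in $X^*(\underline T)$ by $(a,b)\mapsto(a,b,0,0)$ in each coordinate. Let $\langle\lambda,\alpha_j^\vee\rangle=a_j-b_j+c_j-d_j$, let $\alpha_j$ (resp. $\rho_j$) be $(1,-1,0,0)$ (resp. $(1,0,0,0)$) in coordinate $j$ and $0$ elsewhere, and let $\eta$ be $(0,0,1,0)$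 in every coordinate. Let $\pi$ be the automorphism of $X^*(\underline T)$ with $\pi(\lambda)_j=\lambda_{j-1}$ for $j\neq0$ and $\pi(\lambda)_0=(-b,-a,c,d)$ if $\lambda_{f-1}=(a,b,c,d)$. Put $X^0(\underline T)=\{\lambda:\langle\lambda,\alpha_j^\vee\rangle=0\ \forall j\}$, $X^0(\underline T_U)=X^*(\underline T_U)\cap X^0(\underline T)$, $\Lambda_{wt}=X^*(\underline T)/X^0(\underline T)$. Let $X_1(\underline T_U)$ (resp. $X_{reg}(\underline T_U)$) be the set of $\lambda\in X^*(\underline T_U)$ with $0\le\langle\lambda,\alpha_j^\vee\rangle\le p-1$ (resp. $<p-1$) for all $j$. For $\lambda=(a_j,b_j)_j\in X_1(\underline T_U)$ let $$F_U(\lambda)=\bigotimes_{j\in\mathcal J}\left(\mathrm{Sym}^{a_j-b_j}(\mathbb F^2)\otimes\det{}^{b_j}\right)^{(j)}$$ be the representation of $U_{1,1}(k)$ on which $g$ acts on the $j$-th factor through $\sigma_j'(g)\in GL_2(\mathbb F)$; up to isomorphism it depends only on $\lambda$ modulo $(p-\pi)X^0(\underline T)$. **The map $\mathfrak t_\mu$.**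 Let $\underline W=\{\pm1\}^{\mathcal J}$, with $-1$ in coordinate $j$ acting on $X^*(\underline T)$ by $\lambda\mapsto\lambda-\langle\lambda,\alpha_j^\vee\rangle\alpha_j$, let $\underline W_{\mathrm{aff}}=(\bigoplus_j\mathbb Z\alpha_j)\rtimes\underline W\subset\underline{\widetilde W}=X^*(\underline T)\rtimes\underline W$, let $t_\lambda\in\underline{\widetilde W}$ be translation by $\lambda$, and let $wt_\lambda\bullet_p x=w(x+p\lambda+\eta)-\eta$. Let $\Omega\subset\underline{\widetilde W}$ be the stabilizer of the alcove $\{x\in X^*(\underline T)\otimes\mathbb R:0<\langle x+\eta,\alpha_j^\vee\rangle<p\ \forall j\}$. For $\mu\in X^*(\underline T_U)$ and $\omega\in X^*(\underline T)$ put $$\mathfrak t_\mu(\omega)=\widetilde w\bullet_p(\mu+\omega)\ \bmod\ (p-\pi)X^0(\underline T),$$ where $\widetilde w$ is the unique element of $\Omega\cap t_{-\pi^{-1}(\omega)}\underline W_{\mathrm{aff}}$. Let $$\Lambda_{wt}^\mu=\{\omega\in\Lambda_{wt}:0\le\langle\mu+\omega,\alpha_j^\vee\rangle<p-1\ \forall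 j\}.$$ **Statement.** Let $\mu\in X^*(\underline T_U)$ and let $\omega,\omega'\in X^*(\underline T_U)$ have images in $\Lambda_{wt}^\mu$. Then $\mathfrak t_\mu(\omega)$ and $\mathfrak t_\mu(\omega')$ are represented by elements of $X_{reg}(\underline T_U)$, and, for any representatives in $X_1(\underline T_U)$, $$\dim_{\mathbb F}\mathrm{Ext}^1_{U_{1,1}(k)}\bigl(F_U(\mathfrak t_\mu(\omega)),F_U(\mathfrak t_\mu(\omega'))\bigr)=\begin{cases}1&\text{if }\omega,\omega'\text{ are adjacent},\\0&\text{otherwise,}\end{cases}$$ where $\omega,\omega'$ are called adjacent if $\omega-\omega'\equiv\pm\rho_j\bmod X^0(\underline T_U)$ for some $j\in\mathcal J$. -/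

import Mathlib

universe u v

namespace UnitarySerre

open scoped TensorProduct

noncomputable section

/-! ### The character lattices of the tori -/

section Lattice

variable (R : Type*) [CommRing R]

/-- The line spanned by `(1,-1,-1,1)` in `R⁴`. -/
def relH : Submodule R (R × R × R × R) := Submodule.span R {(1, -1, -1, 1)}

/-- `X^*(T_H) ⊗ R`: quadruples `(a,b,c,d)` modulo `(a,b,c,d) ∼ (a+z,b-z,c-z,d+z)`.
For `R = ℤ` this is the character lattice of the diagonal torus of
`H = U_{1,1} ×_{PGL_2} GL_2`. -/
abbrev CharH : Type _ := (R × R × R × R) ⧸ relH R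

variable {R}

/-- The class of `(a,b,c,d)`. -/
def mkH (a b c d : R) : CharH R := (relH R).mkQ (a, b, c, d)

/-- A linear form on `R⁴` killing `(1,-1,-1,1)`, such as pairing with the coroot. -/
lemma relH_le_ker {M : Type*} [AddCommGroup M] [Module R M] (g : R × R × R × R →ₗ[R] M)
    (h : g (1, -1, -1, 1) = 0) : relH R ≤ LinearMap.ker g := by
  rw [relH, Submodule.span_le]
  rintro x rfl
  exact h

/-- Pairing with the coroot `α_H^∨ = (1,-1,1,-1)`, that is `(a,b,c,d) ↦ a - b + c - d`. -/
def pairH : CharH R →ₗ[R] R :=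
  (relH R).liftQ
    { toFun := fun x => x.1 - x.2.1 + x.2.2.1 - x.2.2.2
      map_add' := fun x y => by simp only [Prod.fst_add, Prod.snd_add]; ring
      map_smul' := fun r x => by
        simp only [Prod.smul_fst, Prod.smul_snd, smul_eq_mul, RingHom.id_apply]; ring }
    (relH_le_ker _ (by simp))

/-- The root `α_H = (1,-1,0,0)`. -/
def alphaH : CharH R := mkH 1 (-1) 0 0

/-- The twisting element `η_H = (0,0,1,0)`. -/
def etaH : CharH R := mkH 0 0 1 0

@[simp] lemma pairH_mkH (a b c d : R) : pairH (mkH a b c d) = a - b + c - d := rfl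

@[simp] lemma pairH_alphaH : pairH (alphaH : CharH R) = 2 := by
  simp [alphaH]; norm_num

@[simp] lemma pairH_etaH : pairH (etaH : CharH R) = 1 := by
  simp [etaH]

/-- The reflection `x ↦ x - ⟨x, α_H^∨⟩ α_H`, which generates the Weyl group of `(H, T_H)`. -/
def reflH : CharH R →ₗ[R] CharH R := LinearMap.id - pairH.smulRight alphaH

lemma reflH_apply (x : CharH R) : reflH x = x - pairH x • alphaH := rfl

@[simp] lemma pairH_reflH (x : CharH R) : pairH (reflH x) = - pairH x := by
  rw [reflH_apply, map_sub, map_smul, pairH_alphaH, smul_eq_mul]; ring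

@[simp] lemma reflH_reflH (x : CharH R) : reflH (reflH x) = x := by
  rw [reflH_apply (reflH x), pairH_reflH, reflH_apply, neg_smul]; abel

/-- The action of the Weyl group of `(H, T_H)`, written as the group `{1, -1}` of order two. -/
def weylH (s : ℤˣ) : CharH R →ₗ[R] CharH R := if s = 1 then LinearMap.id else reflH

@[simp] lemma weylH_one : (weylH 1 : CharH R →ₗ[R] CharH R) = LinearMap.id := if_pos rfl

@[simp] lemma weylH_neg_one : (weylH (-1) : CharH R →ₗ[R] CharH R) = reflH :=
  if_neg (by decide)

lemma weylH_mul (s t : ℤˣ) (x : CharH R) : weylH (s * t) x = weylH s (weylH t x) := by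
  rcases Int.units_eq_one_or s with rfl | rfl <;> rcases Int.units_eq_one_or t with rfl | rfl <;>
    simp

variable (R) in
/-- The natural map `X^*(T_H) → X^*(T_H) ⊗ R`. -/
def castH : CharH ℤ →ₗ[ℤ] CharH R :=
  (relH ℤ).liftQ
    ({ toFun := fun x => mkH (x.1 : R) (x.2.1 : R) (x.2.2.1 : R) (x.2.2.2 : R)
       map_zero' := by simp only [Prod.fst_zero, Prod.snd_zero, Int.cast_zero]; exact map_zero (relH R).mkQ
       map_add' := fun x y => by
        simp only [mkH, ← map_add, Prod.fst_add, Prod.snd_add, Int.cast_add, Prod.mk_add_mk] } :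
      (ℤ × ℤ × ℤ × ℤ) →+ CharH R).toIntLinearMap
    (relH_le_ker _ (by
      have : ((1, -1, -1, 1) : R × R × R × R) ∈ relH R := Submodule.mem_span_singleton_self _
      simpa [mkH] using this))

lemma exists_mkH (x : CharH R) : ∃ a b c d : R, x = mkH a b c d := by
  obtain ⟨⟨a, b, c, d⟩, rfl⟩ := (relH R).mkQ_surjective x
  exact ⟨a, b, c, d, rfl⟩

lemma pairH_castH (x : CharH ℤ) : pairH (castH R x) = ((pairH x : ℤ) : R) := by
  obtain ⟨a, b, c, d, rfl⟩ := exists_mkH x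
  change ((a : R) - b + c - d) = ((a - b + c - d : ℤ) : R)
  push_cast; ring

/-- The action `(a,b,c,d) ↦ (-b,-a,c,d)` of the Frobenius of `K` on `X^*(T_H)`. -/
def frobH : CharH ℤ →ₗ[ℤ] CharH ℤ :=
  (relH ℤ).liftQ
    ((relH ℤ).mkQ ∘ₗ
      { toFun := fun x => (-x.2.1, -x.1, x.2.2.1, x.2.2.2)
        map_add' := fun x y => by ext <;> simp <;> ring
        map_smul' := fun r x => by ext <;> simp })
    (relH_le_ker _ (by
      have : ((1, -1, -1, 1) : ℤ × ℤ × ℤ × ℤ) ∈ relH ℤ := Submodule.mem_span_singleton_self _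
      simpa using this))

lemma frobH_frobH (x : CharH ℤ) : frobH (frobH x) = x := by
  obtain ⟨a, b, c, d, rfl⟩ := exists_mkH x
  change mkH (- -a) (- -b) c d = mkH a b c d
  rw [neg_neg, neg_neg]

end Lattice

section Weights

variable (f : ℕ)

/-- The set of embeddings `𝒥` is identified with `Fin f`; indices are taken modulo `f`.
`X^*(T) = ∏_{j} X^*(T_H)`. -/
abbrev XT : Type := Fin f → CharH ℤ

/-- `X^*(T_U) = ∏_j ℤ²`. -/
abbrev XU : Type := Fin f → ℤ × ℤ

variable {f}

/-- The inclusion `X^*(T_U) → X^*(T)`, `(a,b) ↦ (a,b,0,0)` in each embedding. -/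
def inclU : XU f →+ XT f where
  toFun lam j := mkH (lam j).1 (lam j).2 0 0
  map_zero' := by ext j; exact map_zero (relH ℤ).mkQ
  map_add' x y := by
    ext j; simp only [mkH, Pi.add_apply, ← map_add, Prod.fst_add, Prod.snd_add, Prod.mk_add_mk,
      add_zero]

/-- The automorphism `π` of `X^*(T)` given by the arithmetic Frobenius: it shifts the
embeddings by one to the right, and applies `(a,b,c,d) ↦ (-b,-a,c,d)` when passing from the
last embedding to the zeroth one. -/
def frobX [NeZero f] : XT f ≃+ XT f where
  toFun x j := if j = 0 then frobH (x (j - 1)) else x (j - 1)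
  invFun x j := if j + 1 = 0 then frobH (x (j + 1)) else x (j + 1)
  left_inv x := by ext j; by_cases h : j + 1 = 0 <;> simp [h, frobH_frobH]
                   rw [← eq_neg_iff_add_eq_zero.mpr h]
  right_inv x := by ext j; by_cases h : j = 0 <;> simp [h, frobH_frobH]
  map_add' x y := by ext j; by_cases h : j = 0 <;> simp [h]

/-- `X^0(T)`: the characters orthogonal to all coroots. -/
def X0 : AddSubgroup (XT f) where
  carrier := {lam | ∀ j, pairH (lam j) = 0}
  zero_mem' := by simp
  add_mem' hx hy j := by simp [hx j, hy j]
  neg_mem' hx j := by simp [hx j]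

/-- `(p - π) X^0(T)`. -/
def pSubPiX0 (p : ℕ) [NeZero f] : AddSubgroup (XT f) :=
  (X0 (f := f)).map (p • AddMonoidHom.id (XT f) - (frobX (f := f)).toAddMonoidHom)

/-- `X^0(T_U)`. -/
def X0U : AddSubgroup (XU f) := (X0 (f := f)).comap inclU

/-- The `p`-restricted characters `X_1(T_U) = X^*(T_U) ∩ X_1(T)`. -/
def X1U (p : ℕ) : Set (XU f) :=
  {lam | ∀ j, 0 ≤ pairH (inclU lam j) ∧ pairH (inclU lam j) ≤ p - 1}

/-- The regular characters `X_reg(T_U) = X^*(T_U) ∩ X_reg(T)`. -/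
def XregU (p : ℕ) : Set (XU f) :=
  {lam | ∀ j, 0 ≤ pairH (inclU lam j) ∧ pairH (inclU lam j) < p - 1}

/-- `ρ_j`, equal to `(1,0)` in embedding `j` and to `0` elsewhere. -/
def rhoU (j : Fin f) : XU f := Pi.single j (1, 0)

/-! ### The extension graph -/

variable (f) in
/-- The weight lattice `Λ_wt = X^*(T) / X^0(T)`. -/
abbrev LambdaWt : Type := XT f ⧸ X0 (f := f)

/-- The pairing of `Λ_wt` with the coroot `α_j^∨`. -/
def pairWt (j : Fin f) : LambdaWt f →+ ℤ :=
  QuotientAddGroup.lift X0 (pairH.toAddMonoidHom.comp (Pi.evalAddMonoidHom _ j))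
    (fun _ hx => hx j)

/-- The recentered extension graph `Λ_wt^μ`. -/
def LambdaWtMu (p : ℕ) (mu : XT f) : Set (LambdaWt f) :=
  {om | ∀ j, 0 ≤ pairWt j ((mu : LambdaWt f) + om) ∧ pairWt j ((mu : LambdaWt f) + om) < p - 1}

/-- The class in `Λ_wt` of a character in `X^*(T_U)`. -/
def wtU (om : XU f) : LambdaWt f := QuotientAddGroup.mk (inclU om)

/-- The class in `X^*(T) / (p - π) X^0(T)` of a character in `X^*(T_U)`. -/
def classU (p : ℕ) [NeZero f] (lam : XU f) : XT f ⧸ pSubPiX0 (f := f) p :=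
  QuotientAddGroup.mk (inclU lam)

/-- Adjacency of two vertices: `ω - ω' ≡ ± ρ_j` modulo `X^0(T_U)` for some `j`. -/
def Adjacent (om om' : XU f) : Prop :=
  ∃ j, om - om' - rhoU j ∈ X0U (f := f) ∨ om - om' + rhoU j ∈ X0U (f := f)

/-! ### Affine Weyl groups and the map `t_μ` -/

variable (f) in
/-- The Weyl group `W^f`. -/
abbrev Weyl : Type := Fin f → ℤˣ

/-- The action of the Weyl group on `X^*(T) ⊗ R`. -/
def weylAct {R : Type*} [CommRing R] (w : Weyl f) (x : Fin f → CharH R) : Fin f → CharH R :=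
  fun j => weylH (w j) (x j)

lemma weylAct_mul {R : Type*} [CommRing R] (w v : Weyl f) (x : Fin f → CharH R) :
    weylAct (w * v) x = weylAct w (weylAct v x) :=
  funext fun _ => weylH_mul _ _ _

lemma weylAct_one {R : Type*} [CommRing R] (x : Fin f → CharH R) : weylAct 1 x = x := by
  ext j; simp [weylAct]

variable (f) in
/-- The action of the Weyl group on `X^*(T)` by group automorphisms. -/
def weylHom : Weyl f →* MulAut (Multiplicative (XT f)) where
  toFun w := AddEquiv.toMultiplicative
    { toFun := weylAct w
      invFun := weylAct w⁻¹
      left_inv := fun x => by rw [← weylAct_mul, inv_mul_cancel, weylAct_one]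
      right_inv := fun x => by rw [← weylAct_mul, mul_inv_cancel, weylAct_one]
      map_add' := fun x y => by ext j; simp [weylAct] }
  map_one' := MulEquiv.ext fun x => congrArg Multiplicative.ofAdd (weylAct_one x.toAdd)
  map_mul' w v := MulEquiv.ext fun x =>
    congrArg Multiplicative.ofAdd (weylAct_mul w v x.toAdd)

variable (f) in
/-- The extended affine Weyl group `X^*(T) ⋊ W`. -/
abbrev ExtAffWeyl : Type := Multiplicative (XT f) ⋊[weylHom f] Weyl f

/-- The translation `t_λ`. -/
def transl (lam : XT f) : ExtAffWeyl f := SemidirectProduct.inl (Multiplicative.ofAdd lam)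

variable (f) in
/-- The root lattice `Λ_rt`. -/
def LambdaRt : AddSubgroup (XT f) :=
  AddSubgroup.closure (Set.range fun j : Fin f => Pi.single j alphaH)

variable (f) in
/-- The affine Weyl group `Λ_rt ⋊ W`, as a subset of the extended affine Weyl group. -/
def affWeyl : Set (ExtAffWeyl f) := {w | w.left.toAdd ∈ LambdaRt f}

/-- The `p`-dilated dot action on `X^*(T) ⊗ R`: the element `t_λ w = w t_{w⁻¹λ}` sends `x` to
`w (x + p w⁻¹ λ + η) - η = w (x + η) + p λ - η`. -/
def dot (R : Type*) [CommRing R] (p : ℕ) (w : ExtAffWeyl f) (x : Fin f → CharH R) :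
    Fin f → CharH R :=
  fun j => weylAct w.right (x + fun _ => etaH) j + (p : R) • castH R (w.left.toAdd j) - etaH

/-- The fundamental `p`-alcove in `X^*(T) ⊗ ℝ`. -/
def fundAlcove (p : ℕ) : Set (Fin f → CharH ℝ) :=
  {x | ∀ j, 0 < pairH (x j + etaH) ∧ pairH (x j + etaH) < (p : ℝ)}

/-- `Ω`, the stabilizer of the fundamental `p`-alcove under the `p`-dilated dot action. -/
def Omega (p : ℕ) : Set (ExtAffWeyl f) := {w | dot ℝ p w '' fundAlcove p = fundAlcove p}

/-- `Ω ∩ t_{-π⁻¹(ω)} W_aff`. -/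
def OmegaCoset (p : ℕ) [NeZero f] (om : XT f) : Set (ExtAffWeyl f) :=
  Omega p ∩ {w | ∃ v ∈ affWeyl f, w = transl (-(frobX.symm om)) * v}

lemma castH_int (x : CharH ℤ) : castH ℤ x = x := by
  obtain ⟨a, b, c, d, rfl⟩ := exists_mkH x
  rfl

lemma mem_LambdaRt {r : XT f} : r ∈ LambdaRt f ↔ ∀ j, ∃ m : ℤ, r j = m • alphaH := by
  constructor
  · intro h
    induction h using AddSubgroup.closure_induction with
    | mem x hx =>
      obtain ⟨i, rfl⟩ := hx
      intro j
      by_cases hij : j = i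
      · subst hij; exact ⟨1, by simp⟩
      · exact ⟨0, by simp [hij]⟩
    | zero => exact fun j => ⟨0, by simp⟩
    | add x y _ _ hx hy =>
      intro j
      obtain ⟨m, hm⟩ := hx j
      obtain ⟨n, hn⟩ := hy j
      exact ⟨m + n, by rw [Pi.add_apply, hm, hn, add_smul]⟩
    | neg x _ hx =>
      intro j
      obtain ⟨m, hm⟩ := hx j
      exact ⟨-m, by rw [Pi.neg_apply, hm, neg_smul]⟩
  · intro h
    choose m hm using h
    have : r = ∑ j, m j • (Pi.single j alphaH : XT f) := by
      ext i
      rw [Finset.sum_apply, Finset.sum_eq_single i]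
      · simp [hm]
      · intro b _ hb; simp [Ne.symm hb]
      · simp
    rw [this]
    exact sum_mem fun j _ => zsmul_mem (AddSubgroup.subset_closure (Set.mem_range_self j)) _

lemma pairH_weylH {R : Type*} [CommRing R] (s : ℤˣ) (x : CharH R) :
    pairH (weylH s x) = ((s : ℤ) : R) * pairH x := by
  rcases Int.units_eq_one_or s with rfl | rfl <;> simp

lemma pairH_dot {R : Type*} [CommRing R] (p : ℕ) (w : ExtAffWeyl f) (x : Fin f → CharH R)
    (j : Fin f) : pairH (dot R p w x j + etaH) =
      ((w.right j : ℤ) : R) * pairH (x j + etaH) + p * ((pairH (w.left.toAdd j) : ℤ) : R) := by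
  rw [dot, sub_add_cancel, map_add, map_smul, pairH_castH, weylAct, pairH_weylH, smul_eq_mul,
    Pi.add_apply]

lemma mem_Omega {p : ℕ} (hp : 0 < p) (w : ExtAffWeyl f) : w ∈ Omega p ↔
    ∀ j, (w.right j = 1 ∧ pairH (w.left.toAdd j) = 0) ∨
      (w.right j = -1 ∧ pairH (w.left.toAdd j) = 1) := by
  have hp' : (0 : ℝ) < p := by exact_mod_cast hp
  constructor
  · intro h j
    have hx : (fun _ => ((p : ℝ) / 3 - 1) • etaH : Fin f → CharH ℝ) ∈ fundAlcove p := by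
      intro i
      simp only [map_add, map_smul, pairH_etaH, smul_eq_mul]
      constructor <;> linarith
    have h2 := (show dot ℝ p w '' fundAlcove p = fundAlcove p from h) ▸ Set.mem_image_of_mem _ hx
    obtain ⟨h3, h4⟩ := h2 j
    rw [pairH_dot] at h3 h4
    simp only [map_add, map_smul, pairH_etaH, smul_eq_mul] at h3 h4
    set n := pairH (w.left.toAdd j) with hn
    rcases Int.units_eq_one_or (w.right j) with hs | hs
    · left
      refine ⟨hs, ?_⟩
      rw [hs] at h3 h4
      simp only [Units.val_one, Int.cast_one] at h3 h4
      have h5 : (-1 : ℝ) < n := by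
        by_contra! hc
        nlinarith
      have h6 : (n : ℝ) < 1 := by
        by_contra! hc
        nlinarith
      have h5' : (-1 : ℤ) < n := by exact_mod_cast h5
      have h6' : n < 1 := by exact_mod_cast h6
      omega
    · right
      refine ⟨hs, ?_⟩
      rw [hs] at h3 h4
      simp only [Units.val_neg, Units.val_one, Int.cast_neg, Int.cast_one] at h3 h4
      have h5 : (0 : ℝ) < n := by
        by_contra! hc
        nlinarith
      have h6 : (n : ℝ) < 2 := by
        by_contra! hc
        nlinarith
      have h5' : (0 : ℤ) < n := by exact_mod_cast h5
      have h6' : n < 2 := by exact_mod_cast h6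
      omega
  · intro h
    apply Set.Subset.antisymm
    · rintro _ ⟨x, hx, rfl⟩ j
      rw [pairH_dot]
      obtain ⟨h1, h2⟩ := hx j
      rcases h j with ⟨hs, hn⟩ | ⟨hs, hn⟩
      · rw [hs, hn]
        simp only [Units.val_one, Int.cast_one, Int.cast_zero]
        constructor <;> linarith
      · rw [hs, hn]
        simp only [Units.val_neg, Units.val_one, Int.cast_neg, Int.cast_one]
        constructor <;> linarith
    · intro x hx
      refine ⟨fun j => weylH (w.right j) (x j + etaH - (p : ℝ) • castH ℝ (w.left.toAdd j)) - etaH,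
        ?_, ?_⟩
      · intro j
        rw [sub_add_cancel, pairH_weylH, map_sub, map_smul, pairH_castH, smul_eq_mul]
        obtain ⟨h1, h2⟩ := hx j
        rcases h j with ⟨hs, hn⟩ | ⟨hs, hn⟩
        · rw [hs, hn]
          simp only [Units.val_one, Int.cast_one, Int.cast_zero]
          constructor <;> linarith
        · rw [hs, hn]
          simp only [Units.val_neg, Units.val_one, Int.cast_neg, Int.cast_one]
          constructor <;> linarith
      · ext j
        rw [dot, weylAct, Pi.add_apply, sub_add_cancel, ← weylH_mul, Int.units_mul_self, weylH_one,
          LinearMap.id_apply]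
        abel

/-- `Ω ∩ t_{-π⁻¹(ω)} W_aff` consists of exactly one element. -/
lemma existsUnique_mem_OmegaCoset {p : ℕ} (hp : 0 < p) [NeZero f] (om : XT f) :
    ∃! w, w ∈ OmegaCoset p om := by
  have key : ∀ w : ExtAffWeyl f, w ∈ OmegaCoset p om ↔ ∀ j,
      ((w.right j = 1 ∧ pairH (w.left.toAdd j) = 0) ∨
        (w.right j = -1 ∧ pairH (w.left.toAdd j) = 1)) ∧
      ∃ m : ℤ, w.left.toAdd j = -(frobX.symm om) j + m • alphaH := by
    intro w
    rw [forall_and, ← mem_Omega hp, OmegaCoset, Set.mem_inter_iff, Set.mem_ofPred_eq]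
    refine and_congr_right fun _ => ?_
    constructor
    · rintro ⟨v, hv, rfl⟩ j
      obtain ⟨m, hm⟩ := mem_LambdaRt.1 hv j
      refine ⟨m, ?_⟩
      rw [← hm]
      simp [transl]
    · intro h
      refine ⟨(transl (-(frobX.symm om)))⁻¹ * w, ?_, by rw [mul_inv_cancel_left]⟩
      refine mem_LambdaRt.2 fun j => ?_
      obtain ⟨m, hm⟩ := h j
      refine ⟨m, ?_⟩
      have : ((transl (-(frobX.symm om)))⁻¹ * w).left.toAdd j =
          (frobX.symm om) j + w.left.toAdd j := by
        rw [transl, ← map_inv]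
        simp
      rw [this, hm]
      simp
  set nu : XT f := -(frobX.symm om) with hnu
  have hnu' : ∀ j, -(frobX.symm om) j = nu j := fun j => rfl
  refine ⟨⟨Multiplicative.ofAdd fun j => nu j +
      (if Even (pairH (nu j)) then -(pairH (nu j) / 2) else (1 - pairH (nu j)) / 2) • alphaH,
      fun j => if Even (pairH (nu j)) then 1 else -1⟩, (key _).2 fun j => ?_, ?_⟩
  · refine ⟨?_, _, rfl⟩
    by_cases he : Even (pairH (nu j))
    · left
      simp only [he, if_true, toAdd_ofAdd, map_add, map_smul, pairH_alphaH, smul_eq_mul, true_and]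
      obtain ⟨k, hk⟩ := he
      omega
    · right
      simp only [he, if_false, toAdd_ofAdd, map_add, map_smul, pairH_alphaH, smul_eq_mul, true_and]
      obtain ⟨k, hk⟩ := Int.not_even_iff_odd.1 he
      omega
  · intro w hw
    have hw' := (key w).1 hw
    apply SemidirectProduct.ext
    · apply Multiplicative.toAdd.injective
      ext1 j
      obtain ⟨h1, m, hm⟩ := hw' j
      rw [hnu'] at hm
      rw [hm, map_add, map_smul, pairH_alphaH, smul_eq_mul] at h1
      simp only [toAdd_ofAdd, hm]
      congr 2
      split_ifs with he
      · obtain ⟨k, hk⟩ := he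
        omega
      · obtain ⟨k, hk⟩ := Int.not_even_iff_odd.1 he
        omega
    · ext1 j
      obtain ⟨h1, m, hm⟩ := hw' j
      rw [hnu'] at hm
      rw [hm, map_add, map_smul, pairH_alphaH, smul_eq_mul] at h1
      change w.right j = if Even (pairH (nu j)) then 1 else -1
      split_ifs with he
      · obtain ⟨k, hk⟩ := he
        rcases h1 with h1 | h1
        · exact h1.1
        · omega
      · obtain ⟨k, hk⟩ := Int.not_even_iff_odd.1 he
        rcases h1 with h1 | h1
        · omega
        · exact h1.1

/-- The unique element of `Ω ∩ t_{-π⁻¹(ω)} W_aff`. -/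
def wTilde (p : ℕ) [Fact p.Prime] [NeZero f] (om : XT f) : ExtAffWeyl f :=
  (existsUnique_mem_OmegaCoset (Fact.out (p := p.Prime)).pos om).choose

/-- `t'_μ : X^*(T) → X^*(T) / (p - π) X^0(T)`, `ω ↦ w̃ • (μ + ω)`. Its value depends only on the
class of `ω` in `Λ_wt`, and its restriction to `Λ_wt^μ` is the map `t_μ`. -/
def tMu (p : ℕ) [Fact p.Prime] [NeZero f] (mu : XU f) (om : XT f) : XT f ⧸ pSubPiX0 (f := f) p :=
  QuotientAddGroup.mk (dot ℤ p (wTilde p om) (inclU mu + om))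

end Weights

/-! ### Serre weights of `U_{1,1}(k_K)` -/

section Representations

/-- `U_{1,1}(k)`, the unitary group of the quadratic extension `l` of the finite field `k`: the
matrices `g ∈ GL_2(l)` with `(gᵠ)ᵀ Φ₂ g = Φ₂`, where `φ` is the map `x ↦ x^q`, `q = |k|`, and
`Φ₂ = (0 1; -1 0)`. -/
def U11 (k : Type v) (l : Type u) [Field k] [Fintype k] [Field l] [Algebra k l] :
    Subgroup (GL (Fin 2) l) where
  carrier := {g | ((g : Matrix (Fin 2) (Fin 2) l).map (FiniteField.frobeniusAlgHom k l)).transpose *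
    !![0, 1; -1, 0] * (g : Matrix (Fin 2) (Fin 2) l) = !![0, 1; -1, 0]}
  one_mem' := by simp
  mul_mem' {a b} ha hb := by
    simp only [Set.mem_ofPred_eq, Units.val_mul, Matrix.map_mul, Matrix.transpose_mul] at *
    calc _ = ((b : Matrix (Fin 2) (Fin 2) l).map (FiniteField.frobeniusAlgHom k l)).transpose *
          (((a : Matrix (Fin 2) (Fin 2) l).map (FiniteField.frobeniusAlgHom k l)).transpose *
          !![0, 1; -1, 0] * (a : Matrix (Fin 2) (Fin 2) l)) * (b : Matrix (Fin 2) (Fin 2) l) := by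
          simp only [Matrix.mul_assoc]
      _ = _ := by rw [ha, hb]
  inv_mem' {a} ha := by
    simp only [Set.mem_ofPred_eq] at *
    have h1 : (a : Matrix (Fin 2) (Fin 2) l) * ((a⁻¹ : GL (Fin 2) l) : Matrix (Fin 2) (Fin 2) l) = 1 :=
      a.mul_inv
    have h2 : (((a⁻¹ : GL (Fin 2) l) : Matrix (Fin 2) (Fin 2) l).map
          (FiniteField.frobeniusAlgHom k l)).transpose *
        ((a : Matrix (Fin 2) (Fin 2) l).map (FiniteField.frobeniusAlgHom k l)).transpose = 1 := by
      rw [← Matrix.transpose_mul, ← Matrix.map_mul, h1]; simp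
    conv_lhs => rw [← ha]
    calc _ = ((((a⁻¹ : GL (Fin 2) l) : Matrix (Fin 2) (Fin 2) l).map
          (FiniteField.frobeniusAlgHom k l)).transpose *
        ((a : Matrix (Fin 2) (Fin 2) l).map (FiniteField.frobeniusAlgHom k l)).transpose) *
        !![0, 1; -1, 0] * ((a : Matrix (Fin 2) (Fin 2) l) *
          ((a⁻¹ : GL (Fin 2) l) : Matrix (Fin 2) (Fin 2) l)) := by simp only [Matrix.mul_assoc]
      _ = _ := by rw [h1, h2, Matrix.one_mul, Matrix.mul_one]

open MvPolynomial in
/-- The linear substitution `X_j ↦ ∑_i a_{ij} X_i` on `F[X₀, X₁]`. -/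
def linSubst (F : Type u) [Field F] (A : Matrix (Fin 2) (Fin 2) F) :
    MvPolynomial (Fin 2) F →ₐ[F] MvPolynomial (Fin 2) F :=
  aeval fun j => ∑ i, C (A i j) * X i

open MvPolynomial in
lemma linSubst_one (F : Type u) [Field F] : linSubst F 1 = AlgHom.id F _ := by
  apply MvPolynomial.algHom_ext
  intro j
  rw [linSubst, aeval_X, Finset.sum_eq_single j] <;> simp +contextual

open MvPolynomial in
lemma linSubst_mul (F : Type u) [Field F] (A B : Matrix (Fin 2) (Fin 2) F) :
    linSubst F (A * B) = (linSubst F A).comp (linSubst F B) := by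
  apply MvPolynomial.algHom_ext
  intro j
  simp only [linSubst, AlgHom.comp_apply, aeval_X, Matrix.mul_apply, Fin.sum_univ_two, map_add,
    map_mul, ← algebraMap_eq, AlgHom.commutes]
  ring

open MvPolynomial in
lemma linSubst_mem {F : Type u} [Field F] (A : Matrix (Fin 2) (Fin 2) F) {r : ℕ}
    {P : MvPolynomial (Fin 2) F} (hP : P ∈ homogeneousSubmodule (Fin 2) F r) :
    linSubst F A P ∈ homogeneousSubmodule (Fin 2) F r := by
  have h := IsHomogeneous.aeval (n := 1) (m := r) hP
    (fun j => ∑ i, C (A i j) * X i : Fin 2 → MvPolynomial (Fin 2) F)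
    (fun j => IsHomogeneous.sum _ _ _ fun i _ => isHomogeneous_C_mul_X _ _)
  rw [one_mul] at h
  exact h

/-- `Sym^r` of the standard representation of `GL_2(F)` on `F² = F X₀ ⊕ F X₁`: the homogeneous
polynomials of degree `r` in `X₀, X₁`, with `g X_j = ∑_i g_{ij} X_i`. -/
def symRep (F : Type u) [Field F] (r : ℕ) :
    Representation F (GL (Fin 2) F) (MvPolynomial.homogeneousSubmodule (Fin 2) F r) where
  toFun g := (linSubst F (g : Matrix (Fin 2) (Fin 2) F)).toLinearMap.restrict
    (fun _ hP => linSubst_mem _ hP)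
  map_one' := by
    ext1 P
    apply Subtype.ext
    change linSubst F ((1 : GL (Fin 2) F) : Matrix (Fin 2) (Fin 2) F) P = P
    rw [Units.val_one, linSubst_one, AlgHom.id_apply]
  map_mul' g h := by
    ext1 P
    apply Subtype.ext
    change linSubst F ((g * h : GL (Fin 2) F) : Matrix (Fin 2) (Fin 2) F) P =
      linSubst F (g : Matrix (Fin 2) (Fin 2) F) (linSubst F (h : Matrix (Fin 2) (Fin 2) F) P)
    rw [Units.val_mul, linSubst_mul, AlgHom.comp_apply]

/-- The irreducible algebraic representation of `GL_2` of highest weight `(a,b)`, for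
`0 ≤ a - b ≤ p - 1`, on `F`-points: `Sym^{a-b}(F²) ⊗ det^b`. -/
def algRep (F : Type u) [Field F] (lam : ℤ × ℤ) :
    Representation F (GL (Fin 2) F)
      (MvPolynomial.homogeneousSubmodule (Fin 2) F (lam.1 - lam.2).toNat) where
  toFun g := ((Matrix.GeneralLinearGroup.det g ^ lam.2 : Fˣ) : F) • symRep F _ g
  map_one' := by simp
  map_mul' g h := by
    simp only [map_mul, mul_zpow, Units.val_mul, smul_mul_smul_comm]

variable {k : Type v} {l F : Type u} [Field k] [Fintype k] [Field l] [Algebra k l] [Field F]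

/-- The representation `⨂_{0 ≤ j < f} (Sym^{a_j-b_j} ⊗ det^{b_j})^{(j)}` of `U_{1,1}(k)`, where
`GL_2(l)` acts on the `j`-th factor through the embedding `σ'_j = σ'_0 ∘ φ^j` of `l` in `F`. -/
def serreRep (p : ℕ) [ExpChar l p] {f : ℕ} (σ₀' : l →+* F) (lam : XU f) :
    Representation F (U11 k l)
      (⨂[F] j : Fin f,
        MvPolynomial.homogeneousSubmodule (Fin 2) F ((lam j).1 - (lam j).2).toNat) where
  toFun g := PiTensorProduct.map fun j => algRep F (lam j)
    (Matrix.GeneralLinearGroup.map (σ₀'.comp (iterateFrobenius l p j)) (g : GL (Fin 2) l))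
  map_one' := by
    simp only [OneMemClass.coe_one, map_one]
    exact PiTensorProduct.map_one
  map_mul' g h := by
    simp only [Subgroup.coe_mul, map_mul]
    exact PiTensorProduct.map_mul _ _

variable (k) in
/-- The Serre weight `F_U(λ)` of `U_{1,1}(k)`, for `λ ∈ X_1(T_U)`. -/
def serreWeight (p : ℕ) [ExpChar l p] {f : ℕ} (σ₀' : l →+* F) (lam : XU f) :
    Rep.{u} F (U11 k l) :=
  Rep.of (X := ⨂[F] j : Fin f,
    MvPolynomial.homogeneousSubmodule (Fin 2) F ((lam j).1 - (lam j).2).toNat)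
    (serreRep (k := k) p σ₀' lam)

/-- `dim_F Ext^1_G(V, W)`, the extension group being taken in the category of `F`-linear
representations of `G`. -/
def dimExt1 {G : Type u} [Group G] (V W : Rep.{u} F G) : Cardinal :=
  Module.rank F (((Ext F (Rep.{u} F G) 1).obj (Opposite.op V)).obj W)

end Representations

end

end UnitarySerre

open UnitarySerre

/-!
The dimension of `Ext¹` is computed with cocycles. Let `V` and `W` be the two Serre weights, with
digits `r_j` and `r'_j`. An extension of `V` by `W` is given by a map `c : U_{1,1}(k) → Hom(V, W)`
satisfying a cocycle relation, and `Ext¹` is the space of these cocycles modulo coboundaries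
(`dimExt1_eq_rank`). The tensor product defining a Serre weight is replaced by the multihomogeneous
polynomials of multidegree `r` in pairs of variables `X_{j0}, X_{j1}` (`serreEquiv`).

**Upper bound.** The diagonal torus has order `q² - 1`, which is prime to `p`, so a cocycle may be
assumed to vanish on it (`exists_torusCocycle`). Let `v` be the highest weight vector of `V` and `ξ`
the form on `W` invariant under the lower unipotent group, which is dual to the highest weight
vector. Equivariance under the torus makes the functions `y ↦ ξ(c(g) v)` with `g` upper or lower
unipotent with entry `y` homogeneous, `C y^m` and `C' y^{m'}`, where `m` and `m'` are determined
modulo `q - 1` by the highest weights. By the cocycle relation, all monomials of `(y + 1)^m - y^m`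
occur among the monomials of `W`, whose exponents are the `∑ d_j p^j` with `d_j ≤ r'_j`. Hence `m`
is itself such an exponent, in which case a coboundary removes the function, or
`m = (r'_j + 1) p^j` for some `j` (`digits_of_choose`, `digits_of_form_cocycle_ne_zero`), and dually
for `m'`. If both functions vanish, then `g ↦ ξ(c(g) v)` vanishes on the big cell and is determined
by its value at the Weyl element. If this value vanishes too, then `c` is a coboundary
(`mem_extCoboundaries_of_form_eq_zero`), because `v` generates `V` and the translates of `ξ`
separate the points of `W`. If it does not, then the translates of `ξ` on the extension give all
functions on `k`, so `q ≤ dim V + dim W` (`card_le_of_form_weylElt_ne_zero`), which forces `f = 1`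
and `r_0 + r'_0 = p - 1`. For `f = 1`, finite differences in the unipotent direction give the
remaining relations between the three constants (`form_upper_eq_zero_of_prime`,
`form_lower_eq_zero_of_form_upper`). Altogether the dimension is at most one, and zero unless one
of finitely many congruences holds (`rank_extClasses_eq_zero_of_weights`,
`rank_extClasses_eq_one_of_weights`).

**The graph.** The map `t_μ` is made explicit: the digits of `t_μ(ω)` are `⟨μ + ω, α_j^∨⟩` or
`p - 2 - ⟨μ + ω, α_j^∨⟩` according to the parity of `⟨ω, α_{j+1}^∨⟩` (`graphDigit`,
`pairU_of_classU_eq`), and the restriction of `t_μ(ω)` to the torus is that of `μ` times an explicit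
power of the norm (`graphShift`, `charExp_of_classU_eq`). Thus `m` is congruent modulo `q - 1` to
the difference of two of these exponents. If `f ≠ 1` and `m = (r'_j + 1) p^j`, doubling this
congruence and carrying once into position `j + 1` leaves a combination of the powers of `p` with
coefficients of absolute value less than `p`, which must vanish termwise; together with the parities
this says that `ω` and `ω'` differ by `± ρ_{j+1}` (`GraphDigits.adjacent_of_modEq`). It also follows
that `m` and `m'` cannot both be exceptional (`GraphDigits.not_modEq_and_modEq`). The case `f = 1`
is treated directly.

**Lower bound.** If `ω` and `ω'` are adjacent, there are `j` and `s` with `r_j + s + 2 = p` such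
that `r'` is obtained from `r` by replacing `r_j` by `s` and changing the digit in position `j + 1`
by one (`GraphDigits.digits_of_adjacent`). The subspace of `Sym^{p+s}` generated by the `p`-th
powers of the variables is the tensor product of `Sym^s` with the Frobenius twist of the standard
representation, and the quotient is `Sym^{p-2-s} ⊗ det^{s+1}`, by the explicit projection `slotProj`
(`slot_decomposition`, `slotProj_polyRep`). With `Sym^{p+s}` in position `j`, the twisted standard
representation belongs to position `j + 1`; multiplication by the variables, or differentiation, in
this position maps the subspace to `W`, and pushing out gives an extension of `V` by `W` up to a
power of the determinant, which is the right one by `GraphDigits.det_modEq`. The matrix coefficients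
of its cocycle `slotCocycle` are monomials, from which one reads off that it does not split
(`slotCocycle_X_not_mem`, `slotCocycle_pderiv_not_mem`).
-/


/-! ### Extensions of representations and cocycles -/

section

open CategoryTheory

section ExtensionCocycles

variable {F G V W : Type*} [Field F] [Group G] [AddCommGroup V] [Module F V]
  [AddCommGroup W] [Module F W]

/-- The cocycles describing extensions of `ρ` by `τ`: the maps `c : G → Hom(V, W)` for which
`(τ, c; 0, ρ)` is a block upper triangular representation on `W × V`. -/
def extCocycles (ρ : Representation F G V) (τ : Representation F G W) :
    Submodule F (G → V →ₗ[F] W) where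
  carrier := {c | ∀ g h, c (g * h) = τ g ∘ₗ c h + c g ∘ₗ ρ h}
  zero_mem' := by intro g h; simp
  add_mem' := by
    intro a b ha hb g h
    simp only [Pi.add_apply, ha g h, hb g h, LinearMap.comp_add, LinearMap.add_comp]
    abel
  smul_mem' := by
    intro r a ha g h
    simp only [Pi.smul_apply, ha g h, LinearMap.comp_smul, LinearMap.smul_comp, smul_add]

/-- The coboundary `g ↦ τ(g) φ - φ ρ(g)` of a linear map `φ`, as a linear function of `φ`. -/
def extBoundary (ρ : Representation F G V) (τ : Representation F G W) :
    (V →ₗ[F] W) →ₗ[F] (G → V →ₗ[F] W) where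
  toFun φ g := τ g ∘ₗ φ - φ ∘ₗ ρ g
  map_add' a b := by
    ext g v; simp; abel
  map_smul' r a := by
    ext g v; simp [smul_sub]

@[simp] lemma extBoundary_apply (ρ : Representation F G V) (τ : Representation F G W)
    (φ : V →ₗ[F] W) (g : G) (v : V) : extBoundary ρ τ φ g v = τ g (φ v) - φ (ρ g v) := rfl

/-- The cocycles of the split extensions. -/
def extCoboundaries (ρ : Representation F G V) (τ : Representation F G W) :
    Submodule F (G → V →ₗ[F] W) := LinearMap.range (extBoundary ρ τ)

lemma mem_extCoboundaries {ρ : Representation F G V} {τ : Representation F G W}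
    {c : G → V →ₗ[F] W} :
    c ∈ extCoboundaries ρ τ ↔ ∃ φ : V →ₗ[F] W, ∀ g v, c g v = τ g (φ v) - φ (ρ g v) := by
  constructor
  · rintro ⟨φ, rfl⟩
    exact ⟨φ, fun g v => rfl⟩
  · rintro ⟨φ, h⟩
    exact ⟨φ, by ext g v; rw [h, extBoundary_apply]⟩

lemma extCocycles_apply {ρ : Representation F G V} {τ : Representation F G W}
    {c : G → V →ₗ[F] W} (hc : c ∈ extCocycles ρ τ) (g h : G) (v : V) :
    c (g * h) v = τ g (c h v) + c g (ρ h v) := by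
  rw [hc g h]; rfl

lemma extCoboundaries_le (ρ : Representation F G V) (τ : Representation F G W) :
    extCoboundaries ρ τ ≤ extCocycles ρ τ := by
  rintro _ ⟨φ, rfl⟩ g h
  ext v
  simp

/-- The classes of extension cocycles modulo coboundaries. -/
abbrev ExtClasses (ρ : Representation F G V) (τ : Representation F G W) : Type _ :=
  extCocycles ρ τ ⧸ (extCoboundaries ρ τ).submoduleOf (extCocycles ρ τ)

/-- The representation on `W × V` defined by an extension cocycle. -/
def extensionRep {ρ : Representation F G V} {τ : Representation F G W}
    {c : G → V →ₗ[F] W} (hc : c ∈ extCocycles ρ τ) : Representation F G (W × V) where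
  toFun g := (τ g ∘ₗ LinearMap.fst F W V + c g ∘ₗ LinearMap.snd F W V).prod
    (ρ g ∘ₗ LinearMap.snd F W V)
  map_one' := by
    have h1 : c 1 = 0 := by
      have := hc 1 1
      simpa [Module.End.one_eq_id] using this
    ext x <;> simp [h1]
  map_mul' g h := by
    ext x <;> simp [hc g h]

end ExtensionCocycles

section ExtOne

variable {F G : Type u} [Field F] [Group G]

lemma Rep.exact_iff (S : ShortComplex (Rep.{u} F G)) :
    S.Exact ↔ ∀ x : S.X₂, S.g.hom x = 0 → ∃ y : S.X₁, S.f.hom y = x := by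
  rw [← ShortComplex.exact_map_iff_of_faithful S (forget₂ (Rep.{u} F G) (ModuleCat.{u} F)),
    ShortComplex.moduleCat_exact_iff]
  rfl

/-- The extension cocycle attached to a morphism `φ : P₁ → W`, where `P₁ → P₀ → V` is the start
of a projective resolution, `s` is a linear section of `P₀ → V` and `t` is a linear map
`P₀ → P₁` lifting the kernel of `P₀ → V`. -/
def cocycleOfHom {P₁ P₀ V W : Rep.{u} F G} (s : V →ₗ[F] P₀) (t : P₀ →ₗ[F] P₁) :
    (P₁ ⟶ W) →ₗ[F] (G → V →ₗ[F] W) where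
  toFun φ g := φ.hom.toLinearMap ∘ₗ t ∘ₗ (P₀.ρ g ∘ₗ s - s ∘ₗ V.ρ g)
  map_add' a b := by ext g v; rfl
  map_smul' r a := by ext g v; rfl

/-- The first extension group is the group of extension cocycles modulo coboundaries. A class in
the cohomology of `Hom(P_•, W)` is represented by a morphism `P₁ → W`, and `cocycleOfHom` turns it
into an extension cocycle. -/
theorem dimExt1_eq_rank (V W : Rep.{u} F G) :
    dimExt1 V W = Module.rank F (ExtClasses V.ρ W.ρ) := by
  set P := ProjectiveResolution.of V with hP
  set d₁ : P.complex.X 1 ⟶ P.complex.X 0 := P.complex.d 1 0 with hd₁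
  set d₂ : P.complex.X 2 ⟶ P.complex.X 1 := P.complex.d 2 1 with hd₂
  set p : P.complex.X 0 ⟶ V := P.π.f 0 with hp
  have hd₂₁ : ∀ x, d₁.hom (d₂.hom x) = 0 := fun x => by
    have := P.complex.d_comp_d 2 1 0
    exact congrArg (fun f => f.hom x) this
  have hpd : ∀ x, p.hom (d₁.hom x) = 0 := fun x =>
    congrArg (fun f => f.hom x) P.complex_d_comp_π_f_zero
  have ex₀ : ∀ x, p.hom x = 0 → ∃ y, d₁.hom y = x := (Rep.exact_iff _).1 P.exact₀
  have ex₁ : ∀ x, d₁.hom x = 0 → ∃ y, d₂.hom y = x := (Rep.exact_iff _).1 (P.exact_succ 0)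
  have hepi : Epi p := inferInstanceAs (Epi (P.π.f 0))
  have hsurj : Function.Surjective p.hom := (Rep.epi_iff_surjective p).1 hepi
  -- a linear section `s` of `P₀ → V` and a linear map `t` lifting `ker(P₀ → V)` to `P₁`
  obtain ⟨s, hs⟩ := p.hom.toLinearMap.exists_rightInverse_of_surjective
    (LinearMap.range_eq_top.2 hsurj)
  have hs' : ∀ v, p.hom (s v) = v := fun v => LinearMap.congr_fun hs v
  obtain ⟨t₀, ht₀⟩ := d₁.hom.toLinearMap.rangeRestrict.exists_rightInverse_of_surjective
    (LinearMap.range_rangeRestrict _)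
  obtain ⟨t, ht⟩ := t₀.exists_extend
  have ht' : ∀ x, p.hom x = 0 → d₁.hom (t x) = x := fun x hx => by
    obtain ⟨y, rfl⟩ := ex₀ x hx
    have h1 : t (d₁.hom y) = t₀ ⟨d₁.hom y, y, rfl⟩ := LinearMap.congr_fun ht ⟨d₁.hom y, y, rfl⟩
    rw [h1]
    exact congrArg Subtype.val (LinearMap.congr_fun ht₀ ⟨d₁.hom y, y, rfl⟩)
  -- a morphism vanishing on the image of `P₂` does not see the choice of the lift `t`
  have hφt : ∀ (φ : P.complex.X 1 ⟶ W), d₂ ≫ φ = 0 → ∀ x, φ.hom (t (d₁.hom x)) = φ.hom x := by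
    intro φ hφ x
    have h1 : d₁.hom (t (d₁.hom x) - x) = 0 := by
      rw [map_sub, ht' _ (hpd x), sub_self]
    obtain ⟨y, hy⟩ := ex₁ _ h1
    have h2 : φ.hom (d₂.hom y) = 0 := congrArg (fun f => f.hom y) hφ
    rw [hy, map_sub, sub_eq_zero] at h2
    exact h2
  have hφg : ∀ (φ : P.complex.X 1 ⟶ W), d₂ ≫ φ = 0 → ∀ x, p.hom x = 0 → ∀ g,
      φ.hom (t ((P.complex.X 0).ρ g x)) = W.ρ g (φ.hom (t x)) := by
    intro φ hφ x hx g
    obtain ⟨y, rfl⟩ := ex₀ x hx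
    rw [← Rep.hom_comm_apply, hφt φ hφ, hφt φ hφ, Rep.hom_comm_apply]
  let S := (P.complex.linearYonedaObj F W).sc' 0 1 2
  have hg : ∀ φ : P.complex.X 1 ⟶ W, φ ∈ LinearMap.ker S.g.hom ↔ d₂ ≫ φ = 0 := fun φ => Iff.rfl
  have hf : ∀ φ : P.complex.X 1 ⟶ W, φ ∈ LinearMap.range S.f.hom ↔
      ∃ θ : P.complex.X 0 ⟶ W, d₁ ≫ θ = φ := fun φ => Iff.rfl
  have hdiff : ∀ g v, p.hom ((P.complex.X 0).ρ g (s v) - s (V.ρ g v)) = 0 := fun g v => by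
    rw [map_sub, Rep.hom_comm_apply, hs', hs', sub_self]
  have hcoc : ∀ φ : P.complex.X 1 ⟶ W, d₂ ≫ φ = 0 →
      cocycleOfHom s t φ ∈ extCocycles V.ρ W.ρ := by
    intro φ hφ g h
    ext v
    change φ.hom (t ((P.complex.X 0).ρ (g * h) (s v) - s (V.ρ (g * h) v))) =
      W.ρ g (φ.hom (t ((P.complex.X 0).ρ h (s v) - s (V.ρ h v)))) +
      φ.hom (t ((P.complex.X 0).ρ g (s (V.ρ h v)) - s (V.ρ g (V.ρ h v))))
    rw [← hφg φ hφ _ (hdiff h v), ← map_add, ← map_add]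
    simp
  have hcob : ∀ φ : P.complex.X 1 ⟶ W, d₂ ≫ φ = 0 →
      (cocycleOfHom s t φ ∈ extCoboundaries V.ρ W.ρ ↔ φ ∈ LinearMap.range S.f.hom) := by
    intro φ hφ
    rw [hf, mem_extCoboundaries]
    constructor
    · rintro ⟨ψ, hψ⟩
      -- `φ ∘ t` on the kernel and `ψ` on the complement `s(V)` glue to an equivariant map on `P₀`
      have hψ' : ∀ g v, φ.hom (t ((P.complex.X 0).ρ g (s v) - s (V.ρ g v))) =
        W.ρ g (ψ v) - ψ (V.ρ g v) := hψ
      refine ⟨Rep.ofHom (LinearMap.intertwiningMap_of_isIntertwiningMap _ _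
        (φ.hom.toLinearMap ∘ₗ t ∘ₗ (LinearMap.id - s ∘ₗ p.hom.toLinearMap) +
          ψ ∘ₗ p.hom.toLinearMap) fun g y => ?_), ?_⟩
      · change φ.hom (t ((P.complex.X 0).ρ g y - s (p.hom ((P.complex.X 0).ρ g y)))) +
          ψ (p.hom ((P.complex.X 0).ρ g y)) =
          W.ρ g (φ.hom (t (y - s (p.hom y))) + ψ (p.hom y))
        rw [Rep.hom_comm_apply, map_add, ← hφg φ hφ _ (by rw [map_sub, hs', sub_self]),
          sub_eq_iff_eq_add.1 (hψ' g (p.hom y)).symm, ← add_assoc, ← map_add, ← map_add]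
        simp
      · ext y
        change φ.hom (t (d₁.hom y - s (p.hom (d₁.hom y)))) + ψ (p.hom (d₁.hom y)) = φ.hom y
        rw [hpd, map_zero, map_zero, sub_zero, add_zero, hφt φ hφ]
    · rintro ⟨θ, rfl⟩
      refine ⟨θ.hom.toLinearMap ∘ₗ s, fun g v => ?_⟩
      change θ.hom (d₁.hom (t ((P.complex.X 0).ρ g (s v) - s (V.ρ g v)))) =
        W.ρ g (θ.hom (s v)) - θ.hom (s (V.ρ g v))
      rw [ht' _ (hdiff g v), map_sub, Rep.hom_comm_apply]
  let Ψ : LinearMap.ker S.g.hom →ₗ[F] ExtClasses V.ρ W.ρ :=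
    Submodule.mkQ _ ∘ₗ ((cocycleOfHom s t ∘ₗ (LinearMap.ker S.g.hom).subtype).codRestrict
      (extCocycles V.ρ W.ρ) fun φ => hcoc φ.1 ((hg φ.1).1 φ.2))
  have hΨ : Function.Surjective Ψ := by
    intro x
    obtain ⟨⟨c, hc⟩, rfl⟩ := Submodule.mkQ_surjective _ x
    -- lift `P₀ → V` to the extension given by `c`; its restriction to `P₁` has values in `W`
    let E : Rep.{u} F G := Rep.of (extensionRep hc)
    let π : E ⟶ V := Rep.ofHom (LinearMap.intertwiningMap_of_isIntertwiningMap _ _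
      (LinearMap.snd F W V) fun g x => rfl)
    have hπ : Epi π := (Rep.epi_iff_surjective π).2 fun v => ⟨((0 : W), v), rfl⟩
    let L : P.complex.X 0 ⟶ E := Projective.factorThru p π
    have hL : ∀ y, (L.hom y).2 = p.hom y := fun y =>
      congrArg (fun f => f.hom y) (Projective.factorThru_comp p π)
    have hL' : ∀ g y, (L.hom ((P.complex.X 0).ρ g y)).1 =
        W.ρ g (L.hom y).1 + c g (p.hom y) := fun g y => by
      rw [Rep.hom_comm_apply, ← hL]
      rfl
    let φ : P.complex.X 1 ⟶ W := Rep.ofHom (LinearMap.intertwiningMap_of_isIntertwiningMap _ _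
      (LinearMap.fst F W V ∘ₗ L.hom.toLinearMap ∘ₗ d₁.hom.toLinearMap) fun g y => by
        change (L.hom (d₁.hom ((P.complex.X 1).ρ g y))).1 = W.ρ g (L.hom (d₁.hom y)).1
        rw [Rep.hom_comm_apply, hL', hpd, map_zero, add_zero])
    have hφ : d₂ ≫ φ = 0 := by
      ext y
      change (L.hom (d₁.hom (d₂.hom y))).1 = 0
      rw [hd₂₁, map_zero]
      rfl
    refine ⟨⟨φ, hφ⟩, ?_⟩
    refine (Submodule.Quotient.eq _).2 ?_
    refine mem_extCoboundaries.2 ⟨LinearMap.fst F W V ∘ₗ L.hom.toLinearMap ∘ₗ s, fun g v => ?_⟩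
    change (L.hom (d₁.hom (t ((P.complex.X 0).ρ g (s v) - s (V.ρ g v))))).1 - c g v =
      W.ρ g (L.hom (s v)).1 - (L.hom (s (V.ρ g v))).1
    rw [ht' _ (hdiff g v), map_sub, Prod.fst_sub, hL', hs']
    abel
  have hker : LinearMap.range S.moduleCatToCycles = LinearMap.ker Ψ := by
    ext ⟨φ, hφ⟩
    rw [LinearMap.mem_ker]
    change _ ↔ (Submodule.Quotient.mk _ : ExtClasses V.ρ W.ρ) = 0
    rw [Submodule.Quotient.mk_eq_zero]
    refine Iff.trans ?_ (hcob φ ((hg φ).1 hφ)).symm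
    constructor
    · rintro ⟨θ, hθ⟩
      exact ⟨θ, congrArg Subtype.val hθ⟩
    · rintro ⟨θ, hθ⟩
      exact ⟨θ, Subtype.ext hθ⟩
  have e₁ := (P.isoExt (R := F) 1 W).toLinearEquiv
  have e₂ := (ShortComplex.homologyMapIso
    ((P.complex.linearYonedaObj F W).isoSc' 0 1 2 (by simp) (by simp))).toLinearEquiv
  have e₃ := S.moduleCatHomologyIso.toLinearEquiv
  have e₄ := (Submodule.quotEquivOfEq _ _ hker).trans (Ψ.quotKerEquivOfSurjective hΨ)
  exact (((e₁.trans e₂).trans e₃).trans e₄).rank_eq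

end ExtOne

section ExtRank

lemma rank_extClasses_eq_zero {F G V W : Type*} [Field F] [Group G] [AddCommGroup V] [Module F V]
    [AddCommGroup W] [Module F W] {ρ : Representation F G V} {τ : Representation F G W}
    (h : extCocycles ρ τ ≤ extCoboundaries ρ τ) : Module.rank F (ExtClasses ρ τ) = 0 := by
  have : Subsingleton (ExtClasses ρ τ) :=
    Submodule.Quotient.subsingleton_iff.2 (Submodule.submoduleOf_eq_top.2 h)
  exact rank_subsingleton' F _

lemma rank_extClasses_eq_one {F G V W : Type*} [Field F] [Group G] [AddCommGroup V] [Module F V]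
    [AddCommGroup W] [Module F W] {ρ : Representation F G V} {τ : Representation F G W}
    {c₀ : G → V →ₗ[F] W} (hc₀ : c₀ ∈ extCocycles ρ τ) (hc₀' : c₀ ∉ extCoboundaries ρ τ)
    (h : ∀ c ∈ extCocycles ρ τ, ∃ a : F, c - a • c₀ ∈ extCoboundaries ρ τ) :
    Module.rank F (ExtClasses ρ τ) = 1 := by
  refine rank_eq_one (Submodule.Quotient.mk ⟨c₀, hc₀⟩) (fun h0 => hc₀' ?_) fun x => ?_
  · exact (Submodule.Quotient.mk_eq_zero
      ((extCoboundaries ρ τ).submoduleOf (extCocycles ρ τ)) (x := ⟨c₀, hc₀⟩)).1 h0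
  · obtain ⟨⟨c, hc⟩, rfl⟩ := Submodule.mkQ_surjective _ x
    obtain ⟨a, ha⟩ := h c hc
    refine ⟨a, ((Submodule.Quotient.eq _).2 ?_).symm⟩
    exact ha

lemma dimExt1_congr {F G : Type u} [Field F] [Group G] {V V' W W' : Rep.{u} F G} (e : V ≅ V')
    (e' : W ≅ W') : dimExt1 V W = dimExt1 V' W' :=
  ((((Ext F (Rep.{u} F G) 1).mapIso e.symm.op).app W).toLinearEquiv.trans
    (((Ext F (Rep.{u} F G) 1).obj (Opposite.op V')).mapIso e').toLinearEquiv).rank_eq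

end ExtRank

end

/-! ### The group `U_{1,1}(k)` -/

section UnitaryGroup

variable {k : Type v} {l : Type u} [Field k] [Fintype k] [Field l] [Algebra k l]

/-- A matrix belongs to `U_{1,1}(k)` if and only if its conjugate is `det(g)⁻¹ g`. -/
lemma mem_U11_iff {g : GL (Fin 2) l} : g ∈ U11 k l ↔
    ∀ i j, g i j ^ Fintype.card k * (g : Matrix (Fin 2) (Fin 2) l).det = g i j := by
  change ((g : Matrix (Fin 2) (Fin 2) l).map (FiniteField.frobeniusAlgHom k l)).transpose *
    !![0, 1; -1, 0] * (g : Matrix (Fin 2) (Fin 2) l) = !![0, 1; -1, 0] ↔ _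
  have hdet : (g : Matrix (Fin 2) (Fin 2) l).det ≠ 0 := g.isUnit.map Matrix.detMonoidHom |>.ne_zero
  rw [Matrix.det_fin_two] at hdet ⊢
  generalize hA : (g : Matrix (Fin 2) (Fin 2) l) = A at *
  have hF : ∀ x, FiniteField.frobeniusAlgHom k l x = x ^ Fintype.card k := fun x => rfl
  simp only [← Matrix.ext_iff, Fin.forall_fin_two, Matrix.mul_apply, Fin.sum_univ_two,
    Matrix.transpose_apply, Matrix.map_apply, hF]
  simp only [Matrix.of_apply, Matrix.cons_val', Matrix.cons_val_zero, Matrix.cons_val_one,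
    Matrix.cons_val_fin_one]
  generalize A 0 0 = a at *
  generalize A 0 1 = b at *
  generalize A 1 0 = c at *
  generalize A 1 1 = d at *
  generalize Fintype.card k = q at *
  constructor
  · rintro ⟨⟨h1, h2⟩, h3, h4⟩
    refine ⟨⟨?_, ?_⟩, ?_, ?_⟩
    · linear_combination (-b) * h1 + a * h2
    · linear_combination (-b) * h3 + a * h4
    · linear_combination (-d) * h1 + c * h2
    · linear_combination (-d) * h3 + c * h4
  · rintro ⟨⟨h1, h2⟩, h3, h4⟩
    refine ⟨⟨?_, ?_⟩, ?_, ?_⟩ <;> refine mul_right_cancel₀ hdet ?_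
    · linear_combination c * h1 - a * h3
    · linear_combination d * h1 - b * h3
    · linear_combination c * h2 - a * h4
    · linear_combination d * h2 - b * h4

lemma U11_entry_pow (g : U11 k l) (i j : Fin 2) :
    g.1 i j ^ Fintype.card k * (g.1 : Matrix (Fin 2) (Fin 2) l).det = g.1 i j :=
  mem_U11_iff.1 g.2 i j

lemma algebraMap_pow_card (y : k) : algebraMap k l y ^ Fintype.card k = algebraMap k l y := by
  rw [← map_pow, FiniteField.pow_card]

/-- An element of `l` fixed by the `q`-power map lies in `k`. -/
lemma exists_algebraMap_of_pow_card {x : l} (hx : x ^ Fintype.card k = x) :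
    ∃ y : k, algebraMap k l y = x := by
  classical
  by_contra! hne
  have h1 : 1 < Fintype.card k := Fintype.one_lt_card
  refine FiniteField.X_pow_card_sub_X_ne_zero l h1
    (Polynomial.eq_zero_of_natDegree_lt_card_of_eval_eq_zero' _
      (insert x (Finset.univ.image (algebraMap k l))) ?_ ?_)
  · intro y hy
    rcases Finset.mem_insert.1 hy with rfl | hy
    · simp [hx]
    · obtain ⟨z, -, rfl⟩ := Finset.mem_image.1 hy
      simp [algebraMap_pow_card]
  · rw [FiniteField.X_pow_card_sub_X_natDegree_eq l h1, Finset.card_insert_of_notMem,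
      Finset.card_image_of_injective _ (algebraMap k l).injective, Finset.card_univ]
    · exact Nat.lt_succ_self _
    · simpa using hne

/-- The element of `U_{1,1}(k)` given by a matrix with nonzero determinant. -/
def U11.mk (A : Matrix (Fin 2) (Fin 2) l) (hA : A.det ≠ 0)
    (h : ∀ i j, A i j ^ Fintype.card k * A.det = A i j) : U11 k l :=
  ⟨Matrix.GeneralLinearGroup.mkOfDetNeZero A hA, mem_U11_iff.2 h⟩

lemma U11.mk_val (A : Matrix (Fin 2) (Fin 2) l) (hA : A.det ≠ 0)
    (h : ∀ i j, A i j ^ Fintype.card k * A.det = A i j) :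
    ((U11.mk A hA h).1 : Matrix (Fin 2) (Fin 2) l) = A := rfl

lemma U11_ext {g h : U11 k l}
    (H : (g.1 : Matrix (Fin 2) (Fin 2) l) = (h.1 : Matrix (Fin 2) (Fin 2) l)) : g = h :=
  Subtype.ext (Units.ext H)

lemma U11_coe_mul (g h : U11 k l) : ((g * h).1 : Matrix (Fin 2) (Fin 2) l) =
    (g.1 : Matrix (Fin 2) (Fin 2) l) * (h.1 : Matrix (Fin 2) (Fin 2) l) := rfl

/-- The upper unipotent matrix `(1 y; 0 1)`. -/
def upper (y : k) : U11 k l := U11.mk !![1, algebraMap k l y; 0, 1] (by simp [Matrix.det_fin_two])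
  (by simp [Fin.forall_fin_two, Matrix.det_fin_two, algebraMap_pow_card])

/-- The lower unipotent matrix `(1 0; y 1)`. -/
def lower (y : k) : U11 k l := U11.mk !![1, 0; algebraMap k l y, 1] (by simp [Matrix.det_fin_two])
  (by simp [Fin.forall_fin_two, Matrix.det_fin_two, algebraMap_pow_card])

variable (k l) in
/-- The Weyl element `(0 1; -1 0)`. -/
def weylElt : U11 k l := U11.mk !![0, 1; -1, 0] (by simp [Matrix.det_fin_two])
  (by
    have h : (-1 : l) ^ Fintype.card k = -1 := by
      have := algebraMap_pow_card (l := l) (-1 : k)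
      simpa using this
    simp [Fin.forall_fin_two, Matrix.det_fin_two, h])

lemma upper_add (x y : k) : (upper (x + y) : U11 k l) = upper x * upper y := by
  apply U11_ext
  rw [U11_coe_mul]
  simp [upper, U11.mk_val, add_comm, Algebra.smul_def (A := l)]

lemma upper_zero : (upper 0 : U11 k l) = 1 := by
  apply U11_ext
  simp [upper, U11.mk_val, Matrix.one_fin_two]

lemma lower_zero : (lower 0 : U11 k l) = 1 := by
  apply U11_ext
  simp [lower, U11.mk_val, Matrix.one_fin_two]

section Quadratic

variable (hl : Module.finrank k l = 2)
include hl

lemma pow_card_card (x : l) : (x ^ Fintype.card k) ^ Fintype.card k = x := by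
  have : Module.Finite k l := Module.finite_of_finrank_pos (by omega)
  have : Finite l := Module.finite_of_finite k
  have := Fintype.ofFinite l
  have h := FiniteField.pow_card x
  rw [Module.card_eq_pow_finrank (K := k), hl, pow_two, pow_mul] at h
  exact h

/-- The norm of the quadratic extension is `x ↦ x^{q+1}`. -/
lemma algebraMap_norm_quadratic (x : l) :
    algebraMap k l (Algebra.norm k x) = x ^ (Fintype.card k + 1) := by
  have : Module.Finite k l := Module.finite_of_finrank_pos (by omega)
  have : Finite l := Module.finite_of_finite k
  rw [FiniteField.algebraMap_norm_eq_pow, Module.natCard_eq_pow_finrank (K := k) (V := l), hl,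
    Nat.card_eq_fintype_card]
  congr 1
  have h1 : 1 < Fintype.card k := Fintype.one_lt_card
  refine Nat.div_eq_of_eq_mul_left (by omega) ?_
  zify [h1.le, Nat.one_le_pow 2 _ (by omega : 0 < Fintype.card k)]
  ring

lemma exists_norm_unit (y : k) (hy : y ≠ 0) : ∃ t : lˣ, Algebra.norm k (t : l) = y := by
  have : Module.Finite k l := Module.finite_of_finrank_pos (by omega)
  have : Finite l := Module.finite_of_finite k
  obtain ⟨t, ht⟩ := FiniteField.norm_surjective k l y
  refine ⟨Units.mk0 t ?_, ht⟩
  rintro rfl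
  rw [Algebra.norm_zero] at ht
  exact hy ht.symm

/-- The diagonal torus, as the image of `t ↦ diag(t, t^{-q})`. -/
def torus (t : lˣ) : U11 k l := U11.mk !![(t : l), 0; 0, ((t : l) ^ Fintype.card k)⁻¹]
  (by simp [Matrix.det_fin_two])
  (by
    have h := pow_card_card hl (t : l)
    have ht : (t : l) ≠ 0 := t.ne_zero
    simp only [Fin.forall_fin_two, Matrix.det_fin_two]
    have ht' : (t : l) ^ Fintype.card k ≠ 0 := pow_ne_zero _ ht
    simp [h, ht]
    field_simp)

lemma torus_mul (s t : lˣ) : torus hl (s * t) = torus hl s * torus hl t := by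
  apply U11_ext
  rw [U11_coe_mul]
  simp [torus, U11.mk_val, mul_pow, mul_comm]

lemma torus_mul_upper (t : lˣ) (y : k) :
    torus hl t * upper y = upper (Algebra.norm k (t : l) * y) * torus hl t := by
  apply U11_ext
  rw [U11_coe_mul, U11_coe_mul]
  have ht : (t : l) ≠ 0 := t.ne_zero
  simp [torus, upper, U11.mk_val, algebraMap_norm_quadratic hl]
  field_simp
  ring

/-- The big cell: `g` with `g₀₀ ≠ 0` is a product of lower unipotent, diagonal and upper
unipotent matrices. -/
lemma exists_lower_torus_upper (g : U11 k l) (hg : g.1 0 0 ≠ 0) :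
    ∃ (x : k) (t : lˣ) (y : k), g = lower x * torus hl t * upper y := by
  set A := (g.1 : Matrix (Fin 2) (Fin 2) l) with hA
  have hdet : A.det ≠ 0 := g.1.isUnit.map Matrix.detMonoidHom |>.ne_zero
  have h : ∀ i j, A i j ^ Fintype.card k * A.det = A i j := U11_entry_pow g
  have ha : A 0 0 ≠ 0 := hg
  have hq : ∀ i j, (A i j / A 0 0) ^ Fintype.card k = A i j / A 0 0 := fun i j => by
    have h1 := h i j
    have h2 := h 0 0
    have h3 : A 0 0 ^ Fintype.card k ≠ 0 := pow_ne_zero _ ha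
    rw [div_pow, div_eq_div_iff h3 ha]
    refine mul_right_cancel₀ hdet ?_
    linear_combination A 0 0 * h1 - A i j * h2
  obtain ⟨x, hx⟩ := exists_algebraMap_of_pow_card (hq 1 0)
  obtain ⟨y, hy⟩ := exists_algebraMap_of_pow_card (hq 0 1)
  refine ⟨x, Units.mk0 _ ha, y, U11_ext ?_⟩
  rw [U11_coe_mul, U11_coe_mul, ← hA]
  have hd : A 1 1 = A 1 0 / A 0 0 * A 0 1 + (A 0 0 ^ Fintype.card k)⁻¹ := by
    have h2 := h 0 0
    have h3 : A 0 0 ^ Fintype.card k ≠ 0 := pow_ne_zero _ ha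
    rw [Matrix.det_fin_two] at h2
    field_simp
    linear_combination h2
  ext i j
  fin_cases i <;> fin_cases j <;>
    simp [lower, torus, upper, U11.mk_val, hx, hy, ha, Matrix.mul_apply, Fin.sum_univ_two]
  · field_simp
  · rw [hd]; field_simp

/-- The small cell: `g` with `g₀₀ = 0` is the Weyl element times an upper triangular matrix. -/
lemma exists_weylElt_torus_upper (g : U11 k l) (hg : g.1 0 0 = 0) :
    ∃ (t : lˣ) (y : k), g = weylElt k l * torus hl t * upper y := by
  set A := (g.1 : Matrix (Fin 2) (Fin 2) l) with hA
  have hB : (((weylElt k l)⁻¹ * g).1 : Matrix (Fin 2) (Fin 2) l) =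
      !![-A 1 0, -A 1 1; A 0 0, A 0 1] := by
    have h1 : ((weylElt k l)⁻¹ : U11 k l) = U11.mk !![0, -1; 1, 0] (by simp [Matrix.det_fin_two])
      (by
        have h : (-1 : l) ^ Fintype.card k = -1 := by
          have := algebraMap_pow_card (l := l) (-1 : k)
          simpa using this
        simp [Fin.forall_fin_two, Matrix.det_fin_two, h]) := by
      rw [inv_eq_iff_mul_eq_one]
      apply U11_ext
      rw [U11_coe_mul]
      simp [weylElt, U11.mk_val, Matrix.one_fin_two]
    rw [h1, U11_coe_mul, U11.mk_val, ← hA]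
    ext i j
    fin_cases i <;> fin_cases j <;> simp [Matrix.mul_apply, Fin.sum_univ_two]
  have hdet : A.det ≠ 0 := g.1.isUnit.map Matrix.detMonoidHom |>.ne_zero
  have hA0 : A 0 0 = 0 := hg
  have h10 : A 1 0 ≠ 0 := by
    intro h
    rw [Matrix.det_fin_two, h, hA0] at hdet
    simp at hdet
  have e : ∀ i j, ((weylElt k l)⁻¹ * g).1 i j = (!![-A 1 0, -A 1 1; A 0 0, A 0 1] :
      Matrix (Fin 2) (Fin 2) l) i j := fun i j => congrFun (congrFun hB i) j
  obtain ⟨x, t, y, h⟩ := exists_lower_torus_upper hl ((weylElt k l)⁻¹ * g) (by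
    rw [e]; simpa using h10)
  have hx : x = 0 := by
    have h2 := e 1 0
    have h3 : ((lower x * torus hl t * upper y : U11 k l).1 : Matrix (Fin 2) (Fin 2) l) 1 0 =
        algebraMap k l x * t := by
      rw [U11_coe_mul, U11_coe_mul]
      simp [lower, torus, upper, U11.mk_val, Matrix.mul_apply, Fin.sum_univ_two,
        Algebra.smul_def (A := l)]
    have h4 : algebraMap k l x * t = 0 := by
      rw [← h3, ← h]
      refine h2.trans ?_
      simpa using hA0
    simpa using h4
  refine ⟨t, y, ?_⟩
  rw [hx, lower_zero (k := k) (l := l), one_mul, inv_mul_eq_iff_eq_mul] at h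
  rw [h, mul_assoc]

end Quadratic

/-- Transposition, an anti-automorphism of `U_{1,1}(k)`. -/
def transp (g : U11 k l) : U11 k l := U11.mk (g.1 : Matrix (Fin 2) (Fin 2) l).transpose
  (by
    rw [Matrix.det_transpose]
    exact (g.1.isUnit.map Matrix.detMonoidHom).ne_zero)
  (by
    intro i j
    rw [Matrix.det_transpose]
    exact U11_entry_pow g j i)

lemma transp_val (g : U11 k l) : ((transp g).1 : Matrix (Fin 2) (Fin 2) l) =
    (g.1 : Matrix (Fin 2) (Fin 2) l).transpose := rfl

lemma transp_mul (g h : U11 k l) : transp (g * h) = transp h * transp g := by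
  apply U11_ext
  rw [U11_coe_mul, transp_val, U11_coe_mul, Matrix.transpose_mul]
  rfl

lemma transp_one : transp (1 : U11 k l) = 1 := by
  apply U11_ext
  rw [transp_val]
  simp

@[simp] lemma transp_transp (g : U11 k l) : transp (transp g) = g := by
  apply U11_ext
  rw [transp_val, transp_val, Matrix.transpose_transpose]

@[simp] lemma transp_upper (y : k) : transp (upper y : U11 k l) = lower y := by
  apply U11_ext
  rw [transp_val, upper, lower, U11.mk_val, U11.mk_val]
  ext i j
  fin_cases i <;> fin_cases j <;> rfl

@[simp] lemma transp_lower (y : k) : transp (lower y : U11 k l) = upper y := by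
  rw [← transp_upper, transp_transp]

@[simp] lemma transp_torus (hl : Module.finrank k l = 2) (t : lˣ) :
    transp (torus hl t) = torus hl t := by
  apply U11_ext
  rw [transp_val, torus, U11.mk_val]
  ext i j
  fin_cases i <;> fin_cases j <;> rfl

end UnitaryGroup

/-! ### Highest weight data -/

section DigitSums

/-- The number `∑ d_j p^j`. -/
def digitSum (p : ℕ) {f : ℕ} (d : Fin f → ℕ) : ℕ := ∑ j, d j * p ^ (j : ℕ)

variable {p f : ℕ}

lemma digitSum_lt (d : Fin f → ℕ) (hd : ∀ j, d j < p) : digitSum p d < p ^ f := by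
  have h := (finFunctionFinEquiv fun j => (⟨d j, hd j⟩ : Fin p)).2
  rwa [finFunctionFinEquiv_apply] at h

lemma digitSum_injective {d e : Fin f → ℕ} (hd : ∀ j, d j < p) (he : ∀ j, e j < p)
    (h : digitSum p d = digitSum p e) : d = e := by
  have h1 : finFunctionFinEquiv (fun j => (⟨d j, hd j⟩ : Fin p)) =
      finFunctionFinEquiv (fun j => (⟨e j, he j⟩ : Fin p)) := by
    apply Fin.ext
    rw [finFunctionFinEquiv_apply, finFunctionFinEquiv_apply]
    exact h
  have h2 := finFunctionFinEquiv.injective h1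
  funext j
  exact congrArg Fin.val (congrFun h2 j)

lemma exists_digits {m : ℕ} (hm : m < p ^ f) :
    ∃ d : Fin f → ℕ, (∀ j, d j < p) ∧ digitSum p d = m := by
  refine ⟨fun j => (finFunctionFinEquiv.symm (⟨m, hm⟩ : Fin (p ^ f)) j : ℕ), fun j => Fin.is_lt _,
    ?_⟩
  have h := finFunctionFinEquiv_apply (finFunctionFinEquiv.symm (⟨m, hm⟩ : Fin (p ^ f)))
  rw [Equiv.apply_symm_apply] at h
  exact h.symm

lemma digitSum_update (d : Fin f → ℕ) (j : Fin f) (a : ℕ) :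
    digitSum p (Function.update d j a) + d j * p ^ (j : ℕ) = digitSum p d + a * p ^ (j : ℕ) := by
  have h : ∀ i, (Function.update d j a i * p ^ (i : ℕ) : ℕ) =
      Function.update (fun i => d i * p ^ (i : ℕ)) j (a * p ^ (j : ℕ)) i := fun i => by
    by_cases h : i = j
    · subst h; simp
    · simp [h]
  unfold digitSum
  simp_rw [h]
  rw [Finset.sum_update_of_mem (Finset.mem_univ j),
    ← Finset.add_sum_erase _ (fun i => d i * p ^ (i : ℕ)) (Finset.mem_univ j),
    Finset.sdiff_singleton_eq_erase]
  ring

lemma digitSum_add (d e : Fin f → ℕ) : digitSum p (d + e) = digitSum p d + digitSum p e := by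
  simp [digitSum, add_mul, Finset.sum_add_distrib]

lemma digitSum_single (j : Fin f) (a : ℕ) : digitSum p (Pi.single j a) = a * p ^ (j : ℕ) := by
  unfold digitSum
  rw [Finset.sum_eq_single j] <;> simp +contextual

lemma digitSum_div_mod (d : Fin f → ℕ) (hd : ∀ j, d j < p) (j : Fin f) :
    digitSum p d / p ^ (j : ℕ) % p = d j := by
  have h : finFunctionFinEquiv.symm (finFunctionFinEquiv (fun j => (⟨d j, hd j⟩ : Fin p))) j =
    (⟨d j, hd j⟩ : Fin p) := by rw [Equiv.symm_apply_apply]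
  have h' := congrArg Fin.val h
  rw [finFunctionFinEquiv_symm_apply_val, finFunctionFinEquiv_apply] at h'
  exact h'

/-- A special case of Lucas' theorem. -/
lemma choose_pow_modEq [Fact p.Prime] (m t : ℕ) : m.choose (p ^ t) ≡ m / p ^ t % p [MOD p] := by
  induction t generalizing m with
  | zero => simpa using (Nat.mod_modEq m p).symm
  | succ t ih =>
    refine (Choose.choose_modEq_choose_mod_mul_choose_div_nat (p := p)).trans ?_
    have hp : 0 < p := (Fact.out (p := p.Prime)).pos
    have h1 : p ^ (t + 1) % p = 0 := by rw [pow_succ]; exact Nat.mul_mod_left _ _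
    have h2 : p ^ (t + 1) / p = p ^ t := by rw [pow_succ]; exact Nat.mul_div_cancel _ hp
    rw [h1, h2, Nat.choose_zero_right, one_mul]
    refine (ih (m / p)).trans ?_
    rw [Nat.div_div_eq_div_mul, pow_succ']

/-- If all the monomials `X^i`, `i < m`, that occur in `(X+1)^m - X^m` in characteristic `p`
have digits bounded by `r`, then so has `m`, or `m = (r_j+1)p^j` for some `j`. -/
lemma digits_of_choose [Fact p.Prime] (r : Fin f → ℕ) {m : ℕ} (hm : m < p ^ f)
    (h : ∀ i < m, ¬ p ∣ m.choose i →
      ∃ d : Fin f → ℕ, (∀ j, d j ≤ r j ∧ d j < p) ∧ i = digitSum p d) :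
    (∃ d : Fin f → ℕ, (∀ j, d j ≤ r j) ∧ m = digitSum p d) ∨ ∃ j, m = (r j + 1) * p ^ (j : ℕ) := by
  have hp : 0 < p := (Fact.out (p := p.Prime)).pos
  obtain ⟨d, hd, rfl⟩ := exists_digits hm
  by_cases hall : ∀ j, d j ≤ r j
  · exact Or.inl ⟨d, hall, rfl⟩
  push Not at hall
  obtain ⟨j, hj⟩ := hall
  -- lowering a nonzero digit of `m` by one gives an exponent that occurs
  have key : ∀ t, d t ≠ 0 → ∀ i, Function.update d t (d t - 1) i ≤ r i := by
    intro t ht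
    have hu := digitSum_update (p := p) d t (d t - 1)
    have hdt : (d t - 1) * p ^ (t : ℕ) + p ^ (t : ℕ) = d t * p ^ (t : ℕ) := by
      rw [← Nat.succ_mul]; congr 1; omega
    have hpt : 0 < p ^ (t : ℕ) := pow_pos hp _
    have hlt : digitSum p (Function.update d t (d t - 1)) + p ^ (t : ℕ) = digitSum p d := by omega
    obtain ⟨e, he, hee⟩ := h (digitSum p (Function.update d t (d t - 1))) (by omega) (by
      rw [← hlt, Nat.choose_symm_add, hlt]
      intro hdvd
      have h1 := (choose_pow_modEq (p := p) (digitSum p d) t).symm.trans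
        ((Nat.modEq_zero_iff_dvd).2 hdvd)
      rw [digitSum_div_mod d hd] at h1
      exact ht (Nat.ModEq.eq_of_lt_of_lt h1 (hd t) hp))
    have : Function.update d t (d t - 1) = e := by
      refine digitSum_injective (fun i => ?_) (fun i => (he i).2) hee
      by_cases hi : i = t
      · subst hi; simp; have := hd i; omega
      · simp [hi, hd i]
    rw [this]
    exact fun i => (he i).1
  have hz : ∀ t, t ≠ j → d t = 0 := by
    intro t ht
    by_contra h0
    have := key t h0 j
    rw [Function.update_of_ne (Ne.symm ht)] at this
    omega
  have hj' : d j = r j + 1 := by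
    have := key j (by omega) j
    rw [Function.update_self] at this
    omega
  right
  refine ⟨j, ?_⟩
  rw [← hj', ← digitSum_single]
  congr 1
  funext t
  by_cases ht : t = j
  · subst ht; simp
  · simp [ht, hz t ht]

end DigitSums

section FunctionsOnField

variable {k : Type v} {l F : Type u} [Field k] [Fintype k] [Field l] [Algebra k l] [Field F]

/-- The embedding of `k` in `F` induced by `σ`. -/
abbrev evk (k : Type v) [Field k] [Algebra k l] (σ : l →+* F) : k →+* F := σ.comp (algebraMap k l)

lemma eq_of_eval_eq (σ : l →+* F) {P Q : Polynomial F} (hP : P.natDegree < Fintype.card k)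
    (hQ : Q.natDegree < Fintype.card k) (h : ∀ y : k, P.eval (evk k σ y) = Q.eval (evk k σ y)) :
    P = Q := by
  classical
  rw [← sub_eq_zero]
  refine Polynomial.eq_zero_of_natDegree_lt_card_of_eval_eq_zero' _
    (Finset.univ.image (evk k σ)) ?_ ?_
  · intro x hx
    obtain ⟨y, -, rfl⟩ := Finset.mem_image.1 hx
    rw [Polynomial.eval_sub, h, sub_self]
  · rw [Finset.card_image_of_injective _ (evk k σ).injective, Finset.card_univ]
    exact (Polynomial.natDegree_sub_le _ _).trans_lt (max_lt hP hQ)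

end FunctionsOnField

section HighestWeight

variable {k : Type v} {l F : Type u} [Field k] [Fintype k] [Field l] [Algebra k l] [Field F]
  {f : ℕ} {V W : Type*} [AddCommGroup V] [Module F V] [AddCommGroup W] [Module F W]

/-- The structure of the Serre weight `V` of `U_{1,1}(k)` with digits `r_j` and determinant
exponent `b` that determines its extensions: a highest weight vector, the linear form dual to it
that is invariant under the lower unipotent matrices, the resulting matrix coefficient, and bases of
`V` and of its dual which become monomials when `V` (resp. its dual) is embedded in the functions on
`k` by acting with upper (resp. lower) unipotent matrices. -/
structure HighestWeightData (p : ℕ) (hl : Module.finrank k l = 2) (σ : l →+* F)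
    (ρ : Representation F (U11 k l) V) (r : Fin f → ℕ) (b : ℤ) where
  /-- The highest weight vector. -/
  vec : V
  /-- The linear form dual to the highest weight vector. -/
  form : V →ₗ[F] F
  coeff : ∀ g : U11 k l, form (ρ g vec) =
    σ ((g.1 : Matrix (Fin 2) (Fin 2) l) 0 0) ^ digitSum p r *
      σ (g.1 : Matrix (Fin 2) (Fin 2) l).det ^ b
  upper_vec : ∀ y, ρ (upper y) vec = vec
  form_lower : ∀ y v, form (ρ (lower y) v) = form v
  torus_vec : ∀ t : lˣ, ρ (torus hl t) vec =
    σ t ^ ((digitSum p r : ℤ) + (1 - Fintype.card k) * b) • vec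
  form_torus : ∀ (t : lˣ) v, form (ρ (torus hl t) v) =
    σ t ^ ((digitSum p r : ℤ) + (1 - Fintype.card k) * b) * form v
  /-- The basis that becomes a set of monomials on the upper unipotent group. -/
  basis : Module.Basis (∀ j, Fin (r j + 1)) F V
  basis_spec : ∀ d y, form (ρ (upper y) (basis d)) = evk k σ y ^ digitSum p fun j => (d j : ℕ)
  /-- The basis of the dual that becomes a set of monomials on the lower unipotent group. -/
  dualBasis : Module.Basis (∀ j, Fin (r j + 1)) F (Module.Dual F V)
  dualBasis_spec : ∀ d y, dualBasis d (ρ (lower y) vec) = evk k σ y ^ digitSum p fun j => (d j : ℕ)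

/-- The contragredient of a representation of `U_{1,1}(k)`, twisted by the transpose inverse. -/
def transpDual (ρ : Representation F (U11 k l) V) :
    Representation F (U11 k l) (Module.Dual F V) where
  toFun g := (ρ (transp g)).dualMap
  map_one' := by ext; simp [transp_one]
  map_mul' g h := by ext; simp [transp_mul]

lemma transpDual_apply (ρ : Representation F (U11 k l) V) (g : U11 k l) (ξ : Module.Dual F V)
    (v : V) : transpDual ρ g ξ v = ξ (ρ (transp g) v) := rfl

namespace HighestWeightData

variable {p : ℕ} {hl : Module.finrank k l = 2} {σ : l →+* F} {ρ : Representation F (U11 k l) V}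
  {r : Fin f → ℕ} {b : ℤ} (D : HighestWeightData p hl σ ρ r b)
include D

lemma finite : Module.Finite F V := Module.Finite.of_basis D.basis

lemma finrank_eq : Module.finrank F V = ∏ j, (r j + 1) := by
  rw [Module.finrank_eq_card_basis D.basis]
  simp

/-- The twisted contragredient of a Serre weight has the same highest weight; the highest weight
vector and the dual form change roles. -/
noncomputable def dual : HighestWeightData p hl σ (transpDual ρ) r b :=
  haveI := D.finite
  { vec := D.form
    form := Module.evalEquiv F V D.vec
    coeff := fun g => by
      rw [Module.evalEquiv_apply, Module.Dual.eval_apply, transpDual_apply, D.coeff, transp_val,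
        Matrix.det_transpose]
      rfl
    upper_vec := fun y => by
      ext v
      rw [transpDual_apply, transp_upper, D.form_lower]
    form_lower := fun y ξ => by
      rw [Module.evalEquiv_apply, Module.Dual.eval_apply, transpDual_apply, transp_lower,
        D.upper_vec,
        Module.Dual.eval_apply]
    torus_vec := fun t => by
      ext v
      rw [transpDual_apply, transp_torus, D.form_torus, LinearMap.smul_apply, smul_eq_mul]
    form_torus := fun t ξ => by
      rw [Module.evalEquiv_apply, Module.Dual.eval_apply, transpDual_apply, transp_torus,
        D.torus_vec, map_smul,
        Module.Dual.eval_apply, smul_eq_mul]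
    basis := D.dualBasis
    basis_spec := fun d y => by
      rw [Module.evalEquiv_apply, Module.Dual.eval_apply, transpDual_apply, transp_upper,
        D.dualBasis_spec]
    dualBasis := D.basis.map (Module.evalEquiv F V)
    dualBasis_spec := fun d y => by
      rw [Module.Basis.map_apply, Module.evalEquiv_apply, Module.Dual.eval_apply, transpDual_apply,
        transp_lower,
        D.basis_spec] }

@[simp] lemma dual_vec : D.dual.vec = D.form := rfl

lemma dual_form (ξ : Module.Dual F V) : D.dual.form ξ = ξ D.vec := by
  have := D.finite
  change Module.evalEquiv F V D.vec ξ = _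
  rw [Module.evalEquiv_apply, Module.Dual.eval_apply]

lemma form_vec : D.form D.vec = 1 := by
  have h := D.coeff 1
  simpa using h

/-- The polynomial whose value at `y ∈ k` is the value of the form at the translate of `v` by the
upper unipotent matrix with entry `y`. -/
noncomputable def poly : V →ₗ[F] Polynomial F :=
  D.basis.constr F fun d => Polynomial.X ^ digitSum p fun j => (d j : ℕ)

lemma poly_basis (d : ∀ j, Fin (r j + 1)) :
    D.poly (D.basis d) = Polynomial.X ^ digitSum p fun j => (d j : ℕ) :=
  D.basis.constr_basis ..

lemma eval_poly (v : V) (y : k) : (D.poly v).eval (evk k σ y) = D.form (ρ (upper y) v) := by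
  have h : (Polynomial.aeval (evk k σ y)).toLinearMap ∘ₗ D.poly = D.form ∘ₗ ρ (upper y) := by
    refine D.basis.ext fun d => ?_
    simp [poly_basis, D.basis_spec]
  have := LinearMap.congr_fun h v
  simpa [Polynomial.aeval_def] using this

lemma poly_eq (v : V) : D.poly v =
    ∑ d, Polynomial.C (D.basis.repr v d) * Polynomial.X ^ digitSum p fun j => (d j : ℕ) := by
  rw [poly, Module.Basis.constr_apply_fintype]
  simp [Polynomial.smul_eq_C_mul, Module.Basis.equivFun_apply]

lemma coeff_poly_ne_zero {v : V} {n : ℕ} (h : (D.poly v).coeff n ≠ 0) :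
    ∃ d : Fin f → ℕ, (∀ j, d j ≤ r j) ∧ n = digitSum p d := by
  rw [poly_eq, Polynomial.finsetSum_coeff] at h
  obtain ⟨d, -, hd⟩ := Finset.exists_ne_zero_of_sum_ne_zero h
  rw [Polynomial.coeff_C_mul, Polynomial.coeff_X_pow] at hd
  refine ⟨fun j => (d j : ℕ), fun j => Nat.lt_succ_iff.1 (d j).2, ?_⟩
  by_contra hn
  simp [hn] at hd

lemma natDegree_poly_lt (hr : ∀ j, r j < p) (hp : 0 < p) (v : V) :
    (D.poly v).natDegree < p ^ f := by
  by_cases h0 : D.poly v = 0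
  · rw [h0, Polynomial.natDegree_zero]; exact pow_pos hp _
  obtain ⟨d, hd, h⟩ := D.coeff_poly_ne_zero (v := v) (n := (D.poly v).natDegree) (by simpa using h0)
  rw [h]
  exact digitSum_lt d fun j => (hd j).trans_lt (hr j)

lemma poly_injective (hr : ∀ j, r j < p) : Function.Injective D.poly := by
  rw [← LinearMap.ker_eq_bot, LinearMap.ker_eq_bot']
  intro v hv
  refine D.basis.repr.map_eq_zero_iff.1 (Finsupp.ext fun d => ?_)
  have h := congrArg (fun P => Polynomial.coeff P (digitSum p fun j => (d j : ℕ))) hv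
  simp only [poly_eq, Polynomial.finsetSum_coeff, Polynomial.coeff_C_mul, Polynomial.coeff_X_pow,
    Polynomial.coeff_zero] at h
  rw [Finset.sum_eq_single d] at h
  · simpa using h
  · intro e _ hed
    rw [if_neg, mul_zero]
    intro heq
    apply hed
    have := digitSum_injective (fun j => (Nat.lt_succ_iff.1 (d j).2).trans_lt (hr j))
      (fun j => (Nat.lt_succ_iff.1 (e j).2).trans_lt (hr j)) heq
    funext j
    exact Fin.ext (congrFun this j).symm
  · simp

/-- A vector is determined by the values of the form on its upper unipotent translates. -/
lemma eq_of_form_upper (hk : Fintype.card k = p ^ f) (hr : ∀ j, r j < p) (hp : 0 < p) {v w : V}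
    (h : ∀ y : k, D.form (ρ (upper y) v) = D.form (ρ (upper y) w)) : v = w := by
  refine D.poly_injective hr (eq_of_eval_eq (k := k) σ ?_ ?_ fun y => ?_)
  · rw [hk]; exact D.natDegree_poly_lt hr hp v
  · rw [hk]; exact D.natDegree_poly_lt hr hp w
  · rw [eval_poly, eval_poly, h]

lemma eq_of_lower_vec (hk : Fintype.card k = p ^ f) (hr : ∀ j, r j < p) (hp : 0 < p)
    {ξ ζ : Module.Dual F V} (h : ∀ y : k, ξ (ρ (lower y) D.vec) = ζ (ρ (lower y) D.vec)) :
    ξ = ζ := by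
  refine D.dual.eq_of_form_upper hk hr hp fun y => ?_
  rw [dual_form, dual_form, transpDual_apply, transpDual_apply, transp_upper, h]

/-- The highest weight vector generates the representation. -/
lemma span_eq_top (hk : Fintype.card k = p ^ f) (hr : ∀ j, r j < p) (hp : 0 < p) :
    Submodule.span F (Set.range fun g : U11 k l => ρ g D.vec) = ⊤ := by
  by_contra hne
  obtain ⟨ξ, hξ, h⟩ := Submodule.exists_dual_map_eq_bot_of_lt_top (lt_top_iff_ne_top.2 hne)
    inferInstance
  refine hξ (D.eq_of_lower_vec hk hr hp fun y => ?_)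
  rw [LinearMap.zero_apply]
  have : ξ (ρ (lower y) D.vec) ∈ Submodule.map ξ
      (Submodule.span F (Set.range fun g : U11 k l => ρ g D.vec)) :=
    Submodule.mem_map_of_mem (Submodule.subset_span ⟨lower y, rfl⟩)
  rw [h] at this
  exact (Submodule.mem_bot F).1 this

/-- The basis vectors are eigenvectors of the torus. -/
lemma torus_basis (hk : Fintype.card k = p ^ f) (hr : ∀ j, r j < p) (hp : 0 < p) (t : lˣ)
    (d : ∀ j, Fin (r j + 1)) :
    evk k σ (Algebra.norm k (t : l)) ^ (digitSum p fun j => (d j : ℕ)) •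
      ρ (torus hl t) (D.basis d) =
      σ t ^ ((digitSum p r : ℤ) + (1 - Fintype.card k) * b) • D.basis d := by
  have hN : Algebra.norm k (t : l) ≠ 0 := by
    have : Module.Finite k l := Module.finite_of_finrank_pos (by omega)
    rw [Algebra.norm_ne_zero_iff]
    exact t.ne_zero
  refine D.eq_of_form_upper hk hr hp fun y => ?_
  have h1 : upper y * torus hl t = torus hl t * upper ((Algebra.norm k (t : l))⁻¹ * y) := by
    rw [torus_mul_upper, mul_inv_cancel_left₀ hN]
  have h2 : ρ (upper y) (ρ (torus hl t) (D.basis d)) =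
      ρ (torus hl t) (ρ (upper ((Algebra.norm k (t : l))⁻¹ * y)) (D.basis d)) := by
    rw [← Module.End.mul_apply, ← map_mul, h1, map_mul, Module.End.mul_apply]
  rw [map_smul, map_smul, map_smul, map_smul, h2, D.form_torus, D.basis_spec, D.basis_spec,
    smul_eq_mul, smul_eq_mul, mul_left_comm, ← mul_pow, ← map_mul, mul_inv_cancel_left₀ hN]

end HighestWeightData

end HighestWeight

/-! ### Cocycles between highest weight vectors -/

section TorusCocycles

variable {k : Type v} {l F : Type u} [Field k] [Fintype k] [Field l] [Algebra k l] [Field F]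
  {V W : Type*} [AddCommGroup V] [Module F V] [AddCommGroup W] [Module F W]

/-- The extension cocycles that vanish on the diagonal torus. -/
def torusCocycles (hl : Module.finrank k l = 2) (ρ : Representation F (U11 k l) V)
    (τ : Representation F (U11 k l) W) : Submodule F (U11 k l → V →ₗ[F] W) where
  carrier := {c | c ∈ extCocycles ρ τ ∧ ∀ t, c (torus hl t) = 0}
  zero_mem' := ⟨zero_mem _, fun _ => rfl⟩
  add_mem' ha hb := ⟨add_mem ha.1 hb.1, fun t => by simp [ha.2 t, hb.2 t]⟩
  smul_mem' a c hc := ⟨Submodule.smul_mem _ a hc.1, fun t => by simp [hc.2 t]⟩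

variable {hl : Module.finrank k l = 2} {ρ : Representation F (U11 k l) V}
  {τ : Representation F (U11 k l) W}

/-- The order of the torus is prime to the characteristic, so averaging over it makes a cocycle
vanish on the torus. -/
lemma exists_torusCocycle {p : ℕ} [Fact p.Prime] [CharP F p] {f : ℕ} [NeZero f]
    (hk : Fintype.card k = p ^ f) {c : U11 k l → V →ₗ[F] W}
    (hc : c ∈ extCocycles ρ τ) :
    ∃ c' ∈ torusCocycles hl ρ τ, c - c' ∈ extCoboundaries ρ τ := by
  classical
  have : Module.Finite k l := Module.finite_of_finrank_pos (by omega)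
  have : Finite l := Module.finite_of_finite k
  have := Fintype.ofFinite l
  have hcard : ((Fintype.card lˣ : ℕ) : F) ≠ 0 := by
    have h1 : Fintype.card lˣ + 1 = Fintype.card k ^ 2 := by
      rw [Fintype.card_units, Module.card_eq_pow_finrank (K := k) (V := l), hl]
      have : 0 < Fintype.card k ^ 2 := pow_pos Fintype.card_pos _
      omega
    have h2 : ((Fintype.card lˣ : ℕ) : F) + 1 = 0 := by
      have := congrArg (Nat.cast : ℕ → F) h1
      rw [hk] at this
      push_cast at this
      rw [this]
      simp [NeZero.ne f]
    intro h0
    rw [h0, zero_add] at h2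
    exact one_ne_zero h2
  set N : F := ((Fintype.card lˣ : ℕ) : F) with hN
  let Φ : V →ₗ[F] W := ∑ t : lˣ, c (torus hl t) ∘ₗ ρ (torus hl t)⁻¹
  have hΦ : ∀ s v, Φ (ρ (torus hl s) v) = τ (torus hl s) (Φ v) + N • c (torus hl s) v := by
    intro s v
    have h : ∀ t, c (torus hl (s * t)) (ρ (torus hl (s * t))⁻¹ (ρ (torus hl s) v)) =
        τ (torus hl s) (c (torus hl t) (ρ (torus hl t)⁻¹ v)) + c (torus hl s) v := by
      intro t
      have h1 : ρ (torus hl s * torus hl t)⁻¹ (ρ (torus hl s) v) = ρ (torus hl t)⁻¹ v := by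
        rw [← Module.End.mul_apply, ← map_mul]; simp
      have h2 : ρ (torus hl t) (ρ (torus hl t)⁻¹ v) = v := by
        rw [← Module.End.mul_apply, ← map_mul]; simp
      rw [torus_mul, h1, extCocycles_apply hc, h2]
    simp only [Φ, LinearMap.sum_apply, LinearMap.comp_apply, map_sum]
    rw [← Equiv.sum_comp (Equiv.mulLeft s)]
    simp only [Equiv.coe_mulLeft, h, Finset.sum_add_distrib, Finset.sum_const, Finset.card_univ, hN,
      Nat.cast_smul_eq_nsmul]
  refine ⟨c + extBoundary ρ τ (N⁻¹ • Φ), ⟨add_mem hc (extCoboundaries_le _ _ ⟨_, rfl⟩),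
    fun s => ?_⟩, ?_⟩
  · ext v
    change c (torus hl s) v +
      (τ (torus hl s) (N⁻¹ • Φ v) - N⁻¹ • Φ (ρ (torus hl s) v)) = 0
    rw [hΦ, map_smul, smul_add, inv_smul_smul₀ hcard]
    abel
  · rw [sub_add_cancel_left]
    exact neg_mem ⟨_, rfl⟩

lemma torusCocycles_mul_left {c : U11 k l → V →ₗ[F] W} (hc : c ∈ torusCocycles hl ρ τ) (t : lˣ)
    (g : U11 k l) (v : V) : c (torus hl t * g) v = τ (torus hl t) (c g v) := by
  rw [extCocycles_apply hc.1, hc.2]; simp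

lemma torusCocycles_mul_right {c : U11 k l → V →ₗ[F] W} (hc : c ∈ torusCocycles hl ρ τ) (t : lˣ)
    (g : U11 k l) (v : V) : c (g * torus hl t) v = c g (ρ (torus hl t) v) := by
  rw [extCocycles_apply hc.1, hc.2]; simp

lemma extCocycles_one {c : U11 k l → V →ₗ[F] W} (hc : c ∈ extCocycles ρ τ) : c 1 = 0 := by
  have := hc 1 1
  simpa [Module.End.one_eq_id] using this

/-- The transpose of an extension cocycle, which describes the dual extension. -/
def transpCocycle (c : U11 k l → V →ₗ[F] W) (g : U11 k l) :
    Module.Dual F W →ₗ[F] Module.Dual F V := (c (transp g)).dualMap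

lemma transpCocycle_apply (c : U11 k l → V →ₗ[F] W) (g : U11 k l) (ξ : Module.Dual F W) (v : V) :
    transpCocycle c g ξ v = ξ (c (transp g) v) := rfl

lemma transpCocycle_mem {c : U11 k l → V →ₗ[F] W} (hc : c ∈ torusCocycles hl ρ τ) :
    transpCocycle c ∈ torusCocycles hl (transpDual τ) (transpDual ρ) := by
  refine ⟨fun g h => ?_, fun t => ?_⟩
  · ext ξ v
    change ξ (c (transp (g * h)) v) = ξ (c (transp h) (ρ (transp g) v)) +
      ξ (τ (transp h) (c (transp g) v))
    rw [transp_mul, extCocycles_apply hc.1, map_add, add_comm]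
  · ext ξ v
    rw [transpCocycle_apply, transp_torus, hc.2]
    simp

end TorusCocycles

section UpperBound

variable {k : Type v} {l F : Type u} [Field k] [Fintype k] [Field l] [Algebra k l] [Field F]
  {V W : Type*} [AddCommGroup V] [Module F V] [AddCommGroup W] [Module F W]
  {p f : ℕ} {hl : Module.finrank k l = 2} {σ : l →+* F}
  {ρ : Representation F (U11 k l) V} {τ : Representation F (U11 k l) W}
  {r r' : Fin f → ℕ} {b b' : ℤ} {c : U11 k l → V →ₗ[F] W} {m : ℕ}

/-- The highest weight of a Serre weight, as an exponent: the torus element `t` acts on the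
highest weight vector by `σ(t)` raised to this number. -/
def weightExp (p : ℕ) (q : ℕ) {f : ℕ} (r : Fin f → ℕ) (b : ℤ) : ℤ :=
  (digitSum p r : ℤ) + (1 - q) * b

/-- The quotient of the highest weights with parameters `(r', b')` and `(r, b)` is the `m`-th power
of the norm. -/
def WeightRatio (p : ℕ) (σ : l →+* F) (k : Type v) [Field k] [Fintype k] [Algebra k l]
    (r r' : Fin f → ℕ) (b b' : ℤ) (m : ℕ) : Prop :=
  ∀ t : lˣ, σ t ^ weightExp p (Fintype.card k) r' b' =
    σ t ^ weightExp p (Fintype.card k) r b * evk k σ (Algebra.norm k (t : l)) ^ m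

variable (DV : HighestWeightData p hl σ ρ r b) (DW : HighestWeightData p hl σ τ r' b')

/-- A cocycle vanishing on the torus gives a homogeneous function on the upper unipotent
matrices. -/
lemma form_cocycle_upper (hc : c ∈ torusCocycles hl ρ τ) (hm : m ≠ 0)
    (hχ : WeightRatio p σ k r r' b b' m) (y : k) :
    DW.form (c (upper y) DV.vec) = DW.form (c (upper 1) DV.vec) * evk k σ y ^ m := by
  by_cases hy : y = 0
  · rw [hy, upper_zero, extCocycles_one hc.1, map_zero, zero_pow hm]; simp
  obtain ⟨t, rfl⟩ := exists_norm_unit hl y hy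
  have h1 : upper (Algebra.norm k (t : l)) * torus hl t = torus hl t * upper 1 := by
    rw [torus_mul_upper, mul_one]
  have h2 := torusCocycles_mul_right hc t (upper (Algebra.norm k (t : l))) DV.vec
  rw [h1, torusCocycles_mul_left hc, DV.torus_vec, map_smul] at h2
  have h3 := congrArg DW.form h2
  rw [DW.form_torus, map_smul, smul_eq_mul] at h3
  change σ t ^ weightExp p (Fintype.card k) r' b' * _ =
    σ t ^ weightExp p (Fintype.card k) r b * _ at h3
  rw [hχ t, mul_assoc] at h3
  have h4 : σ t ^ weightExp p (Fintype.card k) r b ≠ 0 := zpow_ne_zero _ (by simp)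
  rw [← mul_left_cancel₀ h4 h3, mul_comm]

/-- If the leading coefficient of the homogeneous function attached to a cocycle does not vanish,
then its degree is the exponent of a weight of `W`, or one step below the lowest weight in a single
digit. -/
lemma digits_of_form_cocycle_ne_zero [Fact p.Prime] [CharP F p] (hk : Fintype.card k = p ^ f)
    (hr' : ∀ j, r' j < p) (hc : c ∈ torusCocycles hl ρ τ) (hm : m ≠ 0) (hm' : m < p ^ f)
    (hχ : WeightRatio p σ k r r' b b' m) (hC : DW.form (c (upper 1) DV.vec) ≠ 0) :
    (∃ d : Fin f → ℕ, (∀ j, d j ≤ r' j) ∧ m = digitSum p d) ∨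
      ∃ j, m = (r' j + 1) * p ^ (j : ℕ) := by
  have hp : 0 < p := (Fact.out (p := p.Prime)).pos
  set C := DW.form (c (upper 1) DV.vec) with hCdef
  refine digits_of_choose r' hm' fun i hi hpi => ?_
  have hpoly : Polynomial.C C * ((Polynomial.X + 1) ^ m - Polynomial.X ^ m) =
      DW.poly (c (upper 1) DV.vec) := by
    refine eq_of_eval_eq (k := k) σ ?_ ?_ fun y => ?_
    · rw [hk]
      refine lt_of_le_of_lt ?_ hm'
      refine Polynomial.natDegree_C_mul_le _ _ |>.trans ?_
      refine (Polynomial.natDegree_sub_le _ _).trans (max_le ?_ ?_)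
      · refine Polynomial.natDegree_pow_le.trans ?_
        rw [← Polynomial.C_1, Polynomial.natDegree_X_add_C, mul_one]
      · rw [Polynomial.natDegree_X_pow]
    · rw [hk]; exact DW.natDegree_poly_lt hr' hp _
    · rw [DW.eval_poly]
      have h1 := form_cocycle_upper DV DW hc hm hχ (y + 1)
      rw [upper_add, extCocycles_apply hc.1, DV.upper_vec, map_add,
        form_cocycle_upper DV DW hc hm hχ y, ← hCdef, ← eq_sub_iff_add_eq] at h1
      rw [h1]
      simp only [Polynomial.eval_mul, Polynomial.eval_C, Polynomial.eval_sub, Polynomial.eval_pow,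
        Polynomial.eval_add, Polynomial.eval_X, Polynomial.eval_one, map_add, map_one]
      ring
  have hcoeff : (DW.poly (c (upper 1) DV.vec)).coeff i ≠ 0 := by
    rw [← hpoly, Polynomial.coeff_C_mul, Polynomial.coeff_sub, Polynomial.coeff_X_add_one_pow,
      Polynomial.coeff_X_pow, if_neg hi.ne, sub_zero]
    refine mul_ne_zero hC ?_
    rwa [Ne, CharP.cast_eq_zero_iff F p]
  obtain ⟨d, hd, h⟩ := DW.coeff_poly_ne_zero hcoeff
  exact ⟨d, fun j => ⟨hd j, (hd j).trans_lt (hr' j)⟩, h⟩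

lemma evk_norm_ne_zero (hl : Module.finrank k l = 2) (σ : l →+* F) (t : lˣ) :
    evk k σ (Algebra.norm k (t : l)) ≠ 0 := by
  have : Module.Finite k l := Module.finite_of_finrank_pos (by omega)
  rw [map_ne_zero, Algebra.norm_ne_zero_iff]
  exact t.ne_zero

/-- If the degree of the homogeneous function attached to a cocycle is the exponent of a weight
of `W`, then a coboundary removes it. -/
lemma exists_form_upper_eq_zero (hp : 0 < p) (hk : Fintype.card k = p ^ f)
    (hr' : ∀ j, r' j < p) (hm : m ≠ 0)
    (hχ : WeightRatio p σ k r r' b b' m) {d : Fin f → ℕ} (hd : ∀ j, d j ≤ r' j)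
    (hmd : m = digitSum p d) :
    ∃ c' ∈ torusCocycles hl ρ τ, c' ∈ extCoboundaries ρ τ ∧
      DW.form (c' (upper 1) DV.vec) = 1 ∧ DW.form (c' (lower 1) DV.vec) = 0 := by
  let d' : ∀ j, Fin (r' j + 1) := fun j => ⟨d j, Nat.lt_succ_of_le (hd j)⟩
  set w := DW.basis d' with hw
  have hform : ∀ y : k, DW.form (τ (upper y) w) = evk k σ y ^ m := fun y => by
    rw [hmd]; exact DW.basis_spec d' y
  have hform0 : DW.form w = 0 := by
    have := hform 0
    rwa [upper_zero, map_one, Module.End.one_apply, map_zero, zero_pow hm] at this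
  have htor : ∀ t, τ (torus hl t) w = σ t ^ weightExp p (Fintype.card k) r b • w := fun t => by
    have h1 := DW.torus_basis hk hr' hp t d'
    change evk k σ (Algebra.norm k (t : l)) ^ (digitSum p d) • _ =
      σ t ^ weightExp p (Fintype.card k) r' b' • _ at h1
    rw [← hmd, hχ t, mul_comm, mul_smul] at h1
    exact smul_right_injective _ (pow_ne_zero m (evk_norm_ne_zero hl σ t)) h1
  let φ : V →ₗ[F] W := DV.form.smulRight w
  refine ⟨extBoundary ρ τ φ, ⟨extCoboundaries_le _ _ ⟨φ, rfl⟩, fun t => ?_⟩, ⟨φ, rfl⟩, ?_, ?_⟩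
  · ext v
    rw [extBoundary_apply]
    simp only [φ, LinearMap.smulRight_apply, map_smul, htor, DV.form_torus, LinearMap.zero_apply]
    rw [smul_smul, mul_comm, sub_eq_zero]
    rfl
  · rw [extBoundary_apply]
    simp only [φ, LinearMap.smulRight_apply, map_smul, map_sub, hform, hform0, DV.upper_vec,
      DV.form_vec]
    simp
  · rw [extBoundary_apply]
    simp only [φ, LinearMap.smulRight_apply, map_smul, map_sub, DW.form_lower, hform0,
      DV.form_lower]
    simp

/-- The dual of `exists_form_upper_eq_zero`. -/
lemma exists_form_lower_eq_zero (hp : 0 < p) (hk : Fintype.card k = p ^ f)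
    (hr : ∀ j, r j < p) (hm : m ≠ 0)
    (hχ : WeightRatio p σ k r' r b' b m) {d : Fin f → ℕ} (hd : ∀ j, d j ≤ r j)
    (hmd : m = digitSum p d) :
    ∃ c' ∈ torusCocycles hl ρ τ, c' ∈ extCoboundaries ρ τ ∧
      DW.form (c' (upper 1) DV.vec) = 0 ∧ DW.form (c' (lower 1) DV.vec) = 1 := by
  let d' : ∀ j, Fin (r j + 1) := fun j => ⟨d j, Nat.lt_succ_of_le (hd j)⟩
  set ξ := DV.dualBasis d' with hξ
  have hform : ∀ y : k, ξ (ρ (lower y) DV.vec) = evk k σ y ^ m := fun y => by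
    rw [hmd]; exact DV.dualBasis_spec d' y
  have hform0 : ξ DV.vec = 0 := by
    have := hform 0
    rwa [lower_zero, map_one, Module.End.one_apply, map_zero, zero_pow hm] at this
  have htor : ∀ t v, ξ (ρ (torus hl t) v) = σ t ^ weightExp p (Fintype.card k) r' b' * ξ v :=
    fun t v => by
    have h1 := LinearMap.congr_fun (DV.dual.torus_basis hk hr hp t d') v
    change evk k σ (Algebra.norm k (t : l)) ^ (digitSum p d) * ξ (ρ (transp (torus hl t)) v) =
      σ t ^ weightExp p (Fintype.card k) r b * ξ v at h1
    rw [← hmd, hχ t, mul_comm (_ ^ _), mul_comm (_ ^ _) (_ ^ m), mul_assoc, mul_comm (ξ _),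
      transp_torus] at h1
    exact mul_left_cancel₀ (pow_ne_zero m (evk_norm_ne_zero hl σ t)) h1
  let φ : V →ₗ[F] W := -ξ.smulRight DW.vec
  refine ⟨extBoundary ρ τ φ, ⟨extCoboundaries_le _ _ ⟨φ, rfl⟩, fun t => ?_⟩, ⟨φ, rfl⟩, ?_, ?_⟩
  · ext v
    rw [extBoundary_apply]
    simp only [φ, LinearMap.neg_apply, map_neg, LinearMap.smulRight_apply, map_smul, htor,
      DW.torus_vec, LinearMap.zero_apply]
    rw [smul_smul, mul_comm, sub_eq_zero]
    rfl
  · rw [extBoundary_apply]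
    simp only [φ, LinearMap.neg_apply, map_neg, LinearMap.smulRight_apply, map_smul, map_sub,
      DW.upper_vec, DV.upper_vec, hform0]
    simp
  · rw [extBoundary_apply]
    simp only [φ, LinearMap.neg_apply, map_neg, LinearMap.smulRight_apply, map_smul, map_sub,
      DW.form_lower, hform, hform0, DW.form_vec]
    simp

end UpperBound

/-! ### Vanishing of cocycles -/

section BigCell

variable {k : Type v} {l F : Type u} [Field k] [Fintype k] [Field l] [Algebra k l] [Field F]
  {V W : Type*} [AddCommGroup V] [Module F V] [AddCommGroup W] [Module F W]
  {p f : ℕ} {hl : Module.finrank k l = 2} {σ : l →+* F}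
  {ρ : Representation F (U11 k l) V} {τ : Representation F (U11 k l) W}
  {r r' : Fin f → ℕ} {b b' : ℤ} {c : U11 k l → V →ₗ[F] W} {m m' : ℕ}
  (DV : HighestWeightData p hl σ ρ r b) (DW : HighestWeightData p hl σ τ r' b')

lemma form_cocycle_lower (hc : c ∈ torusCocycles hl ρ τ) (hm' : m' ≠ 0)
    (hχ' : WeightRatio p σ k r' r b' b m') (y : k) :
    DW.form (c (lower y) DV.vec) = DW.form (c (lower 1) DV.vec) * evk k σ y ^ m' := by
  have h := form_cocycle_upper DW.dual DV.dual (transpCocycle_mem hc) hm' hχ' y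
  simpa [HighestWeightData.dual_form, transpCocycle_apply] using h

/-- If the homogeneous function on the upper unipotent group attached to a cocycle vanishes, the
cocycle restricted to this group kills the highest weight vector. -/
lemma cocycle_upper_vec (hp : 0 < p) (hk : Fintype.card k = p ^ f) (hr' : ∀ j, r' j < p)
    (hc : c ∈ torusCocycles hl ρ τ) (hm : m ≠ 0) (hχ : WeightRatio p σ k r r' b b' m)
    (hA : DW.form (c (upper 1) DV.vec) = 0) (y : k) : c (upper y) DV.vec = 0 := by
  refine DW.eq_of_form_upper hk hr' hp fun a => ?_
  have h0 : ∀ z : k, DW.form (c (upper z) DV.vec) = 0 := fun z => by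
    rw [form_cocycle_upper DV DW hc hm hχ, hA, zero_mul]
  have h1 := h0 (a + y)
  rw [upper_add, extCocycles_apply hc.1, DV.upper_vec, map_add, h0, add_zero] at h1
  rw [h1, map_zero, map_zero]

lemma form_comp_cocycle_lower (hp : 0 < p) (hk : Fintype.card k = p ^ f) (hr : ∀ j, r j < p)
    (hc : c ∈ torusCocycles hl ρ τ) (hm' : m' ≠ 0) (hχ' : WeightRatio p σ k r' r b' b m')
    (hB : DW.form (c (lower 1) DV.vec) = 0) (y : k) (v : V) : DW.form (c (lower y) v) = 0 := by
  have h := cocycle_upper_vec DW.dual DV.dual hp hk hr (transpCocycle_mem hc) hm' hχ'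
    (by simpa [HighestWeightData.dual_form, transpCocycle_apply] using hB) y
  simpa [transpCocycle_apply] using LinearMap.congr_fun h v

section

variable (hc : c ∈ torusCocycles hl ρ τ) (hN : ∀ y : k, c (upper y) DV.vec = 0)
  (hN' : ∀ (y : k) v, DW.form (c (lower y) v) = 0)
include hc hN hN'

omit hN in
lemma form_cocycle_lower_mul (x : k) (g : U11 k l) (v : V) :
    DW.form (c (lower x * g) v) = DW.form (c g v) := by
  rw [extCocycles_apply hc.1, map_add, hN', add_zero, DW.form_lower]

omit hN' in
lemma form_cocycle_mul_upper (y : k) (g : U11 k l) :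
    DW.form (c (g * upper y) DV.vec) = DW.form (c g DV.vec) := by
  rw [extCocycles_apply hc.1, hN, map_zero, zero_add, DV.upper_vec]

/-- The matrix coefficient of the cocycle vanishes on the big cell. -/
lemma form_cocycle_bigCell (g : U11 k l) (hg : (g.1 : Matrix (Fin 2) (Fin 2) l) 0 0 ≠ 0) :
    DW.form (c g DV.vec) = 0 := by
  obtain ⟨x, t, y, rfl⟩ := exists_lower_torus_upper hl g hg
  rw [form_cocycle_mul_upper DV DW hc hN, form_cocycle_lower_mul DW hc hN', hc.2]
  simp

/-- A cocycle whose matrix coefficient vanishes identically is a coboundary. -/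
lemma mem_extCoboundaries_of_form_eq_zero (hp : 0 < p) (hk : Fintype.card k = p ^ f)
    (hr : ∀ j, r j < p) (hr' : ∀ j, r' j < p)
    (hK : DW.form (c (weylElt k l) DV.vec) = 0) : c ∈ extCoboundaries ρ τ := by
  have hF : ∀ g, DW.form (c g DV.vec) = 0 := by
    intro g
    by_cases hg : (g.1 : Matrix (Fin 2) (Fin 2) l) 0 0 = 0
    · obtain ⟨t, y, rfl⟩ := exists_weylElt_torus_upper hl g hg
      rw [form_cocycle_mul_upper DV DW hc hN, torusCocycles_mul_right hc, DV.torus_vec,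
        map_smul, map_smul, hK, smul_zero]
    · exact form_cocycle_bigCell DV DW hc hN hN' g hg
  -- `Φ` is injective, and `Φ⁻¹ ∘ Ψ` sends `h v` to `c(h) v` for the highest weight vector `v`
  let Φ : W →ₗ[F] k → F := LinearMap.pi fun y => DW.form ∘ₗ τ (upper y)
  let Ψ : V →ₗ[F] k → F := LinearMap.pi fun y => -(DW.form ∘ₗ c (upper y))
  have hΦ : LinearMap.ker Φ = ⊥ := by
    rw [LinearMap.ker_eq_bot]
    intro w w' h
    exact DW.eq_of_form_upper hk hr' hp fun y => congrFun h y
  have hΨ : ∀ h, Ψ (ρ h DV.vec) = Φ (c h DV.vec) := by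
    intro h
    funext y
    have h1 := hF (upper y * h)
    rw [extCocycles_apply hc.1, map_add] at h1
    exact (eq_neg_of_add_eq_zero_left h1).symm
  obtain ⟨L, hL⟩ := LinearMap.exists_leftInverse_of_injective Φ hΦ
  have hφ : ∀ h, L (Ψ (ρ h DV.vec)) = c h DV.vec := fun h => by
    rw [hΨ]; exact LinearMap.congr_fun hL _
  refine mem_extCoboundaries.2 ⟨-(L ∘ₗ Ψ), fun g v => ?_⟩
  have hv : v ∈ Submodule.span F (Set.range fun g : U11 k l => ρ g DV.vec) := by
    rw [DV.span_eq_top hk hr hp]; trivial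
  have hlin : c g = τ g ∘ₗ (-(L ∘ₗ Ψ)) - (-(L ∘ₗ Ψ)) ∘ₗ ρ g := by
    refine LinearMap.ext_on_range (DV.span_eq_top hk hr hp) fun h => ?_
    simp only [LinearMap.sub_apply, LinearMap.comp_apply, LinearMap.neg_apply, map_neg, hφ]
    rw [← Module.End.mul_apply, ← map_mul, hφ, extCocycles_apply hc.1]
    abel
  exact LinearMap.congr_fun hlin v

/-- If the matrix coefficient of a cocycle does not vanish on the small cell, its translates give
all functions on `k`, which bounds `|k|` by the dimension of the extension. -/
lemma card_le_of_form_weylElt_ne_zero (hK : DW.form (c (weylElt k l) DV.vec) ≠ 0) :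
    Fintype.card k ≤ ∏ j, (r j + 1) + ∏ j, (r' j + 1) := by
  classical
  have := DV.finite
  have := DW.finite
  let Ψ : V × W →ₗ[F] k → F := LinearMap.pi fun y =>
    LinearMap.coprod (DW.form ∘ₗ c (upper y)) (DW.form ∘ₗ τ (upper y))
  have hΨ : Function.Surjective Ψ := by
    rw [← LinearMap.range_eq_top, eq_top_iff, ← (Pi.basisFun F k).span_eq, Submodule.span_le]
    rintro _ ⟨a, rfl⟩
    refine ⟨(DW.form (c (weylElt k l) DV.vec))⁻¹ • (ρ (upper (-a) * weylElt k l) DV.vec,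
      c (upper (-a) * weylElt k l) DV.vec), ?_⟩
    rw [map_smul]
    funext y
    have h1 : Ψ (ρ (upper (-a) * weylElt k l) DV.vec, c (upper (-a) * weylElt k l) DV.vec) y =
        DW.form (c (upper (y - a) * weylElt k l) DV.vec) := by
      rw [sub_eq_add_neg, upper_add, mul_assoc, extCocycles_apply hc.1 (upper y), map_add, add_comm]
      rfl
    rw [Pi.smul_apply, h1, Pi.basisFun_apply]
    by_cases hy : y = a
    · subst hy
      rw [sub_self, upper_zero, one_mul, Pi.single_eq_same, smul_eq_mul, inv_mul_cancel₀ hK]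
    · have h2 : DW.form (c (upper (y - a) * weylElt k l) DV.vec) = 0 := by
        refine form_cocycle_bigCell DV DW hc hN hN' _ ?_
        rw [U11_coe_mul]
        simpa [upper, weylElt, U11.mk_val, Matrix.mul_apply, sub_eq_zero] using Ne.symm hy
      rw [h2, Pi.single_eq_of_ne hy, smul_zero]
  have h := LinearMap.finrank_le_finrank_of_surjective hΨ
  rwa [Module.finrank_fintype_fun_eq_card, Module.finrank_prod, DV.finrank_eq, DW.finrank_eq] at h

omit hN hN' in
/-- The Weyl element sends `t` to `t^{-q}`, so a nonzero matrix coefficient on the small cell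
relates the highest weight of `W` to the `-q`-th power of the one of `V`. -/
lemma weightExp_of_form_weylElt_ne_zero (hK : DW.form (c (weylElt k l) DV.vec) ≠ 0) (t : lˣ) :
    σ t ^ weightExp p (Fintype.card k) r' b' =
      σ t ^ (-((Fintype.card k : ℤ) * weightExp p (Fintype.card k) r b)) := by
  have h1 : torus hl t * weylElt k l = weylElt k l * torus hl (t ^ (-(Fintype.card k : ℤ))) := by
    apply U11_ext
    rw [U11_coe_mul, U11_coe_mul]
    have := pow_card_card hl (t : l)
    ext i j
    fin_cases i <;> fin_cases j <;>
      simp [torus, weylElt, U11.mk_val, Matrix.mul_apply, this]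
  have h2 := torusCocycles_mul_left hc t (weylElt k l) DV.vec
  rw [h1, torusCocycles_mul_right hc, DV.torus_vec, map_smul] at h2
  have h3 := congrArg DW.form h2
  rw [DW.form_torus, map_smul, smul_eq_mul] at h3
  rw [← neg_mul, zpow_mul]
  have h4 : σ ((t ^ (-(Fintype.card k : ℤ)) : lˣ) : l) = σ t ^ (-(Fintype.card k : ℤ)) := by
    rw [Units.val_zpow_eq_zpow_val, map_zpow₀]
  rw [← h4]
  exact (mul_right_cancel₀ hK h3).symm

end

end BigCell

/-! ### The prime field case -/

section

open scoped Nat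

section ForwardDifferences

variable {k : Type v} {l F : Type u} [Field k] [Field l] [Algebra k l] [Field F]
  {p : ℕ}

lemma fwdDiff_iter_comp_evk (σ : l →+* F) (g : F → F) (n : ℕ) (y : k) :
    (fwdDiff 1)^[n] (fun y : k => g (evk k σ y)) y = (fwdDiff 1)^[n] g (evk k σ y) := by
  rw [fwdDiff_iter_eq_sum_shift, fwdDiff_iter_eq_sum_shift]
  refine Finset.sum_congr rfl fun j _ => ?_
  rw [map_add, map_nsmul, map_one]

/-- On a prime field of characteristic `p`, the `n`-th difference of a polynomial function of
degree less than `p` vanishes only if the degree is less than `n`. -/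
lemma natDegree_lt_of_fwdDiff_iter_eq_zero [Fact p.Prime] [CharP F p] (σ : l →+* F)
    {P : Polynomial F} (hP : P.natDegree < p) {n : ℕ}
    (h : ∀ y : k, (fwdDiff 1)^[n] (fun y : k => P.eval (evk k σ y)) y = 0) :
    P = 0 ∨ P.natDegree < n := by
  by_contra! hc
  obtain ⟨h0, hn⟩ := hc
  obtain ⟨j, hj⟩ := Nat.exists_eq_add_of_le hn
  have hz : (fwdDiff 1)^[n] (fun y : k => P.eval (evk k σ y)) = 0 := funext h
  have h1 : (fwdDiff 1)^[P.natDegree] (fun y : k => P.eval (evk k σ y)) 0 = 0 := by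
    rw [hj, add_comm, Function.iterate_add_apply, hz]
    have : (0 : k → F) = (0 : F) • (0 : k → F) := by simp
    rw [this, fwdDiff_iter_const_smul, zero_smul]
    rfl
  rw [fwdDiff_iter_comp_evk σ (fun x => P.eval x)] at h1
  have h2 := congrFun (Polynomial.fwdDiff_iter_degree_eq_factorial P) (evk k σ 0)
  rw [h1] at h2
  have h3 : P.leadingCoeff * ((P.natDegree)! : F) = 0 := h2.symm
  rw [mul_eq_zero, Polynomial.leadingCoeff_eq_zero, or_iff_right h0,
    CharP.cast_eq_zero_iff F p, (Fact.out (p := p.Prime)).dvd_factorial] at h3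
  omega

/-- In characteristic `p`, the `p`-th difference of any function vanishes. -/
lemma fwdDiff_iter_char [Fact p.Prime] [CharP F p] [CharP k p] (hp : p ≠ 2) (g : k → F) (y : k) :
    (fwdDiff 1)^[p] g y = 0 := by
  have hpp : p.Prime := Fact.out
  rw [fwdDiff_iter_eq_sum_shift, Finset.sum_range_succ, Finset.sum_eq_single_of_mem 0]
  · have : p • (1 : k) = 0 := by simp
    simp [this, (hpp.odd_of_ne_two hp).neg_one_pow]
  · simp [hpp.pos]
  · intro j hj hj0
    have h1 : ((p.choose j : ℕ) : F) = 0 := by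
      rw [CharP.cast_eq_zero_iff F p]
      exact hpp.dvd_choose_self hj0 (Finset.mem_range.1 hj)
    rw [mul_smul, Nat.cast_smul_eq_nsmul, nsmul_eq_mul, h1, zero_mul, smul_zero]

end ForwardDifferences

section UnipotentDifferences

variable {k : Type v} {l F : Type u} [Field k] [Fintype k] [Field l] [Algebra k l] [Field F]
  {V W : Type*} [AddCommGroup V] [Module F V] [AddCommGroup W] [Module F W]
  {p f : ℕ} {hl : Module.finrank k l = 2} {σ : l →+* F}
  {ρ : Representation F (U11 k l) V} {τ : Representation F (U11 k l) W}
  {r r' : Fin f → ℕ} {b b' : ℤ} {c : U11 k l → V →ₗ[F] W} {m m' : ℕ}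
  (DV : HighestWeightData p hl σ ρ r b) (DW : HighestWeightData p hl σ τ r' b')

/-- Applying the difference operator of the upper unipotent group to the lowest weight vector
gives a multiple of the highest weight vector. In an extension, this relates the matrix
coefficient of the cocycle on the small cell to its restriction to the unipotent group. -/
lemma fwdDiff_form_cocycle (hp : 0 < p) (hk : Fintype.card k = p ^ f)
    (hr : ∀ j, r j < p) (hc : c ∈ torusCocycles hl ρ τ) :
    ∃ w, ∀ y : k, (fwdDiff 1)^[digitSum p r]
      (fun y : k => DW.form (c (upper y * weylElt k l) DV.vec)) y =
      DW.form (τ (upper y) w) +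
        (-1) ^ digitSum p r * ((digitSum p r)! : F) * DW.form (c (upper y) DV.vec) := by
  set N := digitSum p r with hN
  have hG : ∀ y : k, DV.form (ρ (upper y) (ρ (weylElt k l) DV.vec)) = (-1) ^ N * evk k σ y ^ N := by
    intro y
    rw [← Module.End.mul_apply, ← map_mul, DV.coeff, U11_coe_mul]
    simp [upper, weylElt, U11.mk_val, Matrix.mul_apply, ← hN, neg_pow (σ (algebraMap k l y))]
  have hvec : ∑ j ∈ Finset.range (N + 1), ((-1 : ℤ) ^ (N - j) * N.choose j) •
      ρ (upper (j • 1)) (ρ (weylElt k l) DV.vec) = ((-1 : F) ^ N * (N ! : F)) • DV.vec := by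
    refine DV.eq_of_form_upper hk hr hp fun y => ?_
    rw [map_smul, map_smul, DV.upper_vec, DV.form_vec, map_sum, map_sum]
    have h1 := congrFun (fwdDiff_iter_eq_factorial (R := F) (n := N)) (evk k σ y)
    rw [← fwdDiff_iter_comp_evk σ (fun x => x ^ N), fwdDiff_iter_eq_sum_shift] at h1
    rw [smul_eq_mul, mul_one]
    have h2 : ((N ! : F → F) (evk k σ y)) = (N ! : F) := rfl
    rw [h2] at h1
    rw [← h1, Finset.mul_sum]
    refine Finset.sum_congr rfl fun j _ => ?_
    rw [map_zsmul, map_zsmul, ← Module.End.mul_apply (ρ (upper y)), ← map_mul, ← upper_add, hG,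
      mul_smul_comm]
  refine ⟨∑ j ∈ Finset.range (N + 1), ((-1 : ℤ) ^ (N - j) * N.choose j) •
      c (upper (j • 1) * weylElt k l) DV.vec, fun y => ?_⟩
  rw [fwdDiff_iter_eq_sum_shift, ← smul_eq_mul, ← map_smul, ← map_smul, ← hvec, map_sum, map_sum,
    map_sum, map_sum, ← Finset.sum_add_distrib]
  refine Finset.sum_congr rfl fun j _ => ?_
  rw [map_zsmul, map_zsmul, map_zsmul, map_zsmul, ← smul_add, upper_add, mul_assoc,
    extCocycles_apply hc.1 (upper y), map_add, map_mul, Module.End.mul_apply]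

end UnipotentDifferences

section PrimeField

variable {k : Type v} {l F : Type u} [Field k] [Fintype k] [Field l] [Algebra k l] [Field F]
  {V W : Type*} [AddCommGroup V] [Module F V] [AddCommGroup W] [Module F W]
  {p : ℕ} {hl : Module.finrank k l = 2} {σ : l →+* F}
  {ρ : Representation F (U11 k l) V} {τ : Representation F (U11 k l) W}
  {r r' : Fin 1 → ℕ} {b b' : ℤ} {c : U11 k l → V →ₗ[F] W} {m m' : ℕ}
  (DV : HighestWeightData p hl σ ρ r b) (DW : HighestWeightData p hl σ τ r' b')

/-- Over the prime field, the matrix coefficient on the upper unipotent group cannot have degree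
`r'₀ + 1`, one more than the largest exponent occurring in `W`, if the two weights are large: the
`p`-th difference of the function on the small cell vanishes. -/
lemma form_upper_eq_zero_of_prime [Fact p.Prime] [CharP F p] [CharP k p] (hp : p ≠ 2)
    (hk : Fintype.card k = p ^ 1) (hr : ∀ j, r j < p) (hr' : ∀ j, r' j + 1 < p)
    (hc : c ∈ torusCocycles hl ρ τ) (hχ : WeightRatio p σ k r r' b b' m)
    (hm : m = r' 0 + 1) (hle : p ≤ r 0 + r' 0 + 1) :
    DW.form (c (upper 1) DV.vec) = 0 := by
  have hp0 : 0 < p := (Fact.out (p := p.Prime)).pos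
  set N := digitSum p r with hN
  have hN0 : N = r 0 := by simp [hN, digitSum]
  obtain ⟨w, hw⟩ := fwdDiff_form_cocycle DV DW hp0 hk hr hc
  rw [← hN] at hw
  set C := DW.form (c (upper 1) DV.vec) with hC
  have hN' : digitSum p r' = r' 0 := by simp [digitSum]
  have hcoeff : ∀ i, r' 0 < i → (DW.poly w).coeff i = 0 := by
    intro i hi
    by_contra hne
    obtain ⟨d, hd, rfl⟩ := DW.coeff_poly_ne_zero hne
    have := hd 0
    simp [digitSum] at hi
    omega
  set P : Polynomial F := DW.poly w +
    Polynomial.C ((-1) ^ N * (N ! : F) * C) * Polynomial.X ^ m with hP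
  have heval : ∀ y : k,
      (fwdDiff 1)^[N] (fun y : k => DW.form (c (upper y * weylElt k l) DV.vec)) y =
      P.eval (evk k σ y) := by
    intro y
    rw [hw, form_cocycle_upper DV DW hc (by omega) hχ, hP, Polynomial.eval_add, DW.eval_poly]
    simp only [Polynomial.eval_mul, Polynomial.eval_C, Polynomial.eval_pow, Polynomial.eval_X]
    ring
  have hdeg : P.natDegree < p := by
    refine lt_of_le_of_lt (Polynomial.natDegree_le_iff_coeff_eq_zero.2 fun i hi => ?_) (hr' 0)
    rw [hP, Polynomial.coeff_add, hcoeff i (by omega), Polynomial.coeff_C_mul_X_pow,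
      if_neg (by omega),
      add_zero]
  have hz : ∀ y : k, (fwdDiff 1)^[p - N] (fun y : k => P.eval (evk k σ y)) y = 0 := by
    intro y
    rw [← funext heval, ← Function.iterate_add_apply, Nat.sub_add_cancel (by have := hr 0; omega)]
    exact fwdDiff_iter_char hp _ y
  have hcm : P.coeff m = 0 := by
    rcases natDegree_lt_of_fwdDiff_iter_eq_zero σ hdeg hz with h | h
    · rw [h, Polynomial.coeff_zero]
    · exact Polynomial.coeff_eq_zero_of_natDegree_lt (by omega)
  rw [hP, Polynomial.coeff_add, hcoeff m (by omega), zero_add, Polynomial.coeff_C_mul_X_pow,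
    if_pos rfl, mul_eq_zero] at hcm
  refine hcm.resolve_left (mul_ne_zero (by simp) ?_)
  rw [Ne, CharP.cast_eq_zero_iff F p, (Fact.out (p := p.Prime)).dvd_factorial]
  have := hr 0
  omega

/-- The dual of `form_upper_eq_zero_of_prime`. -/
lemma form_lower_eq_zero_of_prime [Fact p.Prime] [CharP F p] [CharP k p] (hp : p ≠ 2)
    (hk : Fintype.card k = p ^ 1) (hr : ∀ j, r j + 1 < p) (hr' : ∀ j, r' j < p)
    (hc : c ∈ torusCocycles hl ρ τ) (hχ' : WeightRatio p σ k r' r b' b m')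
    (hm' : m' = r 0 + 1) (hle : p ≤ r 0 + r' 0 + 1) :
    DW.form (c (lower 1) DV.vec) = 0 := by
  have h := form_upper_eq_zero_of_prime DW.dual DV.dual hp hk hr' hr (transpCocycle_mem hc) hχ'
    hm' (by omega)
  simpa [HighestWeightData.dual_form, transpCocycle_apply] using h

/-- Over the prime field, if the two weights add up to `p - 3`, the matrix coefficient on the lower
unipotent group vanishes with the one on the upper unipotent group. -/
lemma form_lower_eq_zero_of_form_upper [Fact p.Prime] [CharP F p]
    (hk : Fintype.card k = p ^ 1) (hr : ∀ j, r j < p)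
    (hc : c ∈ torusCocycles hl ρ τ) (hN : ∀ y : k, c (upper y) DV.vec = 0)
    (hχ' : WeightRatio p σ k r' r b' b m')
    (hm' : m' = r 0 + 1) (hsum : r 0 + r' 0 + 3 = p) :
    DW.form (c (lower 1) DV.vec) = 0 := by
  have hp0 : 0 < p := (Fact.out (p := p.Prime)).pos
  have hN0 : digitSum p r = r 0 := by simp [digitSum]
  obtain ⟨w, hw⟩ := fwdDiff_form_cocycle DV DW hp0 hk hr hc
  set C := DW.form (c (lower 1) DV.vec) with hC
  set κ := DW.form (c (weylElt k l) DV.vec) with hκ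
  -- for `y ≠ 0` the matrix `upper y * w` lies in the big cell
  have hG : ∀ y : k, y ≠ 0 → DW.form (c (upper y * weylElt k l) DV.vec) =
      (-1) ^ (r 0) * C * evk k σ y ^ (p - 2) := by
    intro y hy
    have hy' : algebraMap k l y ≠ 0 := by simpa using hy
    let t : lˣ := -(Units.mk0 _ hy')
    have hdec : upper y * weylElt k l = lower y⁻¹ * torus hl t * upper (-y⁻¹) := by
      apply U11_ext
      rw [U11_coe_mul, U11_coe_mul, U11_coe_mul]
      have h1 : (-algebraMap k l y) ^ Fintype.card k = -algebraMap k l y := by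
        rw [← map_neg, algebraMap_pow_card]
      ext i j
      fin_cases i <;> fin_cases j <;>
        simp [torus, weylElt, lower, upper, U11.mk_val, Matrix.mul_apply, h1, t, hy]
    have h2 : σ t ^ ((digitSum p r : ℤ) + (1 - Fintype.card k) * b) =
        (-1) ^ (r 0) * evk k σ y ^ (r 0) := by
      have h3 : (σ t) ^ (Fintype.card k : ℤ) = σ t := by
        rw [zpow_natCast, ← map_pow]
        congr 1
        simp only [t, Units.val_neg, Units.val_mk0]
        rw [← map_neg, algebraMap_pow_card]
      have h4 : σ t ≠ 0 := by simp
      rw [zpow_add₀ h4, zpow_mul, zpow_sub₀ h4, h3, zpow_one, div_self h4, one_zpow, mul_one,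
        zpow_natCast, hN0, ← mul_pow]
      simp [t]
    rw [hdec, extCocycles_apply hc.1, hN, map_zero, zero_add, DV.upper_vec,
      torusCocycles_mul_right hc, DV.torus_vec, map_smul, map_smul, h2,
      form_cocycle_lower DV DW hc (by omega) hχ', hm', map_inv₀, smul_eq_mul, ← hC]
    have h5 : evk k σ y ≠ 0 := by simpa using hy
    have h6 : evk k σ y ^ (p - 2) * evk k σ y = 1 := by
      have h7 : y ^ (p - 1) = 1 := by
        have := FiniteField.pow_card_sub_one_eq_one y hy
        rwa [hk, pow_one] at this
      rw [← pow_succ, show p - 2 + 1 = p - 1 by omega, ← map_pow, h7, map_one]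
    rw [eq_comm, ← mul_right_inj' h5, mul_left_comm, mul_comm _ (_ ^ (p - 2)), h6, inv_pow]
    field_simp
    ring
  set P : Polynomial F := Polynomial.C ((-1) ^ (r 0) * C) * Polynomial.X ^ (p - 2) +
    (Polynomial.C κ - Polynomial.C κ * Polynomial.X ^ (p - 1)) with hP
  have heval : ∀ y : k, DW.form (c (upper y * weylElt k l) DV.vec) = P.eval (evk k σ y) := by
    intro y
    by_cases hy : y = 0
    · rw [hy, upper_zero, one_mul, hP, ← hκ]
      simp [show p - 2 ≠ 0 by omega, show p - 1 ≠ 0 by omega]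
    · have h7 : evk k σ y ^ (p - 1) = 1 := by
        have := FiniteField.pow_card_sub_one_eq_one y hy
        rw [hk, pow_one] at this
        rw [← map_pow, this, map_one]
      rw [hG y hy, hP]
      simp only [Polynomial.eval_add, Polynomial.eval_sub, Polynomial.eval_mul, Polynomial.eval_C,
        Polynomial.eval_pow, Polynomial.eval_X, h7]
      ring
  have hdeg : P.natDegree < p := by
    refine lt_of_le_of_lt (b := p - 1) (Polynomial.natDegree_le_iff_coeff_eq_zero.2 fun i hi => ?_)
      (by omega)
    rw [hP, Polynomial.coeff_add, Polynomial.coeff_sub, Polynomial.coeff_C_mul_X_pow,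
      Polynomial.coeff_C_mul_X_pow, Polynomial.coeff_C, if_neg (by omega), if_neg (by omega),
      if_neg (by omega)]
    simp
  -- the difference of order `r₀` lies in `W`, so that `r'₀ + 1` further differences kill it
  have hz : ∀ y : k, (fwdDiff 1)^[p - 2] (fun y : k => P.eval (evk k σ y)) y = 0 := by
    intro y
    have h1 : ∀ y : k, (fwdDiff 1)^[digitSum p r]
        (fun y : k => DW.form (c (upper y * weylElt k l) DV.vec)) y =
        (DW.poly w).eval (evk k σ y) := by
      intro y
      rw [hw, hN, map_zero, mul_zero, add_zero, DW.eval_poly]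
    rw [← funext heval, show p - 2 = (r' 0 + 1) + digitSum p r by omega,
      Function.iterate_add_apply, funext h1, fwdDiff_iter_comp_evk σ (fun x => (DW.poly w).eval x)]
    refine congrFun (Polynomial.fwdDiff_iter_eq_zero_of_degree_lt (P := DW.poly w) ?_) _
    refine Nat.lt_succ_of_le (Polynomial.natDegree_le_iff_coeff_eq_zero.2 fun i hi => ?_)
    by_contra hne
    obtain ⟨d, hd, rfl⟩ := DW.coeff_poly_ne_zero hne
    have := hd 0
    simp [digitSum] at hi
    omega
  have hcm : P.coeff (p - 2) = 0 := by
    rcases natDegree_lt_of_fwdDiff_iter_eq_zero σ hdeg hz with h | h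
    · rw [h, Polynomial.coeff_zero]
    · exact Polynomial.coeff_eq_zero_of_natDegree_lt h
  rw [hP, Polynomial.coeff_add, Polynomial.coeff_sub, Polynomial.coeff_C_mul_X_pow,
      Polynomial.coeff_C_mul_X_pow, Polynomial.coeff_C, if_pos rfl, if_neg (by omega),
      if_neg (by omega), sub_zero, add_zero, mul_eq_zero] at hcm
  exact hcm.resolve_left (by simp)

end PrimeField

end

/-! ### Dimension of the extension group -/

section Characters

variable {k : Type v} {l F : Type u} [Field k] [Fintype k] [Field l] [Algebra k l] [Field F]
  {p f : ℕ} {r r' : Fin f → ℕ} {b b' : ℤ} {m m' : ℕ}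

/-- Equality of characters of the torus, in terms of exponents. -/
lemma forall_zpow_eq_iff (hl : Module.finrank k l = 2) (σ : l →+* F) (a b : ℤ) :
    (∀ t : lˣ, σ t ^ a = σ t ^ b) ↔ a ≡ b [ZMOD (Fintype.card k : ℤ) ^ 2 - 1] := by
  classical
  have : Module.Finite k l := Module.finite_of_finrank_pos (by omega)
  have : Finite l := Module.finite_of_finite k
  have := Fintype.ofFinite l
  have hcard : ((Fintype.card lˣ : ℕ) : ℤ) = (Fintype.card k : ℤ) ^ 2 - 1 := by
    have h1 : Fintype.card lˣ + 1 = Fintype.card k ^ 2 := by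
      rw [Fintype.card_units, Module.card_eq_pow_finrank (K := k) (V := l), hl]
      have : 0 < Fintype.card k ^ 2 := pow_pos Fintype.card_pos _
      omega
    have := congrArg (Nat.cast : ℕ → ℤ) h1
    push_cast at this
    linarith
  have hz : ∀ (t : lˣ) (a b : ℤ), σ t ^ a = σ t ^ b ↔ t ^ a = t ^ b := by
    intro t a b
    rw [← map_zpow₀, ← map_zpow₀, σ.injective.eq_iff, ← Units.val_zpow_eq_zpow_val,
      ← Units.val_zpow_eq_zpow_val, Units.val_inj]
  simp_rw [hz, ← hcard]
  obtain ⟨g, hg⟩ := IsCyclic.exists_generator (α := lˣ)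
  have hord : orderOf g = Fintype.card lˣ :=
    (orderOf_eq_card_of_forall_mem_zpowers hg).trans Nat.card_eq_fintype_card
  constructor
  · intro h
    have := zpow_eq_zpow_iff_modEq.1 (h g)
    rwa [hord] at this
  · intro h t
    rw [zpow_eq_zpow_iff_modEq]
    refine h.of_dvd ?_
    exact_mod_cast orderOf_dvd_card

lemma weightRatio_iff (hl : Module.finrank k l = 2) (σ : l →+* F) :
    WeightRatio p σ k r r' b b' m ↔
      weightExp p (Fintype.card k) r' b' ≡
        weightExp p (Fintype.card k) r b + (Fintype.card k + 1) * m
        [ZMOD (Fintype.card k : ℤ) ^ 2 - 1] := by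
  rw [← forall_zpow_eq_iff hl σ, WeightRatio]
  refine forall_congr' fun t => ?_
  have h0 : σ t ≠ 0 := by simp
  have h1 : evk k σ (Algebra.norm k (t : l)) = σ t ^ ((Fintype.card k : ℤ) + 1) := by
    change σ (algebraMap k l (Algebra.norm k (t : l))) = _
    rw [algebraMap_norm_quadratic hl, map_pow]
    norm_cast
  rw [h1, zpow_add₀ h0 (weightExp _ _ _ _), zpow_mul, zpow_natCast]

lemma WeightRatio.symm (hl : Module.finrank k l = 2) {σ : l →+* F}
    (h : WeightRatio p σ k r r' b b' m) (hmm : (Fintype.card k : ℤ) - 1 ∣ m + m') :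
    WeightRatio p σ k r' r b' b m' := by
  rw [weightRatio_iff hl] at h ⊢
  obtain ⟨a, ha⟩ := hmm
  obtain ⟨d, hd⟩ := h.dvd
  refine (Int.modEq_iff_dvd.2 ⟨a - d, ?_⟩)
  linear_combination (Fintype.card k + 1 : ℤ) * ha - hd

end Characters

section Numerics

variable {p f : ℕ} {r r' : Fin f → ℕ}

lemma digitSum_top (hp : 0 < p) : (digitSum p fun _ : Fin f => p - 1) + 1 = p ^ f := by
  have h := geom_sum_mul_add (p - 1) f
  rw [show p - 1 + 1 = p by omega] at h
  rw [digitSum, ← Finset.mul_sum, Fin.sum_univ_eq_sum_range (fun i => p ^ i), mul_comm]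
  exact h

lemma digitSum_compl (hp : 0 < p) (hr : ∀ j, r j < p) :
    (digitSum p fun j => p - 1 - r j) + digitSum p r + 1 = p ^ f := by
  rw [← digitSum_add, ← digitSum_top hp]
  congr 2
  funext j
  have := hr j
  simp only [Pi.add_apply]
  omega

lemma digitSum_pos (hp : 0 < p) {j : Fin f} (hj : r j ≠ 0) : 0 < digitSum p r :=
  lt_of_lt_of_le (Nat.mul_pos (Nat.pos_of_ne_zero hj) (pow_pos hp _))
    (Finset.single_le_sum (f := fun j : Fin f => r j * p ^ (j : ℕ)) (fun _ _ => Nat.zero_le _)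
      (Finset.mem_univ j))

/-- Two numbers without the digit `p - 1` add up to a multiple of `p^f - 1` only if both are zero
or their digits are complementary. -/
lemma digits_of_dvd_add [NeZero f] (hr : ∀ j, r j + 1 < p) (hr' : ∀ j, r' j + 1 < p)
    (h : (p : ℤ) ^ f - 1 ∣ digitSum p r + digitSum p r') :
    ((∀ j, r j = 0) ∧ ∀ j, r' j = 0) ∨ ∀ j, r j + r' j + 1 = p := by
  have hp : 0 < p := by have := hr 0; omega
  have hc := digitSum_compl hp (r := r) (fun j => by have := hr j; omega)
  have hc' := digitSum_compl hp (r := r') (fun j => by have := hr' j; omega)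
  have hpos := digitSum_pos hp (r := fun j => p - 1 - r j) (j := 0) (by have := hr 0; omega)
  have hpos' := digitSum_pos hp (r := fun j => p - 1 - r' j) (j := 0) (by have := hr' 0; omega)
  obtain ⟨a, ha⟩ := h
  have hq : ((p ^ f : ℕ) : ℤ) = (p : ℤ) ^ f := by push_cast; rfl
  have h0 : 0 ≤ a := by
    by_contra! hn
    have : ((p : ℤ) ^ f - 1) * a < 0 := mul_neg_of_pos_of_neg (by omega) hn
    omega
  have h2 : a < 2 := by
    by_contra! hn
    nlinarith
  obtain rfl | rfl : a = 0 ∨ a = 1 := by omega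
  · left
    constructor <;> intro j <;> by_contra hj <;> have := digitSum_pos hp hj <;> omega
  · right
    have heq : digitSum p r' = digitSum p fun j => p - 1 - r j := by omega
    have := digitSum_injective (fun j => by have := hr' j; omega) (fun j => by omega) heq
    intro j
    have h1 := congrFun this j
    have := hr j
    omega

/-- For `f ≥ 2`, two Serre weights with complementary digits have total dimension less than `q`. -/
lemma prod_add_prod_lt (hf : 2 ≤ f) (hr : ∀ j, r j + 1 < p) (hr' : ∀ j, r' j + 1 < p)
    (h : ∀ j, r j + r' j + 1 = p) : ∏ j, (r j + 1) + ∏ j, (r' j + 1) < p ^ f := by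
  obtain ⟨n, rfl⟩ := Nat.exists_eq_add_of_le' hf
  rw [Fin.prod_univ_succ, Fin.prod_univ_succ (fun j => r' j + 1)]
  have hle : ∀ s : Fin (n + 2) → ℕ, (∀ j, s j + 1 < p) →
      ∏ j : Fin (n + 1), (s j.succ + 1) ≤ (p - 1) ^ (n + 1) := by
    intro s hs
    refine (Finset.prod_le_pow_card _ _ (p - 1) fun j _ => ?_).trans (by simp)
    have := hs j.succ
    omega
  have h0 := h 0
  obtain ⟨s, rfl⟩ : ∃ s, p = s + 1 := ⟨p - 1, by have := hr 0; omega⟩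
  have h1 := hle r hr
  have h2 := hle r' hr'
  rw [Nat.add_sub_cancel] at h1 h2
  calc _ ≤ (r 0 + 1) * s ^ (n + 1) + (r' 0 + 1) * s ^ (n + 1) :=
        Nat.add_le_add (Nat.mul_le_mul_left _ h1) (Nat.mul_le_mul_left _ h2)
    _ = (s + 2) * s * s ^ n := by
        rw [← add_mul, show r 0 + 1 + (r' 0 + 1) = s + 2 by omega]; ring
    _ ≤ (s + 2) * s * (s + 1) ^ n := Nat.mul_le_mul_left _ (Nat.pow_le_pow_left (by omega) _)
    _ < (s + 1) ^ 2 * (s + 1) ^ n :=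
        Nat.mul_lt_mul_of_pos_right (by nlinarith) (by positivity)
    _ = (s + 1) ^ (n + 2) := by ring

end Numerics

section Assembly

variable {k : Type v} {l F : Type u} [Field k] [Fintype k] [Field l] [Algebra k l] [Field F]
  {V W : Type*} [AddCommGroup V] [Module F V] [AddCommGroup W] [Module F W]
  {p f : ℕ} {hl : Module.finrank k l = 2} {σ : l →+* F}
  {ρ : Representation F (U11 k l) V} {τ : Representation F (U11 k l) W}
  {r r' : Fin f → ℕ} {b b' : ℤ} {c : U11 k l → V →ₗ[F] W} {m m' : ℕ}
  (DV : HighestWeightData p hl σ ρ r b) (DW : HighestWeightData p hl σ τ r' b')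

/-- The cocycles vanishing on the torus that have been reduced by coboundaries: their matrix
coefficients on the unipotent subgroups, homogeneous of degrees `m` and `m'`, vanish unless
these degrees are exceptional. -/
def reducedCocycles (m m' : ℕ) : Submodule F (U11 k l → V →ₗ[F] W) where
  carrier := {c | c ∈ torusCocycles hl ρ τ ∧
    ((¬ ∃ j, m = (r' j + 1) * p ^ (j : ℕ)) → DW.form (c (upper 1) DV.vec) = 0) ∧
    ((¬ ∃ j, m' = (r j + 1) * p ^ (j : ℕ)) → DW.form (c (lower 1) DV.vec) = 0)}
  zero_mem' := ⟨zero_mem _, fun _ => by simp, fun _ => by simp⟩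
  add_mem' ha hb := ⟨add_mem ha.1 hb.1, fun h => by simp [ha.2.1 h, hb.2.1 h],
    fun h => by simp [ha.2.2 h, hb.2.2 h]⟩
  smul_mem' a c hc := ⟨Submodule.smul_mem _ a hc.1, fun h => by simp [hc.2.1 h],
    fun h => by simp [hc.2.2 h]⟩

variable [Fact p.Prime] [CharP F p]

lemma exists_reducedCocycle [NeZero f] (hk : Fintype.card k = p ^ f) (hr : ∀ j, r j < p)
    (hr' : ∀ j, r' j < p) (hm : m ≠ 0) (hm1 : m < p ^ f) (hχ : WeightRatio p σ k r r' b b' m)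
    (hm' : m' ≠ 0) (hm1' : m' < p ^ f) (hχ' : WeightRatio p σ k r' r b' b m')
    (hc : c ∈ extCocycles ρ τ) :
    ∃ c' ∈ reducedCocycles DV DW m m', c - c' ∈ extCoboundaries ρ τ := by
  have hp : 0 < p := (Fact.out (p := p.Prime)).pos
  obtain ⟨c₁, hc₁, h₁⟩ := exists_torusCocycle (hl := hl) hk hc
  -- a coboundary removes the coefficient on the upper unipotent group without changing the one on
  -- the lower unipotent group
  obtain ⟨c₂, hc₂, h₂, hA₂, hB₂⟩ : ∃ c₂ ∈ torusCocycles hl ρ τ, c₁ - c₂ ∈ extCoboundaries ρ τ ∧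
      ((¬ ∃ j, m = (r' j + 1) * p ^ (j : ℕ)) → DW.form (c₂ (upper 1) DV.vec) = 0) ∧
      DW.form (c₂ (lower 1) DV.vec) = DW.form (c₁ (lower 1) DV.vec) := by
    by_cases h : (∃ j, m = (r' j + 1) * p ^ (j : ℕ)) ∨ DW.form (c₁ (upper 1) DV.vec) = 0
    · exact ⟨c₁, hc₁, by simp, fun hn => h.resolve_left hn, rfl⟩
    · push Not at h
      rcases digits_of_form_cocycle_ne_zero DV DW hk hr' hc₁ hm hm1 hχ h.2 with
        ⟨d, hd, hmd⟩ | ⟨j, hj⟩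
      · obtain ⟨e, he, heB, h1, h2⟩ := exists_form_upper_eq_zero DV DW hp hk hr' hm hχ hd hmd
        refine ⟨c₁ - DW.form (c₁ (upper 1) DV.vec) • e, sub_mem hc₁ (Submodule.smul_mem _ _ he),
          ?_, fun _ => ?_, ?_⟩
        · rw [sub_sub_cancel]; exact Submodule.smul_mem _ _ heB
        · simp [h1]
        · simp [h2]
      · exact absurd hj (h.1 j)
  -- and conversely
  obtain ⟨c₃, hc₃, h₃, hB₃, hA₃⟩ : ∃ c₃ ∈ torusCocycles hl ρ τ, c₂ - c₃ ∈ extCoboundaries ρ τ ∧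
      ((¬ ∃ j, m' = (r j + 1) * p ^ (j : ℕ)) → DW.form (c₃ (lower 1) DV.vec) = 0) ∧
      DW.form (c₃ (upper 1) DV.vec) = DW.form (c₂ (upper 1) DV.vec) := by
    by_cases h : (∃ j, m' = (r j + 1) * p ^ (j : ℕ)) ∨ DW.form (c₂ (lower 1) DV.vec) = 0
    · exact ⟨c₂, hc₂, by simp, fun hn => h.resolve_left hn, rfl⟩
    · push Not at h
      rcases digits_of_form_cocycle_ne_zero DW.dual DV.dual hk hr (transpCocycle_mem hc₂) hm' hm1'
        hχ' (by simpa [HighestWeightData.dual_form, transpCocycle_apply] using h.2) with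
        ⟨d, hd, hmd⟩ | ⟨j, hj⟩
      · obtain ⟨e, he, heB, h1, h2⟩ := exists_form_lower_eq_zero DV DW hp hk hr hm' hχ' hd hmd
        refine ⟨c₂ - DW.form (c₂ (lower 1) DV.vec) • e, sub_mem hc₂ (Submodule.smul_mem _ _ he),
          ?_, fun _ => ?_, ?_⟩
        · rw [sub_sub_cancel]; exact Submodule.smul_mem _ _ heB
        · simp [h2]
        · simp [h1]
      · exact absurd hj (h.1 j)
  refine ⟨c₃, ⟨hc₃, fun h => by rw [hA₃, hA₂ h], hB₃⟩, ?_⟩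
  have : c - c₃ = (c - c₁) + (c₁ - c₂) + (c₂ - c₃) := by abel
  rw [this]
  exact add_mem (add_mem h₁ h₂) h₃

omit [CharP F p] in
/-- A matrix coefficient supported on the small cell forces `f = 1` and complementary digits,
because otherwise the dimension of the extension is too small. -/
lemma of_form_weylElt_ne_zero [NeZero f] (hp2 : p ≠ 2) (hk : Fintype.card k = p ^ f)
    (hr : ∀ j, r j + 1 < p)
    (hr' : ∀ j, r' j + 1 < p) (hm : m ≠ 0) (hχ : WeightRatio p σ k r r' b b' m)
    (hm' : m' ≠ 0) (hχ' : WeightRatio p σ k r' r b' b m') (hc : c ∈ torusCocycles hl ρ τ)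
    (hA : DW.form (c (upper 1) DV.vec) = 0) (hB : DW.form (c (lower 1) DV.vec) = 0)
    (hK : DW.form (c (weylElt k l) DV.vec) ≠ 0) :
    f = 1 ∧ (∀ j, r j + r' j + 1 = p) ∧ weightExp p (Fintype.card k) r' b' ≡
      -((Fintype.card k : ℤ) * weightExp p (Fintype.card k) r b)
      [ZMOD (Fintype.card k : ℤ) ^ 2 - 1] := by
  have hp : p.Prime := Fact.out
  have hp3 : 3 ≤ p := by
    have := hp.two_le
    omega
  have hN := cocycle_upper_vec DV DW hp.pos hk (fun j => by have := hr' j; omega) hc hm hχ hA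
  have hN' := form_comp_cocycle_lower DV DW hp.pos hk (fun j => by have := hr j; omega) hc hm' hχ'
    hB
  have hcard := card_le_of_form_weylElt_ne_zero DV DW hc hN hN' hK
  have hexp := (forall_zpow_eq_iff hl σ _ _).1 (weightExp_of_form_weylElt_ne_zero DV DW hc hK)
  have hdvd : (p : ℤ) ^ f - 1 ∣ digitSum p r + digitSum p r' := by
    obtain ⟨a, ha⟩ := hexp.dvd
    rw [weightExp, weightExp, hk] at ha
    push_cast at ha
    exact ⟨-((p : ℤ) ^ f + 1) * a - digitSum p r + p ^ f * b + b',
      by linear_combination -ha⟩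
  rw [hk] at hcard
  rcases digits_of_dvd_add hr hr' hdvd with ⟨h, h'⟩ | h
  · have h1 : p ^ 1 ≤ p ^ f := Nat.pow_le_pow_right hp.pos (NeZero.one_le)
    simp only [h, h', zero_add, Finset.prod_const_one] at hcard
    rw [pow_one] at h1
    omega
  · refine ⟨?_, h, hexp⟩
    by_contra hf
    exact absurd hcard (not_le.2 (prod_add_prod_lt (by have := NeZero.ne f; omega) hr hr' h))

section

variable (hp2 : p ≠ 2) (hk : Fintype.card k = p ^ f) (hr : ∀ j, r j + 1 < p)
  (hr' : ∀ j, r' j + 1 < p) (hm : m ≠ 0) (hm1 : m < p ^ f) (hχ : WeightRatio p σ k r r' b b' m)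
  (hm' : m' ≠ 0) (hm1' : m' < p ^ f) (hχ' : WeightRatio p σ k r' r b' b m')
include DV DW hp2 hk hr hr' hm hm1 hχ hm' hm1' hχ'

omit hm hm' in
lemma form_upper_eq_zero_of_reduced [CharP k p] (hc : c ∈ reducedCocycles DV DW m m')
    (hA : (∃ j, m = (r' j + 1) * p ^ (j : ℕ)) → f = 1 ∧ ∀ j, p ≤ r j + r' j + 1) :
    DW.form (c (upper 1) DV.vec) = 0 := by
  by_cases h : ∃ j, m = (r' j + 1) * p ^ (j : ℕ)
  · obtain ⟨rfl, hle⟩ := hA h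
    obtain ⟨j, hj⟩ := h
    rw [Subsingleton.elim j 0] at hj
    exact form_upper_eq_zero_of_prime DV DW hp2 hk (fun j => by have := hr j; omega) hr' hc.1 hχ
      (by simpa using hj) (hle 0)
  · exact hc.2.1 h

omit hm hm' in
lemma form_lower_eq_zero_of_reduced [CharP k p] (hc : c ∈ reducedCocycles DV DW m m')
    (hB : (∃ j, m' = (r j + 1) * p ^ (j : ℕ)) → f = 1 ∧ ∀ j, p ≤ r j + r' j + 1) :
    DW.form (c (lower 1) DV.vec) = 0 := by
  by_cases h : ∃ j, m' = (r j + 1) * p ^ (j : ℕ)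
  · obtain ⟨rfl, hle⟩ := hB h
    obtain ⟨j, hj⟩ := h
    rw [Subsingleton.elim j 0] at hj
    exact form_lower_eq_zero_of_prime DV DW hp2 hk hr (fun j => by have := hr' j; omega) hc.1 hχ'
      (by simpa using hj) (hle 0)
  · exact hc.2.2 h

omit [CharP F p] hp2 hm1 hm1' in
lemma mem_extCoboundaries_of_forms (hc : c ∈ torusCocycles hl ρ τ)
    (hA : DW.form (c (upper 1) DV.vec) = 0) (hB : DW.form (c (lower 1) DV.vec) = 0)
    (hK : DW.form (c (weylElt k l) DV.vec) = 0) : c ∈ extCoboundaries ρ τ := by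
  have hp : p.Prime := Fact.out
  exact mem_extCoboundaries_of_form_eq_zero DV DW hc
    (cocycle_upper_vec DV DW hp.pos hk (fun j => by have := hr' j; omega) hc hm hχ hA)
    (form_comp_cocycle_lower DV DW hp.pos hk (fun j => by have := hr j; omega) hc hm' hχ' hB)
    hp.pos hk (fun j => by have := hr j; omega) (fun j => by have := hr' j; omega) hK

/-- A numerical criterion for the vanishing of the extension group: `hA` and `hB` exclude the
exceptional degrees on the two unipotent groups, `hK` excludes cocycles supported on the small
cell. -/
theorem rank_extClasses_eq_zero_of_weights [NeZero f] [CharP k p]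
    (hA : (∃ j, m = (r' j + 1) * p ^ (j : ℕ)) → f = 1 ∧ ∀ j, p ≤ r j + r' j + 1)
    (hB : (∃ j, m' = (r j + 1) * p ^ (j : ℕ)) → f = 1 ∧ ∀ j, p ≤ r j + r' j + 1)
    (hK : f = 1 → (∀ j, r j + r' j + 1 = p) → ¬ weightExp p (Fintype.card k) r' b' ≡
      -((Fintype.card k : ℤ) * weightExp p (Fintype.card k) r b)
      [ZMOD (Fintype.card k : ℤ) ^ 2 - 1]) :
    Module.rank F (ExtClasses ρ τ) = 0 := by
  refine rank_extClasses_eq_zero fun c hc => ?_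
  obtain ⟨c', hc', h⟩ := exists_reducedCocycle DV DW hk (fun j => by have := hr j; omega)
    (fun j => by have := hr' j; omega) hm hm1 hχ hm' hm1' hχ' hc
  have hA' := form_upper_eq_zero_of_reduced DV DW hp2 hk hr hr' hm1 hχ hm1' hχ' hc' hA
  have hB' := form_lower_eq_zero_of_reduced DV DW hp2 hk hr hr' hm1 hχ hm1' hχ' hc' hB
  rw [← sub_add_cancel c c']
  refine add_mem h (mem_extCoboundaries_of_forms DV DW hk hr hr' hm hχ hm' hχ' hc'.1
    hA' hB' ?_)
  by_contra h0
  obtain ⟨h1, h2, h3⟩ := of_form_weylElt_ne_zero DV DW hp2 hk hr hr' hm hχ hm' hχ' hc'.1 hA' hB' h0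
  exact hK h1 h2 h3

/-- A numerical criterion for the extension group to be spanned by one given class: in each case,
one matrix coefficient detects whether a reduced cocycle is a coboundary. -/
theorem rank_extClasses_eq_one_of_weights [NeZero f] [CharP k p] (hc : c ∈ extCocycles ρ τ)
    (hc' : c ∉ extCoboundaries ρ τ)
    (h : (f ≠ 1 ∧ ¬ ((∃ j, m = (r' j + 1) * p ^ (j : ℕ)) ∧ ∃ j, m' = (r j + 1) * p ^ (j : ℕ))) ∨
      (f = 1 ∧ ((∀ j, r j + r' j + 3 = p) ∨ ∀ j, r j + r' j + 1 = p))) :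
    Module.rank F (ExtClasses ρ τ) = 1 := by
  have hp : p.Prime := Fact.out
  -- a group element at which the matrix coefficient detects coboundaries
  obtain ⟨g, hg⟩ : ∃ g : U11 k l, ∀ c ∈ reducedCocycles DV DW m m',
      DW.form (c g DV.vec) = 0 → c ∈ extCoboundaries ρ τ := by
    rcases h with ⟨hf, hAB⟩ | ⟨hf, hsum | hsum⟩
    · have hK : ∀ c ∈ reducedCocycles DV DW m m', DW.form (c (upper 1) DV.vec) = 0 →
          DW.form (c (lower 1) DV.vec) = 0 → c ∈ extCoboundaries ρ τ := by
        intro c hc hA hB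
        refine mem_extCoboundaries_of_forms DV DW hk hr hr' hm hχ hm' hχ' hc.1 hA hB ?_
        by_contra h0
        exact hf (of_form_weylElt_ne_zero DV DW hp2 hk hr hr' hm hχ hm' hχ' hc.1 hA hB h0).1
      by_cases hA : ∃ j, m = (r' j + 1) * p ^ (j : ℕ)
      · exact ⟨upper 1, fun c hc h => hK c hc h (hc.2.2 fun hB => hAB ⟨hA, hB⟩)⟩
      · exact ⟨lower 1, fun c hc h => hK c hc (hc.2.1 hA) h⟩
    · refine ⟨upper 1, fun c hc hA => ?_⟩
      have hB : DW.form (c (lower 1) DV.vec) = 0 := by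
        by_cases hB : ∃ j, m' = (r j + 1) * p ^ (j : ℕ)
        · subst hf
          obtain ⟨j, hj⟩ := hB
          rw [Subsingleton.elim j 0] at hj
          exact form_lower_eq_zero_of_form_upper DV DW hk (fun j => by have := hr j; omega) hc.1
            (cocycle_upper_vec DV DW hp.pos hk (fun j => by have := hr' j; omega) hc.1 hm hχ hA) hχ'
            (by simpa using hj) (hsum 0)
        · exact hc.2.2 hB
      refine mem_extCoboundaries_of_forms DV DW hk hr hr' hm hχ hm' hχ' hc.1 hA hB ?_
      by_contra h0
      have h1 := (of_form_weylElt_ne_zero DV DW hp2 hk hr hr' hm hχ hm' hχ' hc.1 hA hB h0).2.1 0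
      have h2 := hsum 0
      omega
    · refine ⟨weylElt k l, fun c hc hK => ?_⟩
      exact mem_extCoboundaries_of_forms DV DW hk hr hr' hm hχ hm' hχ' hc.1
        (form_upper_eq_zero_of_reduced DV DW hp2 hk hr hr' hm1 hχ hm1' hχ' hc
          fun _ => ⟨hf, fun j => (hsum j).ge⟩)
        (form_lower_eq_zero_of_reduced DV DW hp2 hk hr hr' hm1 hχ hm1' hχ' hc
          fun _ => ⟨hf, fun j => (hsum j).ge⟩) hK
  have hred : ∀ c ∈ extCocycles ρ τ, ∃ c' ∈ reducedCocycles DV DW m m',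
      c - c' ∈ extCoboundaries ρ τ := fun c hc =>
    exists_reducedCocycle DV DW hk (fun j => by have := hr j; omega)
      (fun j => by have := hr' j; omega) hm hm1 hχ hm' hm1' hχ' hc
  obtain ⟨c₀, hc₀, h₀⟩ := hred c hc
  have hne : DW.form (c₀ g DV.vec) ≠ 0 := fun h1 => hc' (by
    rw [← sub_add_cancel c c₀]
    exact add_mem h₀ (hg c₀ hc₀ h1))
  refine rank_extClasses_eq_one hc hc' fun c₁ hc₁ => ?_
  obtain ⟨c₂, hc₂, h₂⟩ := hred c₁ hc₁
  set a := DW.form (c₂ g DV.vec) / DW.form (c₀ g DV.vec) with ha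
  refine ⟨a, ?_⟩
  have hmem : c₂ - a • c₀ ∈ extCoboundaries ρ τ := by
    refine hg _ (sub_mem hc₂ (Submodule.smul_mem _ _ hc₀)) ?_
    simp [ha, div_mul_cancel₀ _ hne]
  have : c₁ - a • c = (c₁ - c₂) + (c₂ - a • c₀) - a • (c - c₀) := by
    rw [smul_sub]; abel
  rw [this]
  exact sub_mem (add_mem h₂ hmem) (Submodule.smul_mem _ _ h₀)

end

end Assembly

/-! ### The polynomial model of a Serre weight -/

section

open MvPolynomial
open scoped TensorProduct

section WeightedBasis

variable {F σ M ι : Type*} [Field F] [AddCommMonoid M]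

/-- The basis of monomials of a space of weighted homogeneous polynomials. -/
noncomputable def weightedHomogeneousBasis (w : σ → M) (m : M) (e : ι → σ →₀ ℕ)
    (he : Function.Injective e) (hr : ∀ d, Finsupp.weight w d = m ↔ d ∈ Set.range e) :
    Module.Basis ι F (weightedHomogeneousSubmodule F w m) :=
  Module.Basis.mk (v := fun i => ⟨monomial (e i) 1,
      isWeightedHomogeneous_monomial w _ _ ((hr _).2 ⟨i, rfl⟩)⟩)
    (by
      refine LinearIndependent.of_comp (weightedHomogeneousSubmodule F w m).subtype ?_
      have := (basisMonomials σ F).linearIndependent.comp e he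
      rwa [coe_basisMonomials] at this)
    (by
      rintro ⟨P, hP⟩ -
      have h1 : ∀ d ∈ P.support, ∃ i, e i = d := fun d hd =>
        (hr d).1 (hP (mem_support_iff.1 hd))
      have h2 : (⟨P, hP⟩ : weightedHomogeneousSubmodule F w m) = ∑ d ∈ P.support.attach,
          coeff d.1 P • ⟨monomial (e (h1 d.1 d.2).choose) 1,
            isWeightedHomogeneous_monomial w _ _ ((hr _).2 ⟨_, rfl⟩)⟩ := by
        apply Subtype.ext
        rw [AddSubmonoidClass.coe_finsetSum]
        refine P.as_sum.trans ?_
        rw [← Finset.sum_attach]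
        refine Finset.sum_congr rfl fun d _ => ?_
        have h3 := (h1 d.1 d.2).choose_spec
        change monomial d.1 (coeff d.1 P) = coeff d.1 P • monomial (e (h1 d.1 d.2).choose) 1
        rw [h3, smul_monomial, smul_eq_mul, mul_one]
      rw [h2]
      exact sum_mem fun d _ => Submodule.smul_mem _ _ (Submodule.subset_span ⟨_, rfl⟩))

lemma weightedHomogeneousBasis_apply (w : σ → M) (m : M) (e : ι → σ →₀ ℕ)
    (he : Function.Injective e) (hr : ∀ d, Finsupp.weight w d = m ↔ d ∈ Set.range e) (i : ι) :
    (weightedHomogeneousBasis (F := F) w m e he hr i : MvPolynomial σ F) = monomial (e i) 1 := by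
  rw [weightedHomogeneousBasis, Module.Basis.mk_apply]

end WeightedBasis

lemma cast_choose_ne_zero {F : Type*} [Field F] {p : ℕ} [CharP F p] (hp : p.Prime) {n i : ℕ}
    (hn : n < p) (hi : i ≤ n) :
    (n.choose i : F) ≠ 0 := by
  rw [Ne, CharP.cast_eq_zero_iff F p]
  intro h
  have h1 : p ∣ n.factorial := by
    rw [← Nat.choose_mul_factorial_mul_factorial hi, mul_assoc]
    exact h.mul_right _
  exact absurd (hp.dvd_factorial.1 h1) (by omega)

section PolynomialModel

variable {f : ℕ}

/-- The exponent of the monomial `∏_j X_{j0}^{a_j} X_{j1}^{b_j}`. -/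
noncomputable def pairExp (a b : Fin f → ℕ) : Fin f × Fin 2 →₀ ℕ :=
  Finsupp.equivFunOnFinite.symm fun x => ![a x.1, b x.1] x.2

@[simp] lemma pairExp_zero (a b : Fin f → ℕ) (j : Fin f) : pairExp a b (j, 0) = a j := rfl
@[simp] lemma pairExp_one (a b : Fin f → ℕ) (j : Fin f) : pairExp a b (j, 1) = b j := rfl

lemma pairExp_eta (m : Fin f × Fin 2 →₀ ℕ) :
    pairExp (fun j => m (j, 0)) (fun j => m (j, 1)) = m := by
  ext ⟨j, i⟩
  fin_cases i <;> rfl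

/-- The multidegree of the variables `X_{j0}` and `X_{j1}` is one in position `j`. -/
def multiDeg (x : Fin f × Fin 2) : Fin f → ℕ := Pi.single x.1 1

lemma weight_multiDeg (m : Fin f × Fin 2 →₀ ℕ) (r : Fin f → ℕ) :
    Finsupp.weight multiDeg m = r ↔ ∀ j, m (j, 0) + m (j, 1) = r j := by
  rw [funext_iff]
  refine forall_congr' fun j => ?_
  rw [Finsupp.weight_apply, Finsupp.sum_fintype _ _ (by simp), Finset.sum_apply,
    Fintype.sum_prod_type, Finset.sum_eq_single j]
  · simp [multiDeg]
  · intro i _ hi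
    simp [multiDeg, hi.symm]
  · simp

variable (F : Type u) [Field F]

/-- The multihomogeneous polynomials of multidegree `r` in the pairs of variables
`X_{j0}, X_{j1}`. -/
abbrev polySpace (r : Fin f → ℕ) : Submodule F (MvPolynomial (Fin f × Fin 2) F) :=
  weightedHomogeneousSubmodule F multiDeg r

variable {F}

lemma monomial_mem_polySpace {r : Fin f → ℕ} {m : Fin f × Fin 2 →₀ ℕ}
    (hm : ∀ j, m (j, 0) + m (j, 1) = r j) (a : F) : monomial m a ∈ polySpace F r :=
  isWeightedHomogeneous_monomial _ _ _ ((weight_multiDeg m r).2 hm)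

lemma polySpace_induction {r : Fin f → ℕ} {C : MvPolynomial (Fin f × Fin 2) F → Prop}
    (h : ∀ m : Fin f × Fin 2 →₀ ℕ, (∀ j, m (j, 0) + m (j, 1) = r j) → C (monomial m 1))
    (h0 : C 0)
    (hadd : ∀ P Q, C P → C Q → C (P + Q)) (hsmul : ∀ (a : F) P, C P → C (a • P))
    {P : MvPolynomial (Fin f × Fin 2) F} (hP : P ∈ polySpace F r) : C P := by
  rw [P.as_sum]
  refine Finset.sum_induction _ C hadd h0 fun m hm => ?_
  have : monomial m (coeff m P) = coeff m P • monomial m 1 := by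
    rw [smul_monomial, smul_eq_mul, mul_one]
  rw [this]
  exact hsmul _ _ (h m ((weight_multiDeg m r).1 (hP (mem_support_iff.1 hm))))

lemma polySpace_ext {M : Type*} [AddCommGroup M] [Module F M] {r : Fin f → ℕ}
    {L L' : MvPolynomial (Fin f × Fin 2) F →ₗ[F] M}
    (h : ∀ m : Fin f × Fin 2 →₀ ℕ, (∀ j, m (j, 0) + m (j, 1) = r j) →
      L (monomial m 1) = L' (monomial m 1))
    {P : MvPolynomial (Fin f × Fin 2) F} (hP : P ∈ polySpace F r) : L P = L' P :=
  polySpace_induction (C := fun P => L P = L' P) h (by simp)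
    (fun P Q hP hQ => by rw [map_add, map_add, hP, hQ])
    (fun a P hP => by rw [map_smul, map_smul, hP]) hP

lemma map_mem_polySpace {r r' : Fin f → ℕ}
    {L : MvPolynomial (Fin f × Fin 2) F →ₗ[F] MvPolynomial (Fin f × Fin 2) F}
    (h : ∀ m : Fin f × Fin 2 →₀ ℕ, (∀ j, m (j, 0) + m (j, 1) = r j) →
      L (monomial m 1) ∈ polySpace F r')
    {P : MvPolynomial (Fin f × Fin 2) F} (hP : P ∈ polySpace F r) : L P ∈ polySpace F r' :=
  polySpace_induction (C := fun P => L P ∈ polySpace F r') h (by simp)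
    (fun P Q hP hQ => by rw [map_add]; exact add_mem hP hQ)
    (fun a P hP => by rw [map_smul]; exact Submodule.smul_mem _ _ hP) hP

lemma aeval_monomial_pair {A : Type*} [CommRing A] [Algebra F A] (g : Fin f × Fin 2 → A)
    (m : Fin f × Fin 2 →₀ ℕ) (a : F) :
    aeval g (monomial m a) =
      algebraMap F A a * ∏ j, g (j, 0) ^ m (j, 0) * g (j, 1) ^ m (j, 1) := by
  rw [aeval_monomial, Finsupp.prod_fintype _ _ (by simp), Fintype.prod_prod_type]
  simp [Fin.prod_univ_two]

variable (F) in
/-- The basis of monomials of `polySpace F r`; the index gives the exponents of the `X_{j1}`. -/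
noncomputable def polyBasis (r : Fin f → ℕ) :
    Module.Basis (∀ j, Fin (r j + 1)) F (polySpace F r) :=
  weightedHomogeneousBasis multiDeg r (fun d => pairExp (fun j => r j - d j) fun j => (d j : ℕ))
    (fun d e h => by
      funext j
      exact Fin.ext (by simpa using DFunLike.congr_fun h (j, 1)))
    (fun m => by
      rw [weight_multiDeg]
      constructor
      · intro h
        refine ⟨fun j => ⟨m (j, 1), by have := h j; omega⟩, ?_⟩
        conv_rhs => rw [← pairExp_eta m]
        refine congrArg (fun a => pairExp a _) (funext fun j => ?_)
        have := h j
        simp only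
        omega
      · rintro ⟨d, rfl⟩ j
        have := (d j).2
        simp only [pairExp_zero, pairExp_one]
        omega)

lemma polyBasis_apply (r : Fin f → ℕ) (d : ∀ j, Fin (r j + 1)) :
    (polyBasis F r d : MvPolynomial (Fin f × Fin 2) F) =
      monomial (pairExp (fun j => r j - d j) fun j => (d j : ℕ)) 1 :=
  weightedHomogeneousBasis_apply ..

variable {k : Type v} {l : Type u} [Field k] [Fintype k] [Field l] [Algebra k l]
variable (p : ℕ) [ExpChar l p] (σ : l →+* F)

/-- The embedding `x ↦ σ(x)^{p^j}`. -/
def twistEmb (j : Fin f) : l →+* F := σ.comp (iterateFrobenius l p j)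

lemma twistEmb_apply (j : Fin f) (x : l) : twistEmb p σ j x = σ x ^ p ^ (j : ℕ) := by
  simp [twistEmb, iterateFrobenius_def]

/-- A matrix acts on the variables `X_{j0}, X_{j1}` through the `j`-th embedding. -/
noncomputable def polyAct (A : Matrix (Fin 2) (Fin 2) l) :
    MvPolynomial (Fin f × Fin 2) F →ₐ[F] MvPolynomial (Fin f × Fin 2) F :=
  aeval fun x => ∑ i, C (twistEmb p σ x.1 (A i x.2)) * X (x.1, i)

lemma polyAct_one : polyAct (f := f) p σ 1 = AlgHom.id F _ := by
  apply MvPolynomial.algHom_ext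
  intro x
  rw [polyAct, aeval_X, Finset.sum_eq_single x.2] <;> simp +contextual

lemma polyAct_mul (A B : Matrix (Fin 2) (Fin 2) l) :
    polyAct (f := f) p σ (A * B) = (polyAct p σ A).comp (polyAct p σ B) := by
  apply MvPolynomial.algHom_ext
  intro x
  simp only [polyAct, AlgHom.comp_apply, aeval_X, Matrix.mul_apply, Fin.sum_univ_two, map_add,
    map_mul, ← algebraMap_eq, AlgHom.commutes]
  ring

lemma polyAct_mem (A : Matrix (Fin 2) (Fin 2) l) {r : Fin f → ℕ}
    {P : MvPolynomial (Fin f × Fin 2) F} (hP : P ∈ polySpace F r) :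
    polyAct p σ A P ∈ polySpace F r := by
  refine map_mem_polySpace (L := (polyAct p σ A).toLinearMap) (fun m hm => ?_) hP
  have h1 : ∀ x : Fin f × Fin 2, IsWeightedHomogeneous multiDeg
      (∑ i, C (twistEmb p σ x.1 (A i x.2)) * X (x.1, i) : MvPolynomial (Fin f × Fin 2) F)
      (multiDeg x) := fun x =>
    IsWeightedHomogeneous.sum _ _ _ fun i _ => (isWeightedHomogeneous_X _ _ _).C_mul _
  rw [AlgHom.toLinearMap_apply, polyAct, aeval_monomial, map_one, one_mul,
    mem_weightedHomogeneousSubmodule, ← (weight_multiDeg m r).2 hm, Finsupp.weight_apply]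
  exact IsWeightedHomogeneous.prod _ _ _ fun x _ => (h1 x).pow _

/-- The Serre weight realized on multihomogeneous polynomials, with all the powers of the
determinant collected into one. -/
noncomputable def polyRep (r : Fin f → ℕ) (b : ℤ) :
    Representation F (U11 k l) (polySpace F r) where
  toFun g := σ (g.1 : Matrix (Fin 2) (Fin 2) l).det ^ b •
    (polyAct p σ (g.1 : Matrix (Fin 2) (Fin 2) l)).toLinearMap.restrict
      fun _ hP => polyAct_mem p σ _ hP
  map_one' := by
    ext P
    simp [polyAct_one]
  map_mul' g h := by
    ext1 P
    apply Subtype.ext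
    change σ (g.1 * h.1 : GL (Fin 2) l).1.det ^ b • polyAct p σ (g.1 * h.1 : GL (Fin 2) l).1 P.1 =
      σ g.1.1.det ^ b • polyAct p σ g.1.1 (σ h.1.1.det ^ b • polyAct p σ h.1.1 P.1)
    rw [Units.val_mul, Matrix.det_mul, map_mul, mul_zpow, polyAct_mul, map_smul, mul_smul]
    rfl

lemma polyRep_coe (r : Fin f → ℕ) (b : ℤ) (g : U11 k l) (P : polySpace F r) :
    (polyRep p σ r b g P : MvPolynomial (Fin f × Fin 2) F) =
      σ (g.1 : Matrix (Fin 2) (Fin 2) l).det ^ b •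
        polyAct p σ (g.1 : Matrix (Fin 2) (Fin 2) l) P := rfl

/-- The evaluation at `X_{j0} = 1`, `X_{j1} = 0`. -/
noncomputable def evalHighest : MvPolynomial (Fin f × Fin 2) F →ₐ[F] F :=
  aeval fun x => if x.2 = 0 then 1 else 0

lemma evalHighest_polyAct_monomial (A : Matrix (Fin 2) (Fin 2) l) (m : Fin f × Fin 2 →₀ ℕ) :
    evalHighest (polyAct p σ A (monomial m 1)) = ∏ j, twistEmb p σ j (A 0 0) ^ m (j, 0) *
      twistEmb p σ j (A 0 1) ^ m (j, 1) := by
  have h : (evalHighest (F := F)).comp (polyAct (f := f) p σ A) =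
      aeval fun x => twistEmb p σ x.1 (A 0 x.2) := by
    apply MvPolynomial.algHom_ext
    intro x
    simp [evalHighest, polyAct, ← algebraMap_eq]
  have h1 := AlgHom.congr_fun h (monomial m 1)
  rw [aeval_monomial_pair] at h1
  simpa using h1

lemma upper_val (y : k) : ((upper y : U11 k l).1 : Matrix (Fin 2) (Fin 2) l) =
    !![1, algebraMap k l y; 0, 1] := U11.mk_val ..

lemma lower_val (y : k) : ((lower y : U11 k l).1 : Matrix (Fin 2) (Fin 2) l) =
    !![1, 0; algebraMap k l y, 1] := U11.mk_val ..

lemma weylElt_val : ((weylElt k l).1 : Matrix (Fin 2) (Fin 2) l) = !![0, 1; -1, 0] :=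
  U11.mk_val ..

lemma torus_val (hl : Module.finrank k l = 2) (t : lˣ) :
    ((torus hl t).1 : Matrix (Fin 2) (Fin 2) l) =
      !![(t : l), 0; 0, ((t : l) ^ Fintype.card k)⁻¹] := U11.mk_val ..

lemma det_upper (y : k) : ((upper y : U11 k l).1 : Matrix (Fin 2) (Fin 2) l).det = 1 := by
  rw [upper_val, Matrix.det_fin_two_of]; simp

lemma det_lower (y : k) : ((lower y : U11 k l).1 : Matrix (Fin 2) (Fin 2) l).det = 1 := by
  rw [lower_val, Matrix.det_fin_two_of]; simp

lemma det_weylElt : ((weylElt k l).1 : Matrix (Fin 2) (Fin 2) l).det = 1 := by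
  rw [weylElt_val, Matrix.det_fin_two_of]; simp

lemma sigma_det_torus (hl : Module.finrank k l = 2) (σ : l →+* F) (t : lˣ) :
    σ ((torus hl t).1 : Matrix (Fin 2) (Fin 2) l).det = σ t ^ (1 - (Fintype.card k : ℤ)) := by
  rw [torus_val, Matrix.det_fin_two_of, zpow_sub₀ (by simp)]
  simp [div_eq_mul_inv]

/-- The form that gives the coefficient of the highest weight monomial. -/
noncomputable def polyForm (r : Fin f → ℕ) : polySpace F r →ₗ[F] F :=
  evalHighest.toLinearMap ∘ₗ (polySpace F r).subtype

/-- The highest weight monomial `∏_j X_{j0}^{r_j}`. -/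
noncomputable def polyVec (r : Fin f → ℕ) : polySpace F r :=
  ⟨monomial (pairExp r 0) 1, monomial_mem_polySpace (by simp) 1⟩

lemma polyVec_coe (r : Fin f → ℕ) :
    ((polyVec r : polySpace F r) : MvPolynomial (Fin f × Fin 2) F) = monomial (pairExp r 0) 1 := rfl

lemma polyForm_polyRep_monomial (r : Fin f → ℕ) (b : ℤ) (g : U11 k l)
    {m : Fin f × Fin 2 →₀ ℕ} (hm : ∀ j, m (j, 0) + m (j, 1) = r j) :
    polyForm r (polyRep p σ r b g ⟨monomial m 1, monomial_mem_polySpace hm 1⟩) =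
      σ (g.1 : Matrix (Fin 2) (Fin 2) l).det ^ b *
        ∏ j, twistEmb p σ j ((g.1 : Matrix (Fin 2) (Fin 2) l) 0 0) ^ m (j, 0) *
          twistEmb p σ j ((g.1 : Matrix (Fin 2) (Fin 2) l) 0 1) ^ m (j, 1) := by
  rw [← evalHighest_polyAct_monomial, ← smul_eq_mul, ← map_smul]
  rfl

lemma prod_twistEmb_pow (d : Fin f → ℕ) (x : l) :
    ∏ j, twistEmb p σ j x ^ d j = σ x ^ digitSum p d := by
  simp only [twistEmb_apply, ← pow_mul, Finset.prod_pow_eq_pow_sum, digitSum, mul_comm]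

lemma polyForm_polyRep_polyVec (r : Fin f → ℕ) (b : ℤ) (g : U11 k l) :
    polyForm r (polyRep p σ r b g (polyVec r)) =
      σ ((g.1 : Matrix (Fin 2) (Fin 2) l) 0 0) ^ digitSum p r *
        σ (g.1 : Matrix (Fin 2) (Fin 2) l).det ^ b := by
  rw [polyVec, polyForm_polyRep_monomial p σ r b g (m := pairExp r 0) (by simp)]
  simp [prod_twistEmb_pow, mul_comm]

lemma polySpace_hom_ext {M : Type*} [AddCommGroup M] [Module F M] {r : Fin f → ℕ}
    {L L' : polySpace F r →ₗ[F] M}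
    (h : ∀ (m : Fin f × Fin 2 →₀ ℕ) (hm : ∀ j, m (j, 0) + m (j, 1) = r j),
      L ⟨monomial m 1, monomial_mem_polySpace hm 1⟩ =
        L' ⟨monomial m 1, monomial_mem_polySpace hm 1⟩) : L = L' := by
  refine (polyBasis F r).ext fun d => ?_
  have hd : ∀ j, pairExp (fun j => r j - d j) (fun j => (d j : ℕ)) (j, 0) +
      pairExp (fun j => r j - d j) (fun j => (d j : ℕ)) (j, 1) = r j := fun j => by
    have := (d j).2
    simp only [pairExp_zero, pairExp_one]
    omega
  have h1 : polyBasis F r d = ⟨monomial _ 1, monomial_mem_polySpace hd 1⟩ :=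
    Subtype.ext (polyBasis_apply r d)
  rw [h1]
  exact h _ hd

lemma polyBasis_eq (r : Fin f → ℕ) (d : ∀ j, Fin (r j + 1))
    (hd : ∀ j, pairExp (fun j => r j - d j) (fun j => (d j : ℕ)) (j, 0) +
      pairExp (fun j => r j - d j) (fun j => (d j : ℕ)) (j, 1) = r j) :
    polyBasis F r d = ⟨monomial _ 1, monomial_mem_polySpace hd 1⟩ :=
  Subtype.ext (polyBasis_apply r d)

lemma polyAct_monomial (A : Matrix (Fin 2) (Fin 2) l) (m : Fin f × Fin 2 →₀ ℕ) :
    polyAct p σ A (monomial m 1) = ∏ j,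
      (C (twistEmb p σ j (A 0 0)) * X (j, 0) + C (twistEmb p σ j (A 1 0)) * X (j, 1)) ^ m (j, 0) *
      (C (twistEmb p σ j (A 0 1)) * X (j, 0) + C (twistEmb p σ j (A 1 1)) * X (j, 1)) ^
        m (j, 1) := by
  rw [polyAct, aeval_monomial_pair]
  simp [Fin.sum_univ_two]

lemma monomial_pair (m : Fin f × Fin 2 →₀ ℕ) (a : F) :
    monomial m a = C a * ∏ j, X (j, 0) ^ m (j, 0) * X (j, 1) ^ m (j, 1) := by
  have := aeval_monomial_pair (X : Fin f × Fin 2 → MvPolynomial (Fin f × Fin 2) F) m a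
  rwa [aeval_X_left] at this

lemma polyRep_lower_polyVec (r : Fin f → ℕ) (b : ℤ) (y : k) :
    polyRep p σ r b (lower y) (polyVec r) = ∑ d : ∀ j, Fin (r j + 1),
      ((∏ j, ((r j).choose (d j) : F)) * evk k σ y ^ digitSum p fun j => (d j : ℕ)) •
        polyBasis F r d := by
  apply Subtype.ext
  rw [polyRep_coe, det_lower, polyVec]
  simp only [AddSubmonoidClass.coe_finsetSum, Submodule.coe_smul, polyBasis_apply]
  rw [polyAct_monomial, lower_val]
  have h1 : ∀ j, (X (j, 0) + C (twistEmb p σ j (algebraMap k l y)) * X (j, 1) :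
      MvPolynomial (Fin f × Fin 2) F) ^ r j = ∑ i : Fin (r j + 1),
        C (((r j).choose i : F) * twistEmb p σ j (algebraMap k l y) ^ (i : ℕ)) *
          (X (j, 0) ^ (r j - i) * X (j, 1) ^ (i : ℕ)) := by
    intro j
    rw [add_comm, add_pow, Finset.sum_range]
    refine Finset.sum_congr rfl fun i _ => ?_
    rw [mul_pow, map_mul, map_pow, map_natCast]
    ring
  simp only [map_one, one_zpow, one_smul, pairExp_zero, pairExp_one, Pi.zero_apply, pow_zero,
    mul_one, Matrix.of_apply, Matrix.cons_val', Matrix.cons_val_zero, Matrix.cons_val_one,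
    Matrix.cons_val_fin_one, one_mul, h1]
  rw [Finset.prod_univ_sum, Fintype.piFinset_univ]
  refine Finset.sum_congr rfl fun d _ => ?_
  rw [Finset.prod_mul_distrib, monomial_pair, smul_eq_C_mul, C_1, one_mul]
  simp only [pairExp_zero, pairExp_one]
  congr 1
  rw [← map_prod, Finset.prod_mul_distrib, prod_twistEmb_pow]
  rfl

/-- The highest weight data of the polynomial model. -/
noncomputable def polyData [CharP F p] (hp : p.Prime) (hl : Module.finrank k l = 2)
    (r : Fin f → ℕ) (b : ℤ) (hr : ∀ j, r j < p) :
    HighestWeightData p hl σ (polyRep (k := k) p σ r b) r b where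
  vec := polyVec r
  form := polyForm r
  coeff := polyForm_polyRep_polyVec p σ r b
  upper_vec y := by
    apply Subtype.ext
    rw [polyRep_coe, det_upper, polyVec_coe, polyAct_monomial, upper_val, monomial_pair]
    simp
  form_lower y v := by
    refine LinearMap.congr_fun (f := polyForm r ∘ₗ polyRep p σ r b (lower y)) (g := polyForm r)
      (polySpace_hom_ext fun m hm => ?_) v
    have h0 := polyForm_polyRep_monomial (k := k) p σ r b 1 hm
    rw [map_one, Module.End.one_apply] at h0
    rw [LinearMap.comp_apply, polyForm_polyRep_monomial p σ r b _ hm, h0, det_lower, lower_val]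
    simp
  torus_vec t := by
    apply Subtype.ext
    rw [polyRep_coe, sigma_det_torus, Submodule.coe_smul, polyVec_coe, polyAct_monomial, torus_val,
      monomial_pair, zpow_add₀ (by simp), zpow_mul, mul_comm, mul_smul]
    congr 1
    simp only [map_zero, Matrix.of_apply, Matrix.cons_val', Matrix.cons_val_zero,
      Matrix.cons_val_one, Matrix.cons_val_fin_one, pairExp_zero, pairExp_one, Pi.zero_apply,
      pow_zero, mul_one, zero_mul, add_zero, mul_pow, Finset.prod_mul_distrib, ← C_pow,
      ← map_prod, prod_twistEmb_pow, smul_eq_C_mul, C_1, one_mul, zpow_natCast]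
  form_torus t v := by
    refine LinearMap.congr_fun (f := polyForm r ∘ₗ polyRep p σ r b (torus hl t))
      (g := (σ t ^ ((digitSum p r : ℤ) + (1 - Fintype.card k) * b)) • polyForm r)
      (polySpace_hom_ext fun m hm => ?_) v
    have h0 := polyForm_polyRep_monomial (k := k) p σ r b 1 hm
    rw [map_one, Module.End.one_apply] at h0
    rw [LinearMap.comp_apply, polyForm_polyRep_monomial p σ r b _ hm, LinearMap.smul_apply, h0,
      sigma_det_torus,
      torus_val, zpow_add₀ (by simp), zpow_mul, smul_eq_mul, mul_comm (_ ^ _) (_ ^ b), mul_assoc]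
    congr 1
    by_cases hz : ∀ j, m (j, 1) = 0
    · have hr : ∀ j, m (j, 0) = r j := fun j => by rw [← hm j, hz, add_zero]
      simp [hz, hr, prod_twistEmb_pow]
    · push Not at hz
      obtain ⟨j, hj⟩ := hz
      rw [Finset.prod_eq_zero (Finset.mem_univ j), Finset.prod_eq_zero (Finset.mem_univ j)]
      · simp
      · simp [hj]
      · simp [hj]
  basis := polyBasis F r
  basis_spec d y := by
    have hd : ∀ j, pairExp (fun j => r j - d j) (fun j => (d j : ℕ)) (j, 0) +
        pairExp (fun j => r j - d j) (fun j => (d j : ℕ)) (j, 1) = r j := fun j => by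
      have := (d j).2
      simp only [pairExp_zero, pairExp_one]
      omega
    rw [polyBasis_eq r d hd, polyForm_polyRep_monomial p σ r b _ hd, det_upper, upper_val]
    simp [prod_twistEmb_pow]
  dualBasis := (polyBasis F r).dualBasis.unitsSMul fun d =>
    (Units.mk0 (∏ j, ((r j).choose (d j) : F)) (Finset.prod_ne_zero_iff.2 fun j _ =>
      cast_choose_ne_zero hp (hr j) (Nat.lt_succ_iff.1 (d j).2)))⁻¹
  dualBasis_spec d y := by
    rw [polyRep_lower_polyVec, Module.Basis.unitsSMul_apply, Units.smul_def, LinearMap.smul_apply,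
      map_sum, Finset.sum_eq_single d]
    · have h0 : (∏ j, ((r j).choose (d j) : F)) ≠ 0 := Finset.prod_ne_zero_iff.2 fun j _ =>
        cast_choose_ne_zero hp (hr j) (Nat.lt_succ_iff.1 (d j).2)
      rw [map_smul, Module.Basis.dualBasis_apply_self, if_pos rfl, Units.val_inv_eq_inv_val,
        Units.val_mk0, smul_eq_mul, smul_eq_mul, mul_one, inv_mul_cancel_left₀ h0]
    · intro e _ hed
      rw [map_smul, Module.Basis.dualBasis_apply_self, if_neg hed, smul_zero]
    · simp

end PolynomialModel

end

/-! ### Comparison with the tensor product -/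

section

open MvPolynomial
open scoped TensorProduct

section TensorModel

variable {f : ℕ} {F : Type u} [Field F]

variable (F) in
/-- The basis of monomials of the binary forms of degree `n`. -/
noncomputable def symBasis (n : ℕ) :
    Module.Basis (Fin (n + 1)) F (homogeneousSubmodule (Fin 2) F n) :=
  weightedHomogeneousBasis 1 n (fun d => Finsupp.equivFunOnFinite.symm ![n - d, (d : ℕ)])
    (fun d e h => Fin.ext (by simpa using DFunLike.congr_fun h 1))
    (fun m => by
      rw [Finsupp.weight_apply, Finsupp.sum_fintype _ _ (by simp), Fin.sum_univ_two]
      simp only [Pi.one_apply, smul_eq_mul, mul_one]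
      constructor
      · intro h
        refine ⟨⟨m 1, by omega⟩, Finsupp.ext fun i => ?_⟩
        fin_cases i
        · simp; omega
        · simp
      · rintro ⟨d, rfl⟩
        have := d.2
        simp
        omega)

lemma symBasis_apply (n : ℕ) (d : Fin (n + 1)) :
    (symBasis F n d : MvPolynomial (Fin 2) F) = X 0 ^ (n - d : ℕ) * X 1 ^ (d : ℕ) := by
  refine (weightedHomogeneousBasis_apply ..).trans ?_
  rw [monomial_eq, Finsupp.prod_fintype _ _ (by simp), Fin.prod_univ_two]
  simp

/-- The product of binary forms in separate pairs of variables identifies the tensor product with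
the multihomogeneous polynomials. -/
noncomputable def tensorEquiv (n : Fin f → ℕ) :
    (⨂[F] j, homogeneousSubmodule (Fin 2) F (n j)) ≃ₗ[F] polySpace F n :=
  (Basis.piTensorProduct fun j => symBasis F (n j)).equiv (polyBasis F n) (Equiv.refl _)

lemma tensorEquiv_tprod (n : Fin f → ℕ) (v : ∀ j, homogeneousSubmodule (Fin 2) F (n j)) :
    (tensorEquiv n (PiTensorProduct.tprod F v) : MvPolynomial (Fin f × Fin 2) F) =
      ∏ j, rename (fun i => (j, i)) (v j : MvPolynomial (Fin 2) F) := by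
  let M : MultilinearMap F (fun j => homogeneousSubmodule (Fin 2) F (n j))
      (MvPolynomial (Fin f × Fin 2) F) :=
    (MultilinearMap.mkPiAlgebra F (Fin f) (MvPolynomial (Fin f × Fin 2) F)).compLinearMap
      fun j => (rename fun i => (j, i)).toLinearMap ∘ₗ
        (homogeneousSubmodule (Fin 2) F (n j)).subtype
  have h : (polySpace F n).subtype ∘ₗ (tensorEquiv n).toLinearMap = PiTensorProduct.lift M := by
    refine (Basis.piTensorProduct fun j => symBasis F (n j)).ext fun d => ?_
    have h1 : tensorEquiv n (Basis.piTensorProduct (fun j => symBasis F (n j)) d) =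
        polyBasis F n d := by
      rw [tensorEquiv, Module.Basis.equiv_apply, Equiv.refl_apply]
    rw [LinearMap.comp_apply, LinearEquiv.coe_coe, h1, Submodule.subtype_apply, polyBasis_apply,
      monomial_pair, Basis.piTensorProduct_apply, PiTensorProduct.lift.tprod]
    simp [M, symBasis_apply]
  have h2 := LinearMap.congr_fun h (PiTensorProduct.tprod F v)
  rw [PiTensorProduct.lift.tprod] at h2
  exact h2

variable {k : Type v} {l : Type u} [Field k] [Fintype k] [Field l] [Algebra k l]
variable (p : ℕ) [ExpChar l p] (σ : l →+* F)

lemma rename_linSubst (A : Matrix (Fin 2) (Fin 2) l) (j : Fin f) (P : MvPolynomial (Fin 2) F) :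
    rename (fun i => (j, i)) (linSubst F (A.map (twistEmb p σ j)) P) =
      polyAct p σ A (rename (fun i => (j, i)) P) := by
  have h : (rename fun i => (j, i)).comp (linSubst F (A.map (twistEmb p σ j))) =
      (polyAct p σ A).comp (rename fun i => (j, i)) := by
    apply MvPolynomial.algHom_ext
    intro i
    simp [linSubst, polyAct]
  exact AlgHom.congr_fun h P

/-- The Serre weight is isomorphic to its polynomial model. -/
noncomputable def serreEquiv (lam : XU f) :
    (serreRep (k := k) p σ lam).Equiv (polyRep p σ (fun j => ((lam j).1 - (lam j).2).toNat)
      (∑ j : Fin f, (lam j).2 * (p : ℤ) ^ (j : ℕ))) :=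
  Representation.Equiv.mk (tensorEquiv _) fun g => by
    apply PiTensorProduct.ext
    ext1 v
    apply Subtype.ext
    change (tensorEquiv _ (serreRep p σ lam g (PiTensorProduct.tprod F v)) :
      MvPolynomial (Fin f × Fin 2) F) =
        polyRep p σ _ _ g (tensorEquiv _ (PiTensorProduct.tprod F v))
    have h1 : ∀ j, ((algRep F (lam j) (Matrix.GeneralLinearGroup.map (twistEmb p σ j) g.1) (v j) :
        homogeneousSubmodule (Fin 2) F _) : MvPolynomial (Fin 2) F) =
        twistEmb p σ j g.1.1.det ^ (lam j).2 • linSubst F (g.1.1.map (twistEmb p σ j)) (v j) := by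
      intro j
      have h2 : ((Matrix.GeneralLinearGroup.det
          (Matrix.GeneralLinearGroup.map (twistEmb p σ j) g.1) : Fˣ) : F) =
          twistEmb p σ j g.1.1.det := by
        rw [Matrix.GeneralLinearGroup.val_det_apply]
        exact ((twistEmb p σ j).map_det _).symm
      change ((Matrix.GeneralLinearGroup.det
          (Matrix.GeneralLinearGroup.map (twistEmb p σ j) g.1) ^ (lam j).2 : Fˣ) : F) •
          linSubst F (g.1.1.map (twistEmb p σ j)) (v j) = _
      rw [Units.val_zpow_eq_zpow_val, h2]
    change (tensorEquiv _ (PiTensorProduct.map (fun j => algRep F (lam j)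
      (Matrix.GeneralLinearGroup.map (twistEmb p σ j) g.1)) (PiTensorProduct.tprod F v)) :
      MvPolynomial (Fin f × Fin 2) F) = _
    rw [PiTensorProduct.map_tprod, tensorEquiv_tprod, polyRep_coe, tensorEquiv_tprod, map_prod]
    simp only [h1, map_smul, rename_linSubst]
    rw [Finset.prod_smul]
    congr 1
    have hd : σ g.1.1.det ≠ 0 := by
      rw [map_ne_zero]
      exact ((Matrix.isUnit_iff_isUnit_det _).1 g.1.isUnit).ne_zero
    have h3 : ∀ s : Finset (Fin f), ∏ j ∈ s, twistEmb p σ j g.1.1.det ^ (lam j).2 =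
        σ g.1.1.det ^ ∑ j ∈ s, (lam j).2 * (p : ℤ) ^ (j : ℕ) := by
      intro s
      induction s using Finset.cons_induction with
      | empty => simp
      | cons a s ha ih =>
        rw [Finset.prod_cons, Finset.sum_cons, zpow_add₀ hd, ih, twistEmb_apply, mul_comm (lam a).2,
          zpow_mul]
        norm_cast
    exact h3 _

end TensorModel

end

/-! ### The projection from `Sym^{p+s}` -/

section

open MvPolynomial

section SlotMaps

variable {f : ℕ} {F : Type u} [Field F]

/-- The linear map with prescribed values on monomials. -/
noncomputable def monomialMap (g : (Fin f × Fin 2 →₀ ℕ) → MvPolynomial (Fin f × Fin 2) F) :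
    MvPolynomial (Fin f × Fin 2) F →ₗ[F] MvPolynomial (Fin f × Fin 2) F :=
  (basisMonomials (Fin f × Fin 2) F).constr F g

lemma monomialMap_monomial (g : (Fin f × Fin 2 →₀ ℕ) → MvPolynomial (Fin f × Fin 2) F)
    (m : Fin f × Fin 2 →₀ ℕ) : monomialMap g (monomial m 1) = g m := by
  have := (basisMonomials (Fin f × Fin 2) F).constr_basis F g m
  rwa [coe_basisMonomials] at this

variable (j : Fin f) (s : ℕ)

/-- The exponent of `(X_{j0} X_{j1})^{s+1}`. -/
noncomputable def slotExp : Fin f × Fin 2 →₀ ℕ :=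
  pairExp (Pi.single j (s + 1)) (Pi.single j (s + 1))

lemma slotExp_self (i : Fin 2) : slotExp j s (j, i) = s + 1 := by
  fin_cases i <;> simp [slotExp]

lemma slotExp_of_ne {j i : Fin f} (h : i ≠ j) (a : Fin 2) : slotExp j s (i, a) = 0 := by
  fin_cases a <;> simp [slotExp, h]

variable (F) in
/-- The linear section of `slotProj`. -/
noncomputable def slotLift : MvPolynomial (Fin f × Fin 2) F →ₗ[F] MvPolynomial (Fin f × Fin 2) F :=
  monomialMap fun m =>
    ((m (j, 1) + (s + 1)).choose (s + 1) : F)⁻¹ • monomial (m + slotExp j s) 1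

variable (F) in
/-- The divided power `∂_{j1}^{s+1} / (s+1)!` followed by the division by `X_{j0}^{s+1}`, which is
`X_{j0}^a X_{j1}^b ↦ binom(b, s+1) X_{j0}^{a-s-1} X_{j1}^{b-s-1}`. For `a + b = p + s` it is
the projection of `Sym^{p+s}` to the quotient `Sym^{p-2-s} ⊗ det^{s+1}`. -/
noncomputable def slotProj : MvPolynomial (Fin f × Fin 2) F →ₗ[F] MvPolynomial (Fin f × Fin 2) F :=
  monomialMap fun m => ((m (j, 1)).choose (s + 1) : F) • monomial (m - slotExp j s) 1

variable (F) in
/-- The division by `X_{ji}^p`, forgetting the remainder. -/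
noncomputable def slotQuot (p : ℕ) (i : Fin 2) :
    MvPolynomial (Fin f × Fin 2) F →ₗ[F] MvPolynomial (Fin f × Fin 2) F :=
  monomialMap fun m => if p ≤ m (j, i) then monomial (m - Finsupp.single (j, i) p) 1 else 0

variable {j s} {p : ℕ} {r : Fin f → ℕ} {P : MvPolynomial (Fin f × Fin 2) F}

/-- The binomial coefficient `binom(b, s+1)` vanishes modulo `p` for `p ≤ b ≤ p + s`. -/
lemma cast_choose_eq_zero [CharP F p] (hp : p.Prime) {b : ℕ} (hs : s + 2 ≤ p) (hb : p ≤ b)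
    (hb' : b ≤ p + s) : (b.choose (s + 1) : F) = 0 := by
  rw [CharP.cast_eq_zero_iff F p]
  exact hp.dvd_choose (by omega) (by omega) hb

lemma slotLift_mem (hs : r j + s + 2 = p) (hP : P ∈ polySpace F r) :
    slotLift F j s P ∈ polySpace F (Function.update r j (p + s)) := by
  refine map_mem_polySpace (fun m hm => ?_) hP
  rw [slotLift, monomialMap_monomial]
  refine Submodule.smul_mem _ _ (monomial_mem_polySpace (fun i => ?_) 1)
  have := hm i
  by_cases h : i = j
  · subst h
    simp only [Finsupp.add_apply, slotExp_self, Function.update_self]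
    omega
  · simp [slotExp_of_ne s h, h, this]

lemma slotProj_mem [CharP F p] (hp : p.Prime) (hs : r j + s + 2 = p)
    (hP : P ∈ polySpace F (Function.update r j (p + s))) : slotProj F j s P ∈ polySpace F r := by
  refine map_mem_polySpace (fun m hm => ?_) hP
  rw [slotProj, monomialMap_monomial]
  have hmj := hm j
  rw [Function.update_self] at hmj
  by_cases h1 : m (j, 1) < s + 1
  · rw [Nat.choose_eq_zero_of_lt h1]; simp
  by_cases h0 : p ≤ m (j, 1)
  · rw [cast_choose_eq_zero hp (by omega) h0 (by omega)]; simp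
  refine Submodule.smul_mem _ _ (monomial_mem_polySpace (fun i => ?_) 1)
  have := hm i
  by_cases h : i = j
  · subst h
    simp only [Finsupp.tsub_apply, slotExp_self]
    omega
  · simpa [slotExp_of_ne s h, h] using this

lemma slotQuot_mem (i : Fin 2) (hP : P ∈ polySpace F (Function.update r j (p + s))) :
    slotQuot F j p i P ∈ polySpace F (Function.update r j s) := by
  refine map_mem_polySpace (fun m hm => ?_) hP
  rw [slotQuot, monomialMap_monomial]
  split_ifs with hi
  · refine monomial_mem_polySpace (fun a => ?_) 1
    have ha := hm a
    by_cases h : a = j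
    · subst h
      rw [Function.update_self] at ha
      fin_cases i <;> simp at hi ⊢ <;> omega
    · simpa [h, Finsupp.single_apply, Ne.symm h] using ha
  · exact zero_mem _

lemma slotProj_slotLift [CharP F p] (hp : p.Prime) (hs : r j + s + 2 = p) (hP : P ∈ polySpace F r) :
    slotProj F j s (slotLift F j s P) = P := by
  refine polySpace_ext (L := slotProj F j s ∘ₗ slotLift F j s) (L' := LinearMap.id)
    (fun m hm => ?_) hP
  have hmj := hm j
  rw [LinearMap.comp_apply, slotLift, monomialMap_monomial, map_smul, slotProj,
    monomialMap_monomial, Finsupp.add_apply, slotExp_self, smul_smul,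
    inv_mul_cancel₀ (cast_choose_ne_zero hp (by omega) (by omega)), one_smul, add_tsub_cancel_right]
  rfl

lemma slotQuot_X_pow_mul (hs : s < p) (i a : Fin 2)
    (hP : P ∈ polySpace F (Function.update r j s)) :
    slotQuot F j p i (X (j, a) ^ p * P) = if i = a then P else 0 := by
  have key := polySpace_ext (L := slotQuot F j p i ∘ₗ LinearMap.mulLeft F (X (j, a) ^ p))
    (L' := if i = a then LinearMap.id else 0) (fun m hm => ?_) hP
  · rw [LinearMap.comp_apply, LinearMap.mulLeft_apply] at key
    rw [key]
    split_ifs <;> rfl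
  · have hmj := hm j
    rw [Function.update_self] at hmj
    rw [LinearMap.comp_apply, LinearMap.mulLeft_apply, X_pow_eq_monomial, monomial_mul, one_mul,
      slotQuot, monomialMap_monomial]
    by_cases h : i = a
    · subst h
      simp
    · rw [if_neg, if_neg h, LinearMap.zero_apply]
      have h1 : (j, a) ≠ (j, i) := fun he => h (congrArg Prod.snd he).symm
      rw [Finsupp.add_apply, Finsupp.single_eq_of_ne (Ne.symm h1)]
      fin_cases i <;> simp <;> omega

/-- The kernel of `slotProj` on multidegree `p + s` in position `j` is generated by the `p`-th
powers of `X_{j0}` and `X_{j1}`. -/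
lemma slot_decomposition [CharP F p] (hp : p.Prime) (hs : r j + s + 2 = p)
    (hP : P ∈ polySpace F (Function.update r j (p + s))) :
    P = slotLift F j s (slotProj F j s P) +
      (X (j, 0) ^ p * slotQuot F j p 0 P + X (j, 1) ^ p * slotQuot F j p 1 P) := by
  refine polySpace_ext (L := LinearMap.id) (L' := slotLift F j s ∘ₗ slotProj F j s +
    (LinearMap.mulLeft F (X (j, 0) ^ p) ∘ₗ slotQuot F j p 0 +
      LinearMap.mulLeft F (X (j, 1) ^ p) ∘ₗ slotQuot F j p 1)) (fun m hm => ?_) hP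
  have hmj := hm j
  rw [Function.update_self] at hmj
  simp only [LinearMap.id_apply, LinearMap.add_apply, LinearMap.comp_apply, LinearMap.mulLeft_apply]
  have hX : ∀ i, p ≤ m (j, i) →
      X (j, i) ^ p * monomial (m - Finsupp.single (j, i) p) (1 : F) = monomial m 1 := by
    intro i hi
    rw [X_pow_eq_monomial, monomial_mul, one_mul,
      add_tsub_cancel_of_le (Finsupp.single_le_iff.2 hi)]
  simp only [slotProj, slotQuot, monomialMap_monomial, map_smul]
  by_cases h0 : p ≤ m (j, 0)
  · rw [if_pos h0, if_neg (by omega), hX 0 h0, Nat.choose_eq_zero_of_lt (by omega)]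
    simp
  by_cases h1 : p ≤ m (j, 1)
  · rw [if_pos h1, if_neg h0, hX 1 h1, cast_choose_eq_zero hp (by omega) h1 (by omega)]
    simp
  have hle : slotExp j s ≤ m := by
    rintro ⟨i, a⟩
    by_cases h : i = j
    · subst h
      rw [slotExp_self]
      fin_cases a <;> simp <;> omega
    · rw [slotExp_of_ne s h]; exact Nat.zero_le _
  rw [if_neg h0, if_neg h1, slotLift, monomialMap_monomial, Finsupp.tsub_apply, slotExp_self,
    Nat.sub_add_cancel (by omega), tsub_add_cancel_of_le hle, smul_smul,
    mul_inv_cancel₀ (cast_choose_ne_zero hp (by omega) (by omega)), one_smul]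
  simp

end SlotMaps

end

/-! ### The cocycle of the extension -/

section

open MvPolynomial

section SlotForm

variable {f : ℕ} {F : Type u} [Field F]

/-- The identity `binom(a, i) = (-1)^i binom(p - 1 - a + i, i)` modulo `p`. -/
lemma cast_choose_eq_neg_one_pow_mul {p : ℕ} [CharP F p] (hp : p.Prime) {a b i : ℕ}
    (hab : a + b + 1 = p) (hi : i ≤ a) :
    (a.choose i : F) = (-1) ^ i * ((b + i).choose i : F) := by
  have hF : ((a : F) + b + 1) = 0 := by
    rw [← CharP.cast_eq_zero F p, ← hab]; push_cast; ring
  have key : ∀ i ≤ a, (a.descFactorial i : F) = (-1) ^ i * ((b + 1).ascFactorial i : F) := by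
    intro i
    induction i with
    | zero => simp
    | succ i ih =>
      intro hi
      rw [Nat.descFactorial_succ, Nat.ascFactorial_succ, Nat.cast_mul, ih (by omega),
        Nat.cast_sub (by omega)]
      push_cast
      have : (a : F) - i = -(b + 1 + i) := by linear_combination hF
      rw [this]
      ring
  have hi0 : (i.factorial : F) ≠ 0 := by
    rw [Ne, CharP.cast_eq_zero_iff F p, hp.dvd_factorial]; omega
  refine mul_left_cancel₀ hi0 ?_
  have h1 := key i hi
  rw [Nat.descFactorial_eq_factorial_mul_choose, Nat.ascFactorial_eq_factorial_mul_choose] at h1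
  push_cast at h1
  rw [h1]
  ring

lemma coeff_C_add_C_mul_X_pow (x y : F) (n i : ℕ) :
    ((Polynomial.C x + Polynomial.C y * Polynomial.X) ^ n).coeff i =
      x ^ (n - i) * y ^ i * (n.choose i : F) := by
  have : Polynomial.C x + Polynomial.C y * Polynomial.X =
      (Polynomial.X + Polynomial.C x).comp (Polynomial.C y * Polynomial.X) := by simp [add_comm]
  rw [this, ← Polynomial.pow_comp, Polynomial.comp_C_mul_X_coeff, Polynomial.coeff_X_add_C_pow]
  ring

/-- In characteristic `p` and for `a + b = p + s`, the coefficient of `T^{s+1}` in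
`(α + γ T)^a (β + δ T)^b` is `binom(b, s+1) α^{a-s-1} β^{b-s-1} (α δ - β γ)^{s+1}`. -/
lemma coeff_linear_pow_mul_linear_pow {p : ℕ} [CharP F p] (hp : p.Prime) {a b s : ℕ}
    (hs : s + 2 ≤ p) (hab : a + b = p + s) (α β γ δ : F) :
    ((Polynomial.C α + Polynomial.C γ * Polynomial.X) ^ a *
      (Polynomial.C β + Polynomial.C δ * Polynomial.X) ^ b).coeff (s + 1) =
      (b.choose (s + 1) : F) *
        (α ^ (a - (s + 1)) * β ^ (b - (s + 1)) * (α * δ - β * γ) ^ (s + 1)) := by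
  rw [Polynomial.coeff_mul, Finset.Nat.sum_antidiagonal_eq_sum_range_succ_mk]
  simp only [coeff_C_add_C_mul_X_pow]
  by_cases hb : b ≤ s
  · rw [Nat.choose_eq_zero_of_lt (show b < s + 1 by omega), Nat.cast_zero, zero_mul]
    refine Finset.sum_eq_zero fun i hi => ?_
    rw [Finset.mem_range] at hi
    by_cases h : b < s + 1 - i
    · simp [Nat.choose_eq_zero_of_lt h]
    · have : (a.choose i : F) = 0 := by
        rw [CharP.cast_eq_zero_iff F p]
        exact hp.dvd_choose (by omega) (by omega) (by omega)
      simp [this]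
  by_cases ha : a ≤ s
  · have hb0 : (b.choose (s + 1) : F) = 0 := by
      rw [CharP.cast_eq_zero_iff F p]
      exact hp.dvd_choose (by omega) (by omega) (by omega)
    rw [hb0, zero_mul]
    refine Finset.sum_eq_zero fun i hi => ?_
    rw [Finset.mem_range] at hi
    by_cases h : a < i
    · simp [Nat.choose_eq_zero_of_lt h]
    · have : (b.choose (s + 1 - i) : F) = 0 := by
        rw [CharP.cast_eq_zero_iff F p]
        exact hp.dvd_choose (by omega) (by omega) (by omega)
      simp [this]
  obtain ⟨a', rfl⟩ : ∃ a', a = a' + (s + 1) := ⟨a - (s + 1), by omega⟩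
  obtain ⟨b', rfl⟩ : ∃ b', b = b' + (s + 1) := ⟨b - (s + 1), by omega⟩
  rw [sub_eq_neg_add, add_pow, Finset.mul_sum, Finset.mul_sum, add_tsub_cancel_right,
    add_tsub_cancel_right]
  refine Finset.sum_congr rfl fun i hi => ?_
  rw [Finset.mem_range] at hi
  obtain ⟨t, ht⟩ : ∃ t, s + 1 = i + t := ⟨s + 1 - i, by omega⟩
  rw [cast_choose_eq_neg_one_pow_mul hp (b := b') (by omega) (show i ≤ a' + (s + 1) by omega)]
  have h1 : (b' + (s + 1)).choose (s + 1) * (s + 1).choose i =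
      (b' + (s + 1)).choose t * (b' + i).choose i := by
    rw [← Nat.choose_symm (show i ≤ s + 1 by omega), Nat.choose_mul (by omega)]
    simp only [ht, Nat.add_sub_cancel_left]
    rw [show b' + (i + t) - t = b' + i by omega, show i + t - t = i by omega]
  have h2 := congrArg (Nat.cast (R := F)) h1
  push_cast at h2
  rw [show s + 1 - i = t by omega, show a' + (s + 1) - i = a' + t by omega,
    show b' + (s + 1) - t = b' + i by omega]
  rw [neg_pow (β * γ), mul_pow β γ, mul_pow α δ]
  calc _ = ((b' + (s + 1)).choose t * (b' + i).choose i : F) * (-1) ^ i *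
        (α ^ (a' + t) * γ ^ i * β ^ (b' + i) * δ ^ t) := by ring
    _ = _ := by rw [← h2, pow_add, pow_add]; ring

variable {k : Type v} {l : Type u} [Field k] [Fintype k] [Field l] [Algebra k l]
variable (p : ℕ) [ExpChar l p] (σ : l →+* F)

/-- The coefficient of `T^n` after the substitution `X_{j0} ↦ 1`, `X_{j1} ↦ T`, and
`X_{i0} ↦ 1`, `X_{i1} ↦ 0` for `i ≠ j`. -/
noncomputable def slotForm (j : Fin f) (n : ℕ) : MvPolynomial (Fin f × Fin 2) F →ₗ[F] F :=
  Polynomial.lcoeff F n ∘ₗ (aeval fun x : Fin f × Fin 2 =>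
    if x.2 = 0 then 1 else if x.1 = j then Polynomial.X else 0 :
      MvPolynomial (Fin f × Fin 2) F →ₐ[F] Polynomial F).toLinearMap

lemma slotForm_polyAct_monomial (j : Fin f) (n : ℕ) (A : Matrix (Fin 2) (Fin 2) l)
    (m : Fin f × Fin 2 →₀ ℕ) :
    slotForm j n (polyAct p σ A (monomial m 1)) =
      (∏ i ∈ Finset.univ.erase j, twistEmb p σ i (A 0 0) ^ m (i, 0) *
        twistEmb p σ i (A 0 1) ^ m (i, 1)) *
      ((Polynomial.C (twistEmb p σ j (A 0 0)) +
          Polynomial.C (twistEmb p σ j (A 1 0)) * Polynomial.X) ^ m (j, 0) *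
        (Polynomial.C (twistEmb p σ j (A 0 1)) +
          Polynomial.C (twistEmb p σ j (A 1 1)) * Polynomial.X) ^ m (j, 1)).coeff n := by
  rw [← Polynomial.coeff_C_mul, slotForm, LinearMap.comp_apply, Polynomial.lcoeff_apply,
    polyAct_monomial, AlgHom.toLinearMap_apply, map_prod,
    ← Finset.prod_erase_mul _ _ (Finset.mem_univ j), map_prod]
  congr 2
  · refine Finset.prod_congr rfl fun i hi => ?_
    simp [Finset.ne_of_mem_erase hi, ← algebraMap_eq]
  · simp [← algebraMap_eq]

variable {p} in
/-- `slotForm` gives the highest weight coefficient of the projection `slotProj`. -/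
lemma slotForm_polyAct [CharP F p] (hp : p.Prime) {j : Fin f} {s : ℕ} {r : Fin f → ℕ}
    (hs : r j + s + 2 = p) (A : Matrix (Fin 2) (Fin 2) l) {P : MvPolynomial (Fin f × Fin 2) F}
    (hP : P ∈ polySpace F (Function.update r j (p + s))) :
    slotForm j (s + 1) (polyAct p σ A P) =
      twistEmb p σ j A.det ^ (s + 1) * evalHighest (polyAct p σ A (slotProj F j s P)) := by
  refine polySpace_ext (L := slotForm j (s + 1) ∘ₗ (polyAct p σ A).toLinearMap)
    (L' := (twistEmb p σ j A.det ^ (s + 1)) •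
      (evalHighest.toLinearMap ∘ₗ (polyAct p σ A).toLinearMap ∘ₗ slotProj F j s))
    (fun m hm => ?_) hP
  have hmj := hm j
  rw [Function.update_self] at hmj
  simp only [LinearMap.comp_apply, AlgHom.toLinearMap_apply, LinearMap.smul_apply, slotProj,
    monomialMap_monomial, map_smul]
  rw [slotForm_polyAct_monomial, coeff_linear_pow_mul_linear_pow hp (by omega) hmj,
    evalHighest_polyAct_monomial, ← Finset.prod_erase_mul _ _ (Finset.mem_univ j),
    Matrix.det_fin_two, map_sub, map_mul, map_mul, smul_eq_mul, smul_eq_mul]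
  have : ∀ i ∈ Finset.univ.erase j, twistEmb p σ i (A 0 0) ^ m (i, 0) *
      twistEmb p σ i (A 0 1) ^ m (i, 1) = twistEmb p σ i (A 0 0) ^ (m - slotExp j s) (i, 0) *
      twistEmb p σ i (A 0 1) ^ (m - slotExp j s) (i, 1) := fun i hi => by
    simp [slotExp_of_ne s (Finset.ne_of_mem_erase hi)]
  rw [Finset.prod_congr rfl this]
  simp only [Finsupp.tsub_apply, slotExp_self]
  ring

variable {p} in
/-- For `r_j + s + 2 = p`, the map `slotProj` from multidegree `p + s` in position `j` to
multidegree `r_j` is equivariant up to the indicated twist by a power of the determinant. -/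
lemma slotProj_polyRep [CharP F p] (hp : p.Prime) (hl : Module.finrank k l = 2)
    (hk : Fintype.card k = p ^ f) {j : Fin f} {s : ℕ} {r : Fin f → ℕ} (hr : ∀ i, r i < p)
    (hs : r j + s + 2 = p) (b : ℤ) (g : U11 k l)
    (P : polySpace F (Function.update r j (p + s))) :
    slotProj F j s (polyRep p σ (Function.update r j (p + s)) (b - (s + 1) * p ^ (j : ℕ)) g P) =
      polyRep p σ r b g ⟨slotProj F j s P, slotProj_mem hp hs P.2⟩ := by
  have H : ∀ (h : U11 k l) (Q : polySpace F (Function.update r j (p + s))),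
      slotForm j (s + 1) (polyRep p σ (Function.update r j (p + s))
        (b - (s + 1) * p ^ (j : ℕ)) h Q).1 =
      polyForm r (polyRep p σ r b h ⟨slotProj F j s Q, slotProj_mem hp hs Q.2⟩) := by
    intro h Q
    have hd : σ (h.1 : Matrix (Fin 2) (Fin 2) l).det ≠ 0 :=
      (map_ne_zero σ).2 (Matrix.GeneralLinearGroup.det h.1).ne_zero
    change _ = evalHighest (polyRep p σ r b h ⟨slotProj F j s Q, slotProj_mem hp hs Q.2⟩).1
    rw [polyRep_coe, polyRep_coe, map_smul, map_smul, slotForm_polyAct σ hp hs _ Q.2,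
      twistEmb_apply, ← pow_mul, zpow_sub₀ hd, smul_eq_mul, smul_eq_mul]
    have : σ (h.1 : Matrix (Fin 2) (Fin 2) l).det ^ (((s : ℤ) + 1) * (p : ℤ) ^ (j : ℕ)) =
        σ (h.1 : Matrix (Fin 2) (Fin 2) l).det ^ (p ^ (j : ℕ) * (s + 1)) := by
      rw [← zpow_natCast]; push_cast; ring_nf
    rw [this]
    field_simp
  have h1 : (⟨slotProj F j s (polyRep p σ (Function.update r j (p + s))
      (b - (s + 1) * p ^ (j : ℕ)) g P), slotProj_mem hp hs (Subtype.prop _)⟩ : polySpace F r) =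
      polyRep p σ r b g ⟨slotProj F j s P, slotProj_mem hp hs P.2⟩ := by
    refine (polyData p σ hp hl r b hr).eq_of_form_upper hk hr hp.pos fun y => ?_
    change polyForm r _ = polyForm r _
    rw [← H, ← Module.End.mul_apply, ← Module.End.mul_apply, ← map_mul, ← map_mul, H]
  exact congrArg Subtype.val h1

end SlotForm

section SlotCocycle

variable {f : ℕ} {F : Type u} [Field F]
variable {k : Type v} {l : Type u} [Field k] [Fintype k] [Field l] [Algebra k l]
variable {p : ℕ} [ExpChar l p] (σ : l →+* F)

lemma sigma_det_ne_zero (g : U11 k l) : σ (g.1 : Matrix (Fin 2) (Fin 2) l).det ≠ 0 :=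
  (map_ne_zero σ).2 (Matrix.GeneralLinearGroup.det g.1).ne_zero

lemma U11_det_pow (g : U11 k l) :
    (g.1 : Matrix (Fin 2) (Fin 2) l).det ^ (Fintype.card k + 1) = 1 := by
  have h0 := (Matrix.GeneralLinearGroup.det g.1).ne_zero
  rw [Matrix.GeneralLinearGroup.val_det_apply] at h0
  set A := (g.1 : Matrix (Fin 2) (Fin 2) l) with hA
  have h : ∀ i j, A i j ^ Fintype.card k * A.det = A i j := U11_entry_pow g
  have h1 : A.det ^ Fintype.card k * A.det ^ 2 = A.det := by
    have hfr : A.det ^ Fintype.card k =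
        A 0 0 ^ Fintype.card k * A 1 1 ^ Fintype.card k -
          A 0 1 ^ Fintype.card k * A 1 0 ^ Fintype.card k := by
      have h2 := map_sub (FiniteField.frobeniusAlgHom k l) (A 0 0 * A 1 1) (A 0 1 * A 1 0)
      simp only [FiniteField.coe_frobeniusAlgHom, mul_pow] at h2
      rw [Matrix.det_fin_two, h2]
    rw [hfr]
    conv_rhs => rw [Matrix.det_fin_two, ← h 0 0, ← h 1 1, ← h 0 1, ← h 1 0]
    ring
  refine mul_right_cancel₀ h0 ?_
  rw [one_mul, pow_succ, mul_assoc, ← sq, h1]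

/-- The power of the determinant only depends on the exponent modulo `q + 1`. -/
lemma sigma_det_zpow_congr (g : U11 k l) {a b : ℤ} (h : a ≡ b [ZMOD (Fintype.card k : ℤ) + 1]) :
    σ (g.1 : Matrix (Fin 2) (Fin 2) l).det ^ a = σ (g.1 : Matrix (Fin 2) (Fin 2) l).det ^ b := by
  obtain ⟨c, hc⟩ := h.dvd
  have h1 : σ (g.1 : Matrix (Fin 2) (Fin 2) l).det ^ ((Fintype.card k : ℤ) + 1) = 1 := by
    rw [← map_one σ, ← U11_det_pow g, map_pow, ← zpow_natCast]
    push_cast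
    rfl
  rw [eq_add_of_sub_eq' hc, zpow_add₀ (sigma_det_ne_zero σ g), zpow_mul, h1, one_zpow, mul_one]

lemma Fin.val_add_one_eq_ite [NeZero f] (i : Fin f) :
    ((i + 1 : Fin f) : ℕ) = if (i : ℕ) + 1 = f then 0 else (i : ℕ) + 1 := by
  have h := i.2
  rw [Fin.val_add, show ((1 : Fin f) : ℕ) = 1 % f from rfl, Nat.add_mod_mod]
  split_ifs with h1
  · rw [h1, Nat.mod_self]
  · exact Nat.mod_eq_of_lt (by omega)

lemma Fin.add_one_eq_zero_iff_val [NeZero f] (i : Fin f) : i + 1 = 0 ↔ (i : ℕ) + 1 = f := by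
  rw [← Fin.val_inj, Fin.val_add_one_eq_ite, Fin.val_zero]
  split_ifs with h <;> simp [h]

/-- The `p`-th power of the entries passes from one embedding to the next one; from the last
embedding to the zeroth one this is the unitarity relation. -/
lemma twistEmb_pow [NeZero f] (hk : Fintype.card k = p ^ f) (g : U11 k l) (i : Fin f)
    (a b : Fin 2) : twistEmb p σ i (g.1 a b) ^ p =
      σ (g.1 : Matrix (Fin 2) (Fin 2) l).det ^ (-(if i + 1 = 0 then 1 else 0) : ℤ) *
        twistEmb p σ (i + 1) (g.1 a b) := by
  rw [twistEmb_apply, twistEmb_apply, ← pow_mul, ← pow_succ, Fin.val_add_one_eq_ite]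
  simp only [Fin.add_one_eq_zero_iff_val]
  split_ifs with h
  · have h1 := congrArg σ (U11_entry_pow g a b)
    rw [map_mul, map_pow, hk] at h1
    rw [h, pow_zero, pow_one, zpow_neg_one, eq_inv_mul_iff_mul_eq₀ (sigma_det_ne_zero σ g),
      mul_comm,
      h1]
  · simp

/-- The chain rule for the substitution `polyAct`. -/
lemma pderiv_polyAct (A : Matrix (Fin 2) (Fin 2) l) (j : Fin f) (a : Fin 2)
    (P : MvPolynomial (Fin f × Fin 2) F) : pderiv (j, a) (polyAct p σ A P) =
      ∑ c, C (twistEmb p σ j (A a c)) * polyAct p σ A (pderiv (j, c) P) := by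
  induction P using MvPolynomial.induction_on with
  | C x => simp [← algebraMap_eq]
  | add P Q hP hQ => simp only [map_add, hP, hQ, mul_add, Finset.sum_add_distrib]
  | mul_X P x hP =>
    rw [map_mul, Derivation.leibniz, hP]
    have hX : pderiv (j, a) (polyAct p σ A (X x)) =
        ∑ c, C (twistEmb p σ j (A a c)) * polyAct p σ A (pderiv (j, c) (X x)) := by
      obtain ⟨i, b⟩ := x
      rw [polyAct, aeval_X, map_sum]
      by_cases h : i = j
      · subst h
        simp [Derivation.leibniz, pderiv_X, Pi.single_apply, apply_ite]
      · simp [Derivation.leibniz, pderiv_X, h]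
    rw [hX]
    simp only [Derivation.leibniz, map_add, smul_eq_mul, map_mul, mul_add, Finset.sum_add_distrib,
      Finset.mul_sum]
    congr 1 <;> exact Finset.sum_congr rfl fun c _ => by ring

/-- The maps `μ 0`, `μ 1` define an equivariant map `∑_i X_{ji}^p P_i ↦ ∑_i μ_i(P_i)` from the
`p`-th powers of the variables in position `j` times the polynomials of multidegree `r₀`, with
determinant exponent `b₀`, to the polynomials of multidegree `r'`, with determinant exponent
`b'`. -/
structure SlotMul (p : ℕ) [ExpChar l p] (σ : l →+* F) (j : Fin f) (r₀ r' : Fin f → ℕ) (b₀ b' : ℤ)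
    (μ : Fin 2 → MvPolynomial (Fin f × Fin 2) F →ₗ[F] MvPolynomial (Fin f × Fin 2) F) : Prop where
  mem : ∀ i, ∀ P ∈ polySpace F r₀, μ i P ∈ polySpace F r'
  equiv : ∀ (g : U11 k l) (i : Fin 2), ∀ P ∈ polySpace F r₀,
    σ (g.1 : Matrix (Fin 2) (Fin 2) l).det ^ b₀ •
      ∑ a, twistEmb p σ j (g.1 a i) ^ p • μ a (polyAct p σ (g.1 : Matrix (Fin 2) (Fin 2) l) P) =
    σ (g.1 : Matrix (Fin 2) (Fin 2) l).det ^ b' •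
      polyAct p σ (g.1 : Matrix (Fin 2) (Fin 2) l) (μ i P)

variable {σ}

/-- The cocycle of the extension obtained from `Sym^{p+s}` in position `j` by pushing out its
subspace generated by `p`-th powers along `μ`: lift `P` along `slotProj`, let `g` act, and apply
`μ` to the quotients by the `p`-th powers. -/
noncomputable def slotCocycle {j : Fin f} {r r' : Fin f → ℕ} {s : ℕ} {b₀ b' : ℤ}
    {μ : Fin 2 → MvPolynomial (Fin f × Fin 2) F →ₗ[F] MvPolynomial (Fin f × Fin 2) F}
    (hs : r j + s + 2 = p) (hμ : SlotMul (k := k) p σ j (Function.update r j s) r' b₀ b' μ)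
    (g : U11 k l) : polySpace F r →ₗ[F] polySpace F r' :=
  LinearMap.codRestrict (polySpace F r')
    ((∑ i, μ i ∘ₗ slotQuot F j p i) ∘ₗ
      (polySpace F (Function.update r j (p + s))).subtype ∘ₗ
        polyRep p σ (Function.update r j (p + s)) b₀ g ∘ₗ
          (slotLift F j s).restrict fun _ hP => slotLift_mem hs hP)
    fun P => by
      rw [LinearMap.comp_apply, LinearMap.sum_apply]
      exact sum_mem fun i _ => hμ.mem i _ (slotQuot_mem i (Subtype.prop _))

lemma slotCocycle_coe {j : Fin f} {r r' : Fin f → ℕ} {s : ℕ} {b₀ b' : ℤ}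
    {μ : Fin 2 → MvPolynomial (Fin f × Fin 2) F →ₗ[F] MvPolynomial (Fin f × Fin 2) F}
    (hs : r j + s + 2 = p) (hμ : SlotMul (k := k) p σ j (Function.update r j s) r' b₀ b' μ)
    (g : U11 k l) (P : polySpace F r) :
    (slotCocycle hs hμ g P : MvPolynomial (Fin f × Fin 2) F) =
      ∑ i, μ i (slotQuot F j p i (polyRep p σ (Function.update r j (p + s)) b₀ g
        ⟨slotLift F j s P, slotLift_mem hs P.2⟩)) := by
  simp [slotCocycle]
  rfl

lemma slotCocycle_mem [CharP F p] (hp : p.Prime) (hl : Module.finrank k l = 2)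
    (hk : Fintype.card k = p ^ f) {j : Fin f} {r r' : Fin f → ℕ} {s : ℕ} {b b' : ℤ}
    {μ : Fin 2 → MvPolynomial (Fin f × Fin 2) F →ₗ[F] MvPolynomial (Fin f × Fin 2) F}
    (hr : ∀ i, r i < p) (hs : r j + s + 2 = p)
    (hμ : SlotMul (k := k) p σ j (Function.update r j s) r' (b - (s + 1) * p ^ (j : ℕ)) b' μ) :
    slotCocycle hs hμ ∈ extCocycles (polyRep p σ r b) (polyRep p σ r' b') := by
  intro g h
  ext1 P
  apply Subtype.ext
  set rE := Function.update r j (p + s) with hrE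
  set bE := b - (s + 1) * p ^ (j : ℕ) with hbE
  have hlift : ∀ Q : polySpace F r, slotLift F j s Q ∈ polySpace F rE := fun Q =>
    slotLift_mem hs Q.2
  set x : polySpace F rE := ⟨slotLift F j s P, hlift P⟩ with hx
  set Q : Fin 2 → MvPolynomial (Fin f × Fin 2) F := fun i =>
    slotQuot F j p i (polyRep p σ rE bE h x) with hQ
  have hQm : ∀ i, Q i ∈ polySpace F (Function.update r j s) := fun i =>
    slotQuot_mem i (Subtype.prop _)
  have hx' : (⟨slotProj F j s x, slotProj_mem hp hs x.2⟩ : polySpace F r) = P :=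
    Subtype.ext (slotProj_slotLift hp hs P.2)
  -- the decomposition of `h x` into the lift of `h P` and a part divisible by `p`-th powers
  have h1 : (polyRep p σ rE bE h x : MvPolynomial (Fin f × Fin 2) F) =
      slotLift F j s (polyRep p σ r b h P) + ∑ i, X (j, i) ^ p * Q i := by
    have h2 := slot_decomposition hp hs (polyRep p σ rE bE h x).2
    rwa [slotProj_polyRep σ hp hl hk hr hs, hx', ← Fin.sum_univ_two (fun i => X (j, i) ^ p *
      slotQuot F j p i (polyRep p σ rE bE h x : MvPolynomial (Fin f × Fin 2) F))] at h2
  have hX : ∀ i, polyAct p σ (g.1 : Matrix (Fin 2) (Fin 2) l)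
      (X (j, i) ^ p : MvPolynomial (Fin f × Fin 2) F) =
        ∑ a, C (twistEmb p σ j (g.1 a i) ^ p) * X (j, a) ^ p := by
    intro i
    have : ExpChar F p := ExpChar.prime hp
    rw [map_pow, polyAct, aeval_X, sum_pow_char]
    simp only [mul_pow, C_pow]
  have h2 : ∀ a, slotQuot F j p a (polyRep p σ rE bE (g * h) x) =
      slotQuot F j p a (polyRep p σ rE bE g ⟨slotLift F j s (polyRep p σ r b h P), hlift _⟩) +
        ∑ i, σ (g.1 : Matrix (Fin 2) (Fin 2) l).det ^ bE • twistEmb p σ j (g.1 a i) ^ p •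
          polyAct p σ (g.1 : Matrix (Fin 2) (Fin 2) l) (Q i) := by
    intro a
    rw [map_mul, Module.End.mul_apply, polyRep_coe, polyRep_coe _ _ _ _ g ⟨_, hlift _⟩]
    simp only [h1, map_add, smul_add]
    congr 1
    rw [map_smul, map_sum, map_sum, Finset.smul_sum]
    refine Finset.sum_congr rfl fun i _ => ?_
    rw [map_mul, hX, Finset.sum_mul, map_sum, Finset.sum_eq_single a]
    · rw [mul_assoc, ← smul_eq_C_mul, map_smul,
        slotQuot_X_pow_mul (by omega) _ _ (polyAct_mem p σ _ (hQm i)), if_pos rfl]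
    · intro c _ hc
      rw [mul_assoc, ← smul_eq_C_mul, map_smul,
        slotQuot_X_pow_mul (by omega) _ _ (polyAct_mem p σ _ (hQm i)), if_neg hc.symm, smul_zero]
    · simp
  rw [slotCocycle_coe]
  simp only [LinearMap.add_apply, LinearMap.comp_apply, Submodule.coe_add, polyRep_coe p σ r' b',
    slotCocycle_coe]
  rw [Finset.sum_congr rfl fun a _ => congrArg (μ a) (h2 a)]
  simp only [map_add, Finset.sum_add_distrib]
  rw [add_comm, map_sum, Finset.smul_sum]
  congr 1
  have h3 : ∀ i, _ := fun i => hμ.equiv g i (Q i) (hQm i)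
  change _ = ∑ i, σ (g.1 : Matrix (Fin 2) (Fin 2) l).det ^ b' •
    polyAct p σ (g.1 : Matrix (Fin 2) (Fin 2) l) (μ i (Q i))
  simp only [← h3, map_sum, map_smul, Finset.smul_sum]
  exact Finset.sum_comm

/-- The `p`-th powers of the variables in position `j` transform like the variables in position
`j + 1`, up to a determinant when passing from the last position to the zeroth one. -/
lemma slotMul_X [NeZero f] (hk : Fintype.card k = p ^ f) (j : Fin f) (r₀ : Fin f → ℕ) {b₀ b' : ℤ}
    (hb : b' ≡ b₀ - (if j + 1 = 0 then 1 else 0) [ZMOD (Fintype.card k : ℤ) + 1]) :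
    SlotMul (k := k) p σ j r₀ (r₀ + Pi.single (j + 1) 1) b₀ b'
      fun i => LinearMap.mulLeft F (X (j + 1, i)) where
  mem i P hP := by
    rw [LinearMap.mulLeft_apply, add_comm]
    exact (isWeightedHomogeneous_X F multiDeg (j + 1, i)).mul hP
  equiv g i P _ := by
    simp only [twistEmb_pow σ hk, LinearMap.mulLeft_apply, mul_smul, ← Finset.smul_sum]
    rw [smul_smul, ← zpow_add₀ (sigma_det_ne_zero σ g), ← sub_eq_add_neg,
      ← sigma_det_zpow_congr σ g hb, map_mul, polyAct, aeval_X, Finset.sum_mul]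
    simp only [smul_eq_C_mul, mul_assoc]

/-- The partial derivatives `∂_{j+1,1}` and `-∂_{j+1,0}` transform like the variables in position
`j + 1`, up to a determinant. -/
lemma slotMul_pderiv [NeZero f] (hk : Fintype.card k = p ^ f) (j : Fin f) (r' : Fin f → ℕ)
    {b₀ b' : ℤ} (hb : b' ≡ b₀ - (if j + 1 = 0 then 1 else 0) + p ^ ((j + 1 : Fin f) : ℕ)
      [ZMOD (Fintype.card k : ℤ) + 1]) :
    SlotMul (k := k) p σ j (r' + Pi.single (j + 1) 1) r' b₀ b'
      ![(pderiv (j + 1, 1)).toLinearMap, -(pderiv (j + 1, 0)).toLinearMap] where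
  mem i P hP := by
    have h : ∀ a, pderiv (j + 1, a) P ∈ polySpace F r' := fun a => hP.pderiv rfl
    fin_cases i
    · exact h 1
    · exact neg_mem (h 0)
  equiv g i P _ := by
    simp only [twistEmb_pow σ hk, mul_smul, ← Finset.smul_sum]
    rw [smul_smul, ← zpow_add₀ (sigma_det_ne_zero σ g), ← sub_eq_add_neg,
      sigma_det_zpow_congr σ g hb, zpow_add₀ (sigma_det_ne_zero σ g), mul_smul]
    congr 1
    have hd : σ (g.1 : Matrix (Fin 2) (Fin 2) l).det ^ ((p : ℤ) ^ ((j + 1 : Fin f) : ℕ)) =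
        twistEmb p σ (j + 1) (g.1 : Matrix (Fin 2) (Fin 2) l).det := by
      rw [twistEmb_apply, ← zpow_natCast]; push_cast; rfl
    rw [hd, Matrix.det_fin_two]
    fin_cases i
    · simp [Fin.sum_univ_two, pderiv_polyAct, smul_eq_C_mul]
      ring
    · simp [Fin.sum_univ_two, pderiv_polyAct, smul_eq_C_mul]
      ring

end SlotCocycle

end

/-! ### The extension does not split -/

section

open MvPolynomial

section NonSplit

variable {k : Type v} {l F : Type u} [Field k] [Fintype k] [Field l] [Algebra k l] [Field F]
  {f : ℕ} {V W : Type*} [AddCommGroup V] [Module F V] [AddCommGroup W] [Module F W]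
  {p : ℕ} {hl : Module.finrank k l = 2} {σ : l →+* F}
  {ρ : Representation F (U11 k l) V} {τ : Representation F (U11 k l) W}
  {r r' : Fin f → ℕ} {b b' : ℤ}

/-- If the form takes the values `κ + C y^n` on the upper unipotent translates of a vector, then `n`
has digits bounded by `r`. -/
lemma HighestWeightData.digits_of_form_upper (D : HighestWeightData p hl σ ρ r b) (hp : 0 < p)
    (hk : Fintype.card k = p ^ f) (hr : ∀ j, r j < p) {v : V} {n : ℕ} {κ C : F} (hC : C ≠ 0)
    (hn : n ≠ 0) (hn' : n < p ^ f)
    (h : ∀ y, D.form (ρ (upper y) v) = κ + C * evk k σ y ^ n) :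
    ∃ d : Fin f → ℕ, (∀ j, d j ≤ r j) ∧ n = digitSum p d := by
  have hpoly : D.poly v = Polynomial.C κ + Polynomial.C C * Polynomial.X ^ n := by
    refine eq_of_eval_eq (k := k) σ ?_ ?_ fun y => ?_
    · rw [hk]; exact D.natDegree_poly_lt hr hp v
    · rw [hk]
      refine (Polynomial.natDegree_add_le _ _).trans_lt ?_
      rw [Polynomial.natDegree_C, max_eq_right (Nat.zero_le _)]
      exact (Polynomial.natDegree_C_mul_X_pow_le _ _).trans_lt hn'
    · rw [D.eval_poly, h]
      simp
  refine D.coeff_poly_ne_zero (v := v) ?_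
  rw [hpoly]
  simpa [Polynomial.coeff_C, hn] using hC

/-- A digit condition satisfied by coboundaries whose value on the upper unipotent group is a
monomial. -/
lemma digits_of_coboundary_upper {c : U11 k l → V →ₗ[F] W} (DV : HighestWeightData p hl σ ρ r b)
    (DW : HighestWeightData p hl σ τ r' b') (hp : 0 < p) (hk : Fintype.card k = p ^ f)
    (hr' : ∀ j, r' j < p) (hc : c ∈ extCoboundaries ρ τ) {n : ℕ} {C : F} (hC : C ≠ 0)
    (hn : n ≠ 0) (hn' : n < p ^ f)
    (h : ∀ y, DW.form (c (upper y) DV.vec) = C * evk k σ y ^ n) :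
    ∃ d : Fin f → ℕ, (∀ j, d j ≤ r' j) ∧ n = digitSum p d := by
  obtain ⟨φ, hφ⟩ := mem_extCoboundaries.1 hc
  refine DW.digits_of_form_upper hp hk hr' (v := φ DV.vec) (κ := DW.form (φ DV.vec)) hC hn hn'
    fun y => ?_
  rw [← h, hφ, DV.upper_vec, map_sub]
  ring

/-- A digit condition satisfied by coboundaries whose value on the lower unipotent group is a
monomial. -/
lemma digits_of_coboundary_lower {c : U11 k l → V →ₗ[F] W} (DV : HighestWeightData p hl σ ρ r b)
    (DW : HighestWeightData p hl σ τ r' b') (hp : 0 < p) (hk : Fintype.card k = p ^ f)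
    (hr : ∀ j, r j < p) (hc : c ∈ extCoboundaries ρ τ) {n : ℕ} {C : F} (hC : C ≠ 0)
    (hn : n ≠ 0) (hn' : n < p ^ f)
    (h : ∀ y, DW.form (c (lower y) DV.vec) = C * evk k σ y ^ n) :
    ∃ d : Fin f → ℕ, (∀ j, d j ≤ r j) ∧ n = digitSum p d := by
  obtain ⟨φ, hφ⟩ := mem_extCoboundaries.1 hc
  refine DV.dual.digits_of_form_upper hp hk hr (v := DW.form ∘ₗ φ) (κ := DW.form (φ DV.vec))
    (neg_ne_zero.2 hC) hn hn' fun y => ?_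
  have h1 := h y
  rw [hφ, map_sub, DW.form_lower] at h1
  rw [DV.dual_form, transpDual_apply, transp_upper, LinearMap.comp_apply]
  linear_combination -h1

end NonSplit

section SlotNonSplit

variable {f : ℕ} {F : Type u} [Field F] {p : ℕ} {j : Fin f} {s : ℕ} {r : Fin f → ℕ}

lemma evalHighest_monomial (m : Fin f × Fin 2 →₀ ℕ) :
    evalHighest (monomial m (1 : F)) = if ∀ i, m (i, 1) = 0 then 1 else 0 := by
  rw [evalHighest, aeval_monomial_pair]
  simp only [map_one, one_mul, if_true, one_pow, one_ne_zero, if_false]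
  by_cases h : ∀ i, m (i, 1) = 0
  · rw [if_pos h]
    exact Finset.prod_eq_one fun i _ => by simp [h]
  · rw [if_neg h]
    push Not at h
    obtain ⟨i, hi⟩ := h
    exact Finset.prod_eq_zero (Finset.mem_univ i) (by simp [hi])

lemma evalHighest_slotQuot_zero {P : MvPolynomial (Fin f × Fin 2) F}
    (hP : P ∈ polySpace F (Function.update r j (p + s))) :
    evalHighest (slotQuot F j p 0 P) = evalHighest P := by
  refine polySpace_ext (L := evalHighest.toLinearMap ∘ₗ slotQuot F j p 0)
    (L' := evalHighest.toLinearMap) (fun m hm => ?_) hP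
  have hmj := hm j
  rw [Function.update_self] at hmj
  rw [LinearMap.comp_apply, AlgHom.toLinearMap_apply, AlgHom.toLinearMap_apply, slotQuot,
    monomialMap_monomial]
  by_cases h : p ≤ m (j, 0)
  · rw [if_pos h, evalHighest_monomial, evalHighest_monomial]
    simp
  · rw [if_neg h, map_zero, evalHighest_monomial, if_neg]
    intro h1
    have := h1 j
    omega

lemma evalHighest_slotQuot_one (P : MvPolynomial (Fin f × Fin 2) F) :
    evalHighest (slotQuot F j p 1 P) = slotForm j p P := by
  refine LinearMap.congr_fun (f := evalHighest.toLinearMap ∘ₗ slotQuot F j p 1)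
    (g := slotForm j p) ((basisMonomials _ F).ext fun m => ?_) P
  rw [coe_basisMonomials, LinearMap.comp_apply, AlgHom.toLinearMap_apply, slotQuot,
    monomialMap_monomial]
  have h1 : slotForm j p (monomial m (1 : F)) =
      if (∀ i, i ≠ j → m (i, 1) = 0) ∧ m (j, 1) = p then 1 else 0 := by
    rw [slotForm, LinearMap.comp_apply, AlgHom.toLinearMap_apply, aeval_monomial_pair, map_one,
      one_mul, ← Finset.prod_erase_mul _ _ (Finset.mem_univ j)]
    simp only [one_ne_zero, if_true, if_false, one_pow, one_mul, Polynomial.lcoeff_apply]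
    by_cases h : ∀ i, i ≠ j → m (i, 1) = 0
    · rw [Finset.prod_eq_one fun i hi => by simp [h i (Finset.ne_of_mem_erase hi)], one_mul,
        Polynomial.coeff_X_pow]
      exact if_congr (by rw [and_iff_right h, eq_comm]) rfl rfl
    · rw [if_neg fun h' => h h'.1]
      push Not at h
      obtain ⟨i, hi, hi'⟩ := h
      rw [Finset.prod_eq_zero (Finset.mem_erase.2 ⟨hi, Finset.mem_univ i⟩), zero_mul,
        Polynomial.coeff_zero]
      simp [hi, hi']
  rw [h1]
  split_ifs with h2 h3 h3
  · rw [evalHighest_monomial, if_pos]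
    intro i
    by_cases h : i = j
    · subst h; simp [h3.2]
    · simp [h3.1 i h]
  · rw [evalHighest_monomial, if_neg]
    refine fun h => h3 ⟨fun i hi => ?_, ?_⟩
    · simpa [Finsupp.single_apply, hi.symm] using h i
    · have := h j
      simp at this
      omega
  · omega
  · rw [map_zero]

/-- Euler's formula at the highest weight monomial. -/
lemma evalHighest_pderiv_zero (i : Fin f) {P : MvPolynomial (Fin f × Fin 2) F}
    (hP : P ∈ polySpace F r) :
    evalHighest (pderiv (i, 0) P) = r i * evalHighest P := by
  refine polySpace_ext (L := evalHighest.toLinearMap ∘ₗ (pderiv (i, 0)).toLinearMap)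
    (L' := (r i : F) • evalHighest.toLinearMap) (fun m hm => ?_) hP
  have hmi := hm i
  rw [LinearMap.comp_apply, LinearMap.smul_apply, AlgHom.toLinearMap_apply,
    AlgHom.toLinearMap_apply]
  change evalHighest (pderiv (i, 0) (monomial m 1)) = _
  rw [pderiv_monomial,
    one_mul, ← mul_one (m (i, 0) : F), ← smul_eq_mul, ← smul_monomial, map_smul,
    evalHighest_monomial, evalHighest_monomial, smul_eq_mul, smul_eq_mul]
  by_cases h : ∀ c, m (c, 1) = 0
  · have h' : ∀ c, (m - Finsupp.single (i, 0) 1 : Fin f × Fin 2 →₀ ℕ) (c, 1) = 0 := fun c => by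
      simp [h]
    rw [if_pos h, if_pos h', ← hmi, h, add_zero]
  · have h' : ¬ ∀ c, (m - Finsupp.single (i, 0) 1 : Fin f × Fin 2 →₀ ℕ) (c, 1) = 0 := by
      simpa using h
    rw [if_neg h, if_neg h', mul_zero, mul_zero]

lemma slotQuot_eq_zero_of_degreeOf_lt (i : Fin 2) {P : MvPolynomial (Fin f × Fin 2) F}
    (h : degreeOf (j, i) P < p) : slotQuot F j p i P = 0 := by
  rw [P.as_sum, map_sum]
  refine Finset.sum_eq_zero fun m hm => ?_
  have h1 : m (j, i) < p := (monomial_le_degreeOf (j, i) hm).trans_lt h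
  rw [← mul_one (coeff m P), ← smul_eq_mul, ← smul_monomial, map_smul, slotQuot,
    monomialMap_monomial, if_neg h1.not_ge, smul_zero]

/-- The exponent of the lift of the highest weight vector along `slotProj`. -/
lemma slotLift_polyVec : slotLift F j s (polyVec r : polySpace F r) =
    monomial (pairExp r 0 + slotExp j s) 1 := by
  rw [polyVec_coe, slotLift, monomialMap_monomial]
  simp

variable {k : Type v} {l : Type u} [Field k] [Fintype k] [Field l] [Algebra k l]
variable [ExpChar l p] {σ : l →+* F}

lemma polyForm_apply (P : polySpace F r) : polyForm r P = evalHighest P.1 := rfl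

omit [Fintype k] in
lemma twistEmb_algebraMap (i : Fin f) (y : k) :
    twistEmb p σ i (algebraMap k l y) = evk k σ y ^ p ^ (i : ℕ) := by
  rw [twistEmb_apply]; rfl

/-- The cocycle obtained by multiplication with the variables in position `j + 1`, evaluated
between highest weight vectors. -/
lemma polyForm_slotCocycle_X [NeZero f] (hs : r j + s + 2 = p) {r' : Fin f → ℕ} {b₀ b' : ℤ}
    (hμ : SlotMul (k := k) p σ j (Function.update r j s) r' b₀ b'
      fun i => LinearMap.mulLeft F (X (j + 1, i)))
    (g : U11 k l) :
    polyForm r' (slotCocycle hs hμ g (polyVec r)) =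
    σ (g.1 : Matrix (Fin 2) (Fin 2) l).det ^ b₀ *
      ((∏ i, twistEmb p σ i (g.1 0 0) ^ (pairExp r 0 + slotExp j s) (i, 0)) *
        twistEmb p σ j (g.1 0 1) ^ (s + 1)) := by
  rw [polyForm_apply, slotCocycle_coe, Fin.sum_univ_two, map_add, LinearMap.mulLeft_apply,
    LinearMap.mulLeft_apply,
    map_mul, map_mul, evalHighest_slotQuot_zero (r := r) (Subtype.prop _), polyRep_coe]
  simp only [slotLift_polyVec]
  rw [map_smul, evalHighest_polyAct_monomial, Finset.prod_mul_distrib,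
    Finset.prod_eq_single_of_mem (f := fun i => twistEmb p σ i (g.1 0 1) ^ _) j (Finset.mem_univ j)
    (fun i _ hi => by simp [slotExp_of_ne s hi])]
  simp [evalHighest, slotExp_self]

/-- The cocycle obtained by differentiation in position `j + 1`, evaluated between highest weight
vectors on the lower unipotent group. -/
lemma polyForm_slotCocycle_pderiv [NeZero f]
    (hs : r j + s + 2 = p) {r' : Fin f → ℕ} (hr' : r' + Pi.single (j + 1) 1 = Function.update r j s)
    {b₀ b' : ℤ} (hμ : SlotMul (k := k) p σ j (Function.update r j s) r' b₀ b'
      ![(pderiv (j + 1, 1)).toLinearMap, -(pderiv (j + 1, 0)).toLinearMap]) (y : k) :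
    polyForm _ (slotCocycle hs hμ (lower y) (polyVec r)) =
      -((r' (j + 1) + 1 : ℕ) * (r j + (s + 1)).choose (r j + 1)) *
        evk k σ y ^ ((r j + 1) * p ^ (j : ℕ)) := by
  have hQ : ∀ i, slotQuot F j p i _ ∈ polySpace F (Function.update r j s) := fun i =>
    slotQuot_mem i (Subtype.prop (polyRep (k := k) p σ (Function.update r j (p + s)) b₀ (lower y)
      ⟨slotLift F j s (polyVec r : polySpace F r), slotLift_mem hs (Subtype.prop _)⟩))
  rw [polyForm_apply, slotCocycle_coe, Fin.sum_univ_two]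
  change evalHighest (pderiv (j + 1, 1) _ + -pderiv (j + 1, 0) _) = _
  have h0 : slotQuot F j p 0 (polyRep (k := k) p σ (Function.update r j (p + s)) b₀ (lower y)
      ⟨slotLift F j s (polyVec r : polySpace F r), slotLift_mem hs (Subtype.prop _)⟩) = 0 := by
    refine slotQuot_eq_zero_of_degreeOf_lt 0 ?_
    rw [polyRep_coe, det_lower, map_one, one_zpow, one_smul, lower_val]
    simp only [slotLift_polyVec]
    rw [polyAct_monomial, ← Finset.prod_erase_mul _ _ (Finset.mem_univ j)]
    have hX : ∀ (i : Fin f) (x y : F), degreeOf (j, (0 : Fin 2))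
        (C x * X (i, 0) + C y * X (i, 1) : MvPolynomial (Fin f × Fin 2) F) ≤
          if i = j then 1 else 0 := fun i x y => by
      refine (degreeOf_add_le _ _ _).trans (max_le ?_ ?_)
      · refine (degreeOf_C_mul_le _ _ _).trans ?_
        rw [degreeOf_X]
        simp [eq_comm]
      · refine (degreeOf_C_mul_le _ _ _).trans ?_
        rw [degreeOf_X]
        simp
    have hX1 : ∀ y : F, degreeOf (j, (0 : Fin 2))
        (C 0 * X (j, 0) + C y * X (j, 1) : MvPolynomial (Fin f × Fin 2) F) = 0 := fun y => by
      rw [C_0, zero_mul, zero_add]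
      refine Nat.le_zero.1 ((degreeOf_C_mul_le _ _ _).trans ?_)
      rw [degreeOf_X]
      simp
    have hpow : ∀ (n : ℕ) (P : MvPolynomial (Fin f × Fin 2) F) (e : ℕ),
        degreeOf (j, (0 : Fin 2)) P ≤ e → degreeOf (j, (0 : Fin 2)) (P ^ n) ≤ n * e :=
      fun n P e h => (degreeOf_pow_le _ _ _).trans (Nat.mul_le_mul_left _ h)
    refine (degreeOf_mul_le _ _ _).trans_lt ?_
    refine (Nat.add_le_add (b := 0) (d := (r j + (s + 1)) * 1) ?_ ?_).trans_lt (by omega)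
    · refine (degreeOf_prod_le _ _ _).trans (Finset.sum_nonpos fun i hi => ?_)
      have hij := Finset.ne_of_mem_erase hi
      refine (degreeOf_mul_le _ _ _).trans (Nat.add_le_add (b := 0) (d := 0) ?_ ?_)
      · exact (hpow _ _ 0 ((hX _ _ _).trans (by rw [if_neg hij]))).trans (by simp)
      · exact (hpow _ _ 0 ((hX _ _ _).trans (by rw [if_neg hij]))).trans (by simp)
    · refine (degreeOf_mul_le _ _ _).trans
        (Nat.add_le_add (b := (r j + (s + 1)) * 1) (d := 0) ?_ ?_)
      · refine (hpow _ _ 1 ((hX _ _ _).trans (by rw [if_pos rfl]))).trans ?_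
        rw [Finsupp.add_apply, slotExp_self, pairExp_zero]
      · refine (hpow _ _ 0 ?_).trans (by simp)
        simpa using (hX1 1).le
  rw [h0, map_zero, zero_add, map_neg, evalHighest_pderiv_zero _ (hQ 1), evalHighest_slotQuot_one,
    polyRep_coe, det_lower, map_one, one_zpow, one_smul, lower_val]
  simp only [slotLift_polyVec]
  rw [slotForm_polyAct_monomial, ← hr', Finset.prod_eq_one fun i hi => by
    simp [slotExp_of_ne s (Finset.ne_of_mem_erase hi)]]
  have hp : p = r j + 1 + (s + 1) := by omega
  have h1 : ∀ P : Polynomial F, (P * Polynomial.X ^ (s + 1)).coeff p = P.coeff (r j + 1) :=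
    fun P => by rw [hp, Polynomial.coeff_mul_X_pow]
  simp only [Finsupp.add_apply, slotExp_self, pairExp_zero, pairExp_one, Pi.zero_apply, zero_add,
    Matrix.of_apply, Matrix.cons_val', Matrix.cons_val_zero, Matrix.cons_val_one,
    Matrix.cons_val_fin_one, one_mul, map_zero]
  rw [map_one (twistEmb p σ j), Polynomial.C_1, one_mul, ← Polynomial.C_1, h1,
    coeff_C_add_C_mul_X_pow, one_pow, one_mul, twistEmb_algebraMap, ← pow_mul,
    mul_comm (p ^ _), Pi.add_apply, Pi.single_eq_same]
  ring

lemma digitSum_ne_of_lt {p : ℕ} {j : Fin f} {a : ℕ} (ha : a < p) {r : Fin f → ℕ} (hr : ∀ i, r i < p)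
    (h : r j < a) : ¬ ∃ d : Fin f → ℕ, (∀ i, d i ≤ r i) ∧ a * p ^ (j : ℕ) = digitSum p d := by
  rintro ⟨d, hd, h1⟩
  rw [← digitSum_single] at h1
  have h2 := congrFun (digitSum_injective (fun i => ?_) (fun i => (hd i).trans_lt (hr i)) h1) j
  · rw [Pi.single_eq_same] at h2
    have := hd j
    omega
  · by_cases hi : i = j
    · subst hi; simpa using ha
    · simp [hi]; omega

lemma mul_pow_val_lt {p : ℕ} (j : Fin f) {a : ℕ} (ha : a < p) : a * p ^ (j : ℕ) < p ^ f := by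
  rw [← digitSum_single]
  refine digitSum_lt _ fun i => ?_
  by_cases hi : i = j
  · subst hi; simpa using ha
  · simp [hi]; omega

/-- The extension obtained by differentiation does not split: its value on the lower unipotent group
is a monomial whose exponent is not one of those of a coboundary. -/
lemma slotCocycle_pderiv_not_mem [NeZero f] [CharP F p] (hp : p.Prime)
    (hl : Module.finrank k l = 2) (hk : Fintype.card k = p ^ f) (hs : r j + s + 2 = p)
    {r' : Fin f → ℕ} (hr : ∀ i, r i < p) (hr'' : ∀ i, r' i + 1 < p)
    (hr' : r' + Pi.single (j + 1) 1 = Function.update r j s) {b b₀ b' : ℤ}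
    (hμ : SlotMul (k := k) p σ j (Function.update r j s) r' b₀ b'
      ![(pderiv (j + 1, 1)).toLinearMap, -(pderiv (j + 1, 0)).toLinearMap]) :
    slotCocycle hs hμ ∉ extCoboundaries (polyRep p σ r b) (polyRep p σ r' b') := by
  intro hc
  refine digitSum_ne_of_lt (j := j) (a := r j + 1) (by omega) hr (Nat.lt_succ_self _)
    (digits_of_coboundary_lower (polyData p σ hp hl r b hr)
      (polyData p σ hp hl r' b' fun i => (Nat.lt_succ_self _).trans (hr'' i)) hp.pos hk hr hc
      (C := -((r' (j + 1) + 1 : ℕ) * (r j + (s + 1)).choose (r j + 1))) ?_ ?_ ?_ fun y => ?_)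
  · refine neg_ne_zero.2 (mul_ne_zero ?_ (cast_choose_ne_zero hp (by omega) (by omega)))
    rw [Ne, CharP.cast_eq_zero_iff F p]
    exact Nat.not_dvd_of_pos_of_lt (Nat.succ_pos _) (hr'' _)
  · exact mul_ne_zero (by omega) (pow_ne_zero _ hp.ne_zero)
  · exact mul_pow_val_lt j (by omega)
  · exact polyForm_slotCocycle_pderiv hs hr' hμ y

/-- The extension obtained by multiplication does not split. For `f ≠ 1` its value on the upper
unipotent group is a monomial whose exponent is not one of those of a coboundary. -/
lemma slotCocycle_X_not_mem [NeZero f] [CharP F p] (hp : p.Prime)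
    (hl : Module.finrank k l = 2) (hk : Fintype.card k = p ^ f) (hs : r j + s + 2 = p)
    {r' : Fin f → ℕ} (hr : ∀ i, r i < p) (hr'' : ∀ i, r' i + 1 < p)
    (hr' : r' = Function.update r j s + Pi.single (j + 1) 1) {b b₀ b' : ℤ}
    (hμ : SlotMul (k := k) p σ j (Function.update r j s) r' b₀ b'
      fun i => LinearMap.mulLeft F (X (j + 1, i))) :
    slotCocycle hs hμ ∉ extCoboundaries (polyRep p σ r b) (polyRep p σ r' b') := by
  intro hc
  have hr1 : ∀ i, r' i < p := fun i => (Nat.lt_succ_self _).trans (hr'' i)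
  set DV := polyData (k := k) p σ hp hl r b hr
  set DW := polyData (k := k) p σ hp hl r' b' hr1
  have hu : ∀ y, DW.form (slotCocycle hs hμ (upper y) DV.vec) =
      1 * evk k σ y ^ ((s + 1) * p ^ (j : ℕ)) := fun y => by
    refine (polyForm_slotCocycle_X hs hμ (upper y)).trans ?_
    rw [det_upper, map_one, one_zpow, upper_val]
    simp [twistEmb_algebraMap, ← pow_mul, mul_comm]
  by_cases hj : j + 1 = j
  · -- here `f = 1`, and the coboundary is excluded by its value at the Weyl element
    have hsub : ∀ i, i = j := by
      have h1 := Fin.val_add_one_eq_ite j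
      rw [hj] at h1
      have h2 : f = 1 := by
        have := j.2
        split_ifs at h1 <;> omega
      intro i
      have := i.2
      exact Fin.ext (by omega)
    have hr's : r' = Pi.single j (s + 1) := funext fun i => by
      rw [hr', hsub i, Pi.add_apply, Function.update_self, hj, Pi.single_eq_same,
        Pi.single_eq_same]
    have hs' : s + 2 < p := by
      have := hr'' j
      rw [hr's, Pi.single_eq_same] at this
      omega
    obtain ⟨φ, hφ⟩ := mem_extCoboundaries.1 hc
    set κ := DW.form (φ DV.vec) with hκ
    -- `φ` sends the highest weight vector to the sum of the lowest weight monomial and `κ` times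
    -- the highest weight vector
    set low : polySpace F r' := ⟨monomial (pairExp 0 r') 1, monomial_mem_polySpace (by simp) 1⟩
      with hlow
    have hlow_form : ∀ g : U11 k l, DW.form (polyRep p σ r' b' g low) = _ := fun g =>
      polyForm_polyRep_monomial p σ r' b' g (m := pairExp 0 r') (by simp)
    have hφv : φ DV.vec = low + κ • DW.vec := by
      refine DW.eq_of_form_upper hk hr1 hp.pos fun y => ?_
      have h1 := hu y
      rw [hφ, DV.upper_vec, map_sub, ← hκ] at h1
      rw [map_add, map_add, map_smul, map_smul, DW.upper_vec, DW.form_vec, hlow_form, det_upper,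
        upper_val]
      simp only [pairExp_zero, pairExp_one, Pi.zero_apply, pow_zero, one_mul, map_one, one_zpow,
        Matrix.of_apply, Matrix.cons_val', Matrix.cons_val_zero, Matrix.cons_val_one,
        Matrix.cons_val_fin_one, prod_twistEmb_pow, smul_eq_mul, mul_one]
      have h2 : digitSum p r' = (s + 1) * p ^ (j : ℕ) := by rw [hr's, digitSum_single]
      rw [h2]
      change _ = evk k σ y ^ _ + κ
      linear_combination h1
    have hφf : DW.form ∘ₗ φ = κ • DV.form := by
      refine DV.eq_of_lower_vec hk hr hp.pos fun y => ?_
      have h1 : DW.form (slotCocycle hs hμ (lower y) DV.vec) = 0 := by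
        refine (polyForm_slotCocycle_X hs hμ (lower y)).trans ?_
        rw [lower_val]
        simp
      rw [hφ, map_sub, DW.form_lower, ← hκ, sub_eq_zero] at h1
      rw [LinearMap.comp_apply, ← h1, LinearMap.smul_apply, DV.form_lower, DV.form_vec, smul_eq_mul,
        mul_one]
    have hw : DW.form (slotCocycle hs hμ (weylElt k l) DV.vec) = 0 := by
      refine (polyForm_slotCocycle_X hs hμ (weylElt k l)).trans ?_
      rw [Finset.prod_eq_zero (Finset.mem_univ j)]
      · simp
      · rw [weylElt_val]
        simp [slotExp_self]
    have hw1 : ∀ {r : Fin f → ℕ}, r j ≠ 0 → digitSum p r ≠ 0 := fun {r} h h0 =>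
      h (by simpa [hp.ne_zero] using (Finset.sum_eq_zero_iff.1 h0) j (Finset.mem_univ j))
    have hV : DV.form (polyRep p σ r b (weylElt k l) DV.vec) = 0 := by
      rw [DV.coeff, weylElt_val]
      simp [hw1 (r := r) (by omega)]
    have hW : DW.form (polyRep p σ r' b' (weylElt k l) DW.vec) = 0 := by
      rw [DW.coeff, weylElt_val]
      simp [hw1 (r := r') (by simp [hr's])]
    rw [hφ, hφv, map_sub, map_add, map_add, map_smul, map_smul, hW, hlow_form,
      ← LinearMap.comp_apply, hφf, LinearMap.smul_apply, hV, det_weylElt, weylElt_val] at hw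
    simp at hw
  · refine digitSum_ne_of_lt (j := j) (a := s + 1) (by omega) hr1 ?_
      (digits_of_coboundary_upper DV DW hp.pos hk hr1 hc one_ne_zero ?_ ?_ hu)
    · rw [hr', Pi.add_apply, Function.update_self, Pi.single_eq_of_ne (Ne.symm hj)]
      omega
    · exact mul_ne_zero (by omega) (pow_ne_zero _ hp.ne_zero)
    · exact mul_pow_val_lt j (by omega)

end SlotNonSplit

end

/-! ### The map `t_μ` in coordinates -/

section CharacterExponent

/-- The exponent of the restriction of the character `(a,b,c,d)` to the torus of elements
`diag(t, t^{-q})`, normalized by the character `t ↦ t^{q+1}` of the third coordinate. -/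
def charExpH (q : ℤ) : CharH ℤ →ₗ[ℤ] ℤ :=
  (relH ℤ).liftQ
    { toFun := fun x => x.1 - q * x.2.1 + (q + 1) * x.2.2.1
      map_add' := fun x y => by simp only [Prod.fst_add, Prod.snd_add]; ring
      map_smul' := fun r x => by
        simp only [Prod.smul_fst, Prod.smul_snd, smul_eq_mul, RingHom.id_apply]; ring }
    (relH_le_ker _ (by simp; ring))

lemma charExpH_mkH (q a b c d : ℤ) : charExpH q (mkH a b c d) = a - q * b + (q + 1) * c := rfl

lemma pairH_frobH (x : CharH ℤ) : pairH (frobH x) = pairH x := by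
  obtain ⟨a, b, c, d, rfl⟩ := exists_mkH x
  change -b - -a + c - d = a - b + c - d
  ring

lemma charExpH_frobH (q : ℤ) (x : CharH ℤ) :
    charExpH q (frobH x) ≡ q * charExpH q x [ZMOD q ^ 2 - 1] := by
  obtain ⟨a, b, c, d, rfl⟩ := exists_mkH x
  change -b - q * -a + (q + 1) * c ≡ q * (a - q * b + (q + 1) * c) [ZMOD q ^ 2 - 1]
  exact Int.modEq_iff_dvd.2 ⟨c - b, by ring⟩

variable {f : ℕ}

/-- The exponent of the restriction of a character to the torus of `U_{1,1}(k)`. -/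
def charExp (p : ℕ) (q : ℤ) : XT f →ₗ[ℤ] ℤ :=
  ∑ j : Fin f, (p : ℤ) ^ (j : ℕ) • (charExpH q ∘ₗ LinearMap.proj j)

lemma charExp_apply (p : ℕ) (q : ℤ) (x : XT f) :
    charExp p q x = ∑ j : Fin f, (p : ℤ) ^ (j : ℕ) * charExpH q (x j) := by
  simp [charExp, LinearMap.sum_apply]

variable [NeZero f]

lemma frobX_apply_add_one (x : XT f) (j : Fin f) :
    frobX x (j + 1) = if (j : ℕ) + 1 = f then frobH (x j) else x j := by
  change (if j + 1 = 0 then frobH (x (j + 1 - 1)) else x (j + 1 - 1)) = _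
  rw [add_sub_cancel_right]
  simp only [Fin.add_one_eq_zero_iff_val]

/-- Passing from `p λ` to `π(λ)` does not change the restriction to the torus of `U_{1,1}(k)`. -/
lemma charExp_frobX (p : ℕ) (x : XT f) :
    charExp p (p ^ f : ℕ) (frobX x) ≡ p * charExp p (p ^ f : ℕ) x
      [ZMOD ((p ^ f : ℕ) : ℤ) ^ 2 - 1] := by
  rw [charExp_apply, charExp_apply, Finset.mul_sum, ← Equiv.sum_comp (Equiv.addRight (1 : Fin f))]
  refine Int.ModEq.sum fun j _ => ?_
  rw [Equiv.coe_addRight, frobX_apply_add_one, Fin.val_add_one_eq_ite]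
  split_ifs with h
  · rw [pow_zero, one_mul, ← mul_assoc, ← pow_succ', h]
    have := charExpH_frobH ((p ^ f : ℕ) : ℤ) (x j)
    push_cast at this ⊢
    exact this
  · rw [pow_succ' (p : ℤ), mul_assoc]

lemma mem_pSubPiX0_iff {p : ℕ} {x : XT f} : x ∈ pSubPiX0 p ↔
    ∃ y ∈ X0 (f := f), p • y - frobX y = x := by
  rfl

lemma pairH_eq_zero_of_mem_pSubPiX0 {p : ℕ} {x : XT f} (hx : x ∈ pSubPiX0 p) (j : Fin f) :
    pairH (x j) = 0 := by
  obtain ⟨y, hy, rfl⟩ := mem_pSubPiX0_iff.1 hx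
  have hy' : ∀ j, pairH (y j) = 0 := hy
  obtain ⟨i, rfl⟩ : ∃ i, j = i + 1 := ⟨j - 1, by simp⟩
  rw [Pi.sub_apply, Pi.smul_apply, map_sub, map_nsmul, hy', frobX_apply_add_one]
  split_ifs <;> simp [pairH_frobH, hy']

lemma charExp_modEq_zero_of_mem_pSubPiX0 {p : ℕ} {x : XT f} (hx : x ∈ pSubPiX0 p) :
    charExp p (p ^ f : ℕ) x ≡ 0 [ZMOD ((p ^ f : ℕ) : ℤ) ^ 2 - 1] := by
  obtain ⟨y, -, rfl⟩ := mem_pSubPiX0_iff.1 hx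
  rw [map_sub, map_nsmul, nsmul_eq_mul]
  have h := (charExp_frobX p y).symm.sub (Int.ModEq.refl (charExp p (p ^ f : ℕ) (frobX y)))
  rwa [sub_self] at h

end CharacterExponent

section GraphCoordinates

variable {f : ℕ} [NeZero f]

/-- The pairings of `t_μ(ω)` with the coroots, in terms of the pairings `μ_j` and `w_j` of `μ` and
`ω`. -/
def graphDigit (p : ℕ) (μ w : Fin f → ℤ) (j : Fin f) : ℤ :=
  if Even (w (j + 1)) then μ j + w j else p - 2 - (μ j + w j)

/-- The restriction of `t_μ(ω)` to the torus of `U_{1,1}(k)` differs from that of `μ` by this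
power of `t ↦ t^{q+1}`. -/
def graphShift (p : ℕ) (μ w : Fin f → ℤ) : ℤ :=
  ∑ j : Fin f, (p : ℤ) ^ (j : ℕ) *
    (p * ((w (j + 1) + 1) / 2) - if Even (w (j + 1)) then 0 else μ j + w j + 1)

/-- The pairings of a character of `T_U` with the coroots. -/
def pairU (lam : XU f) (j : Fin f) : ℤ := (lam j).1 - (lam j).2

omit [NeZero f] in
lemma pairH_inclU (lam : XU f) (j : Fin f) : pairH (inclU lam j) = pairU lam j := by
  change (lam j).1 - (lam j).2 + 0 - 0 = pairU lam j
  rw [pairU]; ring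

variable {p : ℕ} [Fact p.Prime]

lemma mem_affWeyl_spec {om : XT f} {w : ExtAffWeyl f} (h : w ∈ OmegaCoset p om) (j : Fin f) :
    ((w.right j = 1 ∧ pairH (w.left.toAdd j) = 0) ∨
        (w.right j = -1 ∧ pairH (w.left.toAdd j) = 1)) ∧
      ∃ m : ℤ, w.left.toAdd j = -(frobX.symm om) j + m • alphaH := by
  refine ⟨(mem_Omega (Fact.out (p := p.Prime)).pos w).1 h.1 j, ?_⟩
  obtain ⟨v, hv, rfl⟩ := h.2
  obtain ⟨m, hm⟩ := mem_LambdaRt.1 hv j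
  refine ⟨m, ?_⟩
  rw [← hm]
  simp [transl]

lemma frobX_symm_apply (x : XT f) (j : Fin f) :
    frobX.symm x j = if j + 1 = 0 then frobH (x (j + 1)) else x (j + 1) := rfl

lemma pairH_frobX_symm (om : XU f) (j : Fin f) :
    pairH (frobX.symm (inclU om) j) = pairU om (j + 1) := by
  rw [frobX_symm_apply, ← pairH_inclU]
  split_ifs <;> simp [pairH_frobH]

/-- An explicit form of `w̃`. -/
lemma wTilde_spec (om : XU f) (j : Fin f) :
    (wTilde p (inclU om)).left.toAdd j =
      -(frobX.symm (inclU om)) j + ((pairU om (j + 1) + 1) / 2) • alphaH ∧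
    (wTilde p (inclU om)).right j = if Even (pairU om (j + 1)) then 1 else -1 := by
  have h := (existsUnique_mem_OmegaCoset (Fact.out (p := p.Prime)).pos (inclU om)).choose_spec.1
  obtain ⟨h1, m, hm⟩ := mem_affWeyl_spec h j
  change (wTilde p (inclU om)).left.toAdd j = _ at hm
  change (((wTilde p (inclU om)).right j = 1 ∧ pairH ((wTilde p (inclU om)).left.toAdd j) = 0) ∨
        ((wTilde p (inclU om)).right j = -1 ∧ pairH ((wTilde p (inclU om)).left.toAdd j) = 1)) at h1
  rw [hm, map_add, map_neg, map_smul, pairH_alphaH, smul_eq_mul, pairH_frobX_symm] at h1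
  rcases h1 with ⟨h2, h3⟩ | ⟨h2, h3⟩
  · have h4 : Even (pairU om (j + 1)) := ⟨m, by omega⟩
    rw [if_pos h4]
    refine ⟨?_, h2⟩
    rw [hm, show (pairU om (j + 1) + 1) / 2 = m by omega]
  · have h4 : ¬ Even (pairU om (j + 1)) := by
      rw [Int.not_even_iff_odd]; exact ⟨m - 1, by omega⟩
    rw [if_neg h4]
    refine ⟨?_, h2⟩
    rw [hm, show (pairU om (j + 1) + 1) / 2 = m by omega]

/-- The representative of `t_μ(ω)` given by the dot action. -/
lemma dot_wTilde (mu om : XU f) (j : Fin f) :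
    dot ℤ p (wTilde p (inclU om)) (inclU mu + inclU om) j =
      inclU mu j + inclU om j - p • frobX.symm (inclU om) j +
        (p * ((pairU om (j + 1) + 1) / 2) -
          if Even (pairU om (j + 1)) then 0 else pairU mu j + pairU om j + 1) • alphaH := by
  obtain ⟨h1, h2⟩ := wTilde_spec (p := p) om j
  rw [dot, weylAct, h1, h2, castH_int, Pi.add_apply, Pi.add_apply]
  split_ifs with h
  · rw [weylH_one, LinearMap.id_apply, sub_zero, smul_add, smul_neg, smul_smul,
      Nat.cast_smul_eq_nsmul]
    abel
  · rw [weylH_neg_one, reflH_apply, map_add, map_add, pairH_etaH, pairH_inclU, pairH_inclU,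
      smul_add,
      smul_neg, smul_smul, Nat.cast_smul_eq_nsmul, sub_smul]
    abel

lemma pairH_dot_wTilde (mu om : XU f) (j : Fin f) :
    pairH (dot ℤ p (wTilde p (inclU om)) (inclU mu + inclU om) j) =
      graphDigit p (pairU mu) (pairU om) j := by
  rw [dot_wTilde, map_add, map_sub, map_add, map_nsmul, pairH_frobX_symm, pairH_inclU, pairH_inclU,
    map_smul, pairH_alphaH, graphDigit, nsmul_eq_mul, smul_eq_mul]
  split_ifs with h
  · obtain ⟨c, hc⟩ := h
    rw [show (pairU om (j + 1) + 1) / 2 = c by omega, hc]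
    ring
  · obtain ⟨c, hc⟩ := Int.not_even_iff_odd.1 h
    rw [show (pairU om (j + 1) + 1) / 2 = c + 1 by omega, hc]
    ring

lemma charExp_dot_wTilde (mu om : XU f) :
    charExp p (p ^ f : ℕ) (dot ℤ p (wTilde p (inclU om)) (inclU mu + inclU om)) ≡
      charExp p (p ^ f : ℕ) (inclU mu) + ((p ^ f : ℕ) + 1) * graphShift p (pairU mu) (pairU om)
        [ZMOD ((p ^ f : ℕ) : ℤ) ^ 2 - 1] := by
  have h1 : dot ℤ p (wTilde p (inclU om)) (inclU mu + inclU om) =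
      inclU mu + inclU om - p • frobX.symm (inclU om) + fun j : Fin f =>
        (p * ((pairU om (j + 1) + 1) / 2) -
          if Even (pairU om (j + 1)) then 0 else pairU mu j + pairU om j + 1) • alphaH :=
    funext fun j => dot_wTilde mu om j
  have h2 : charExp p (p ^ f : ℕ) (fun j : Fin f => (p * ((pairU om (j + 1) + 1) / 2) -
          if Even (pairU om (j + 1)) then 0 else pairU mu j + pairU om j + 1) • alphaH) =
      ((p ^ f : ℕ) + 1) * graphShift p (pairU mu) (pairU om) := by
    rw [charExp_apply, graphShift, Finset.mul_sum]
    refine Finset.sum_congr rfl fun j _ => ?_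
    rw [map_smul, alphaH, charExpH_mkH, smul_eq_mul]
    ring
  have h3 := charExp_frobX p (frobX.symm (inclU om))
  rw [AddEquiv.apply_symm_apply] at h3
  rw [h1, map_add, map_sub, map_add, h2, map_nsmul, nsmul_eq_mul]
  refine Int.ModEq.add_right _ ?_
  have h4 := (h3.sub_right (p * charExp p (p ^ f : ℕ) (frobX.symm (inclU om)))).add_left
    (charExp p (p ^ f : ℕ) (inclU mu))
  rw [sub_self, add_zero, ← add_sub_assoc] at h4
  exact h4

lemma pairU_of_classU_eq {mu om lam : XU f} (h : classU p lam = tMu p mu (inclU om)) (j : Fin f) :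
    pairU lam j = graphDigit p (pairU mu) (pairU om) j := by
  have h1 := pairH_eq_zero_of_mem_pSubPiX0 (QuotientAddGroup.eq.1 h) j
  rw [Pi.add_apply, Pi.neg_apply, map_add, map_neg, pairH_inclU, pairH_dot_wTilde] at h1
  linarith

lemma charExp_of_classU_eq {mu om lam : XU f} (h : classU p lam = tMu p mu (inclU om)) :
    charExp p (p ^ f : ℕ) (inclU lam) ≡
      charExp p (p ^ f : ℕ) (inclU mu) + ((p ^ f : ℕ) + 1) * graphShift p (pairU mu) (pairU om)
        [ZMOD ((p ^ f : ℕ) : ℤ) ^ 2 - 1] := by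
  have h1 := charExp_modEq_zero_of_mem_pSubPiX0 (QuotientAddGroup.eq.1 h)
  rw [map_add, map_neg] at h1
  have h2 := h1.add_left (charExp p (p ^ f : ℕ) (inclU lam))
  rw [add_neg_cancel_left, add_zero] at h2
  exact h2.symm.trans (charExp_dot_wTilde mu om)

omit [NeZero f] in
lemma exists_inclU_eq (x : XT f) (h : ∀ j, ∃ a b, x j = mkH a b 0 0) : ∃ lam, inclU lam = x := by
  choose a b hab using h
  exact ⟨fun j => (a j, b j), funext fun j => (hab j).symm⟩

/-- The image of `t_μ` is represented by characters of `T_U`. -/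
lemma exists_classU_eq (mu om : XU f) : ∃ lam, classU p lam = tMu p mu (inclU om) := by
  have hadd : ∀ a b a' b' : ℤ, mkH a b 0 0 + mkH a' b' 0 0 = mkH (a + a') (b + b') 0 0 := by
    intro a b a' b'
    simp only [mkH, ← map_add, Prod.mk_add_mk, add_zero]
  have hsmul : ∀ c a b : ℤ, c • mkH a b 0 0 = mkH (c * a) (c * b) 0 0 := by
    intro c a b
    simp only [mkH, ← map_smul, Prod.smul_mk, smul_eq_mul, mul_zero]
  obtain ⟨lam, hlam⟩ := exists_inclU_eq
    (dot ℤ p (wTilde p (inclU om)) (inclU mu + inclU om)) fun j => by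
      have h1 : ∃ a b, frobX.symm (inclU om) j = mkH a b 0 0 := by
        rw [frobX_symm_apply]
        split_ifs
        · exact ⟨_, _, rfl⟩
        · exact ⟨_, _, rfl⟩
      obtain ⟨a, b, hab⟩ := h1
      rw [dot_wTilde, hab, ← Nat.cast_smul_eq_nsmul ℤ, sub_eq_add_neg, ← neg_smul, hsmul, alphaH,
        hsmul]
      change ∃ a' b', mkH (mu j).1 (mu j).2 0 0 + mkH (om j).1 (om j).2 0 0 + _ + _ = _
      rw [hadd, hadd, hadd]
      exact ⟨_, _, rfl⟩
  exact ⟨lam, congrArg QuotientAddGroup.mk hlam⟩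

end GraphCoordinates

/-! ### Combinatorics of the extension graph -/

section GraphCombinatorics

variable {f : ℕ} [NeZero f] {p : ℕ}

lemma pow_mul_self_eq (j : Fin f) : (p : ℤ) ^ (j : ℕ) * p =
    (p : ℤ) ^ ((j + 1 : Fin f) : ℕ) + if j + 1 = 0 then (p : ℤ) ^ f - 1 else 0 := by
  simp only [Fin.val_add_one_eq_ite, ← Fin.add_one_eq_zero_iff_val]
  split_ifs with h
  · rw [← pow_succ, (Fin.add_one_eq_zero_iff_val j).1 h]; ring
  · rw [pow_succ, add_zero]

/-- Summation over the embeddings shifted cyclically by one. -/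
lemma sum_pow_mul_add_one (w : Fin f → ℤ) :
    ∑ j : Fin f, (p : ℤ) ^ (j : ℕ) * (p * w (j + 1)) =
      ∑ j : Fin f, (p : ℤ) ^ (j : ℕ) * w j + ((p : ℤ) ^ f - 1) * w 0 := by
  have h : ∀ j : Fin f, (p : ℤ) ^ (j : ℕ) * (p * w (j + 1)) =
      (p : ℤ) ^ ((j + 1 : Fin f) : ℕ) * w (j + 1) +
        if j + 1 = 0 then ((p : ℤ) ^ f - 1) * w 0 else 0 := fun j => by
    rw [← mul_assoc, pow_mul_self_eq, add_mul]
    split_ifs with h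
    · rw [h]
    · rw [zero_mul]
  simp_rw [h]
  rw [Finset.sum_add_distrib]
  congr 1
  · exact Equiv.sum_comp (Equiv.addRight (1 : Fin f)) fun j : Fin f => (p : ℤ) ^ (j : ℕ) * w j
  rw [Finset.sum_eq_single (-1 : Fin f)]
  · simp
  · intro j _ hj
    rw [if_neg fun h => hj (eq_neg_of_add_eq_zero_left h)]
  · simp

/-- Twice the exponent of the torus character relating `t_μ(ω)` to `μ` is the difference of their
digit sums, up to a correction at the zeroth embedding. -/
lemma two_mul_graphShift (μ w : Fin f → ℤ) :
    2 * graphShift p μ w = ∑ j : Fin f, (p : ℤ) ^ (j : ℕ) * graphDigit p μ w j -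
      ∑ j : Fin f, (p : ℤ) ^ (j : ℕ) * μ j + ((p : ℤ) ^ f - 1) * w 0 := by
  have h1 := sum_pow_mul_add_one (p := p) w
  have h2 : 2 * graphShift p μ w = ∑ j : Fin f, ((p : ℤ) ^ (j : ℕ) * (p * w (j + 1)) +
      (p : ℤ) ^ (j : ℕ) * graphDigit p μ w j - (p : ℤ) ^ (j : ℕ) * μ j -
      (p : ℤ) ^ (j : ℕ) * w j) := by
    rw [graphShift, Finset.mul_sum]
    refine Finset.sum_congr rfl fun j _ => ?_
    rw [graphDigit]
    split_ifs with h
    · obtain ⟨c, hc⟩ := h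
      rw [show (w (j + 1) + 1) / 2 = c by omega, hc]
      ring
    · obtain ⟨c, hc⟩ := Int.not_even_iff_odd.1 h
      rw [show (w (j + 1) + 1) / 2 = c + 1 by omega, hc]
      ring
  rw [h2, Finset.sum_sub_distrib, Finset.sum_sub_distrib, Finset.sum_add_distrib, h1]
  ring

variable {μ w w' : Fin f → ℤ} {j : Fin f}

lemma graphDigit_nonneg (h : 0 ≤ μ j + w j) (h' : μ j + w j < p - 1) :
    0 ≤ graphDigit p μ w j ∧ graphDigit p μ w j < p - 1 := by
  rw [graphDigit]
  split_ifs <;> constructor <;> linarith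

lemma two_dvd_graphDigit_sub (hp : Odd (p : ℤ)) (μ w w' : Fin f → ℤ) (j : Fin f) :
    (2 : ℤ) ∣ graphDigit p μ w' j - graphDigit p μ w j + (w' j - w j) +
      (w' (j + 1) - w (j + 1)) := by
  obtain ⟨c, hc⟩ := hp
  rw [graphDigit, graphDigit]
  simp only [Int.even_iff]
  split_ifs <;> omega

/-- A vanishing linear combination of the powers of `p` with small coefficients is trivial. -/
lemma eq_zero_of_sum_pow_mul_eq_zero (hp : 0 < p) {f : ℕ} (δ : Fin f → ℤ) (hδ : ∀ j, |δ j| < p)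
    (h : ∑ j : Fin f, (p : ℤ) ^ (j : ℕ) * δ j = 0) : δ = 0 := by
  induction f with
  | zero => exact Subsingleton.elim _ _
  | succ f ih =>
    rw [Fin.sum_univ_succ] at h
    simp only [Fin.val_zero, pow_zero, one_mul, Fin.val_succ, pow_succ'] at h
    simp only [mul_assoc, ← Finset.mul_sum] at h
    have h0 : δ 0 = 0 := Int.eq_zero_of_abs_lt_dvd
      ⟨-∑ j : Fin f, (p : ℤ) ^ (j : ℕ) * δ j.succ, by linarith⟩ (hδ 0)
    rw [h0, zero_add] at h
    have h1 := ih (fun j => δ j.succ) (fun j => hδ _)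
      ((mul_eq_zero.1 h).resolve_left (by exact_mod_cast hp.ne'))
    funext j
    refine Fin.cases h0 (fun j => ?_) j
    exact congrFun h1 j

omit [NeZero f] in
/-- A linear combination of the powers of `p` with small coefficients, not all of them extremal, can
only be divisible by `p^f - 1` trivially. -/
lemma eq_zero_of_dvd_sum_pow_mul (hp : 1 < p) (δ : Fin f → ℤ) (hδ : ∀ j, |δ j| < p)
    (hj : |δ j| < p - 1) (h : (p : ℤ) ^ f - 1 ∣ ∑ j : Fin f, (p : ℤ) ^ (j : ℕ) * δ j) : δ = 0 := by
  refine eq_zero_of_sum_pow_mul_eq_zero (by omega) δ hδ (Int.eq_zero_of_abs_lt_dvd h ?_)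
  have h1 : ∑ j : Fin f, (p : ℤ) ^ (j : ℕ) * (p - 1) = (p : ℤ) ^ f - 1 := by
    rw [← Finset.sum_mul, Fin.sum_univ_eq_sum_range (fun i => (p : ℤ) ^ i), geom_sum_mul]
  rw [← h1]
  have hpos : ∀ i : Fin f, (0 : ℤ) < (p : ℤ) ^ (i : ℕ) := fun i => by positivity
  refine (Finset.abs_sum_le_sum_abs _ _).trans_lt (Finset.sum_lt_sum (fun i _ => ?_)
    ⟨j, Finset.mem_univ j, ?_⟩)
  · rw [abs_mul, abs_of_pos (hpos i)]
    exact mul_le_mul_of_nonneg_left (by have := hδ i; omega) (hpos i).le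
  · rw [abs_mul, abs_of_pos (hpos j)]
    exact mul_lt_mul_of_pos_left hj (hpos j)

/-- Induction along the cyclic order of the embeddings. -/
lemma forall_of_add_one {P : Fin f → Prop} (h0 : P 0) (h : ∀ i, P i → P (i + 1)) (i : Fin f) :
    P i := by
  obtain ⟨n, hn⟩ := i
  induction n with
  | zero => exact h0
  | succ n ih =>
    have h1 := h _ (ih (by omega))
    convert h1
    rw [Fin.val_add_one_eq_ite, if_neg (by simp only; omega)]

/-- The pairings `w`, `w'` of two vertices of the extension graph with the coroots are those of
adjacent vertices. -/
def AdjacentPairings (w w' : Fin f → ℤ) : Prop :=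
  ∃ j, w' - w = Pi.single j 1 ∨ w' - w = Pi.single j (-1)

omit [NeZero f] in
lemma sum_pow_mul_single (j : Fin f) (a : ℤ) :
    ∑ i : Fin f, (p : ℤ) ^ (i : ℕ) * (Pi.single j a : Fin f → ℤ) i = (p : ℤ) ^ (j : ℕ) * a := by
  rw [Finset.sum_eq_single j] <;> simp +contextual

lemma add_one_ne_self_of_ne_one (hf : f ≠ 1) (j : Fin f) : j + 1 ≠ j := by
  intro h
  have h1 := Fin.val_add_one_eq_ite j
  rw [h] at h1
  have := j.2
  split_ifs at h1 <;> omega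

omit [NeZero f] in
lemma eq_of_eq_one (hf : f = 1) (i j : Fin f) : i = j := by
  have := i.2
  have := j.2
  exact Fin.ext (by omega)

/-- The situation of two weights `t_μ(ω)` and `t_μ(ω')` with digits `r` and `r'`, where `μ`, `w` and
`w'` stand for the pairings of `μ`, `ω` and `ω'` with the coroots, and `ω`, `ω'` lie in
`Λ_wt^μ`. -/
structure GraphDigits (p : ℕ) (μ w w' : Fin f → ℤ) (r r' : Fin f → ℕ) : Prop where
  nonneg : ∀ j, 0 ≤ μ j + w j
  lt : ∀ j, μ j + w j < p - 1
  nonneg' : ∀ j, 0 ≤ μ j + w' j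
  lt' : ∀ j, μ j + w' j < p - 1
  eq : ∀ j, (r j : ℤ) = graphDigit p μ w j
  eq' : ∀ j, (r' j : ℤ) = graphDigit p μ w' j

namespace GraphDigits

variable {r r' : Fin f → ℕ} (H : GraphDigits p μ w w' r r')
include H

lemma symm : GraphDigits p μ w' w r' r :=
  ⟨H.nonneg', H.lt', H.nonneg, H.lt, H.eq', H.eq⟩

lemma add_one_lt (j : Fin f) : r j + 1 < p := by
  have h1 := (graphDigit_nonneg (H.nonneg j) (H.lt j)).2
  rw [← H.eq] at h1
  omega

lemma two_mul_sub : 2 * (graphShift p μ w' - graphShift p μ w) =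
    ∑ j : Fin f, (p : ℤ) ^ (j : ℕ) * ((r' j : ℤ) - r j) + ((p : ℤ) ^ f - 1) * (w' 0 - w 0) := by
  rw [mul_sub, two_mul_graphShift, two_mul_graphShift]
  simp only [H.eq, H.eq', mul_sub, Finset.sum_sub_distrib]
  ring

lemma two_dvd (hp : Odd (p : ℤ)) (j : Fin f) :
    (2 : ℤ) ∣ r' j - r j + (w' j - w j) + (w' (j + 1) - w (j + 1)) := by
  rw [H.eq, H.eq']
  exact two_dvd_graphDigit_sub hp μ w w' j

/-- If `w_{j+1}` and `w'_{j+1}` have the same parity, then `r_j` and `r'_j` differ by `w'_j - w_j`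
up to sign. -/
lemma of_even {j : Fin f} (h : (2 : ℤ) ∣ w' (j + 1) - w (j + 1)) :
    w' j - w j = r' j - r j ∨ w' j - w j = r j - r' j := by
  rw [H.eq, H.eq', graphDigit, graphDigit]
  simp only [Int.even_iff]
  split_ifs <;> omega

/-- If `w_{j+1}` and `w'_{j+1}` have different parities, then `r_j` and `p - 2 - r'_j` differ by
`w'_j - w_j` up to sign. -/
lemma of_odd {j : Fin f} (h : ¬ (2 : ℤ) ∣ w' (j + 1) - w (j + 1)) :
    w' j - w j = p - 2 - r' j - r j ∨ w' j - w j = r' j + r j - (p - 2) := by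
  rw [H.eq, H.eq', graphDigit, graphDigit]
  simp only [Int.even_iff]
  split_ifs <;> omega

/-- The exceptional exponent `(r'_j + 1) p^j` of a value on the upper unipotent group only occurs
for adjacent weights if `f ≠ 1`. -/
lemma adjacent_of_modEq (hp : Odd (p : ℤ)) (hf : f ≠ 1) {j : Fin f}
    (h : ((r' j : ℤ) + 1) * (p : ℤ) ^ (j : ℕ) ≡ graphShift p μ w' - graphShift p μ w
      [ZMOD (p : ℤ) ^ f - 1]) :
    (w' - w = Pi.single (j + 1) 1 ∨ w' - w = Pi.single (j + 1) (-1)) ∧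
      r' (j + 1) = r (j + 1) + 1 := by
  have hj := add_one_ne_self_of_ne_one hf j
  have hp1 : 1 < p := by have := H.add_one_lt j; omega
  have hq : (p : ℤ) ^ f - 1 ≠ 0 := by
    have : (1 : ℤ) < (p : ℤ) ^ f := one_lt_pow₀ (by exact_mod_cast hp1) (NeZero.ne f)
    omega
  obtain ⟨c, hc⟩ := h.dvd
  have h2 := H.two_mul_sub
  -- doubling the congruence and carrying `2 (r'_j + 1) p^j = (2 r'_j + 2 - p) p^j + p^{j+1}` makes
  -- all the coefficients small
  set δ : Fin f → ℤ := fun i => (r' i : ℤ) - r i -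
    (Pi.single j (2 * ((r' j : ℤ) + 1) - p) : Fin f → ℤ) i -
    (Pi.single (j + 1) 1 : Fin f → ℤ) i with hδ
  have hδj : δ j = p - 2 - r j - r' j := by
    simp only [hδ, Pi.single_eq_same, Pi.single_eq_of_ne hj.symm]; ring
  have hδj1 : δ (j + 1) = r' (j + 1) - r (j + 1) - 1 := by
    simp only [hδ, Pi.single_eq_same, Pi.single_eq_of_ne hj]; ring
  have hδi : ∀ i, i ≠ j → i ≠ j + 1 → δ i = r' i - r i := fun i h1 h2 => by
    simp only [hδ, Pi.single_eq_of_ne h1, Pi.single_eq_of_ne h2]; ring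
  have hsum : ∑ i : Fin f, (p : ℤ) ^ (i : ℕ) * δ i =
      ((p : ℤ) ^ f - 1) * (2 * c - (w' 0 - w 0) + if j + 1 = 0 then 1 else 0) := by
    simp only [hδ, mul_sub, Finset.sum_sub_distrib, sum_pow_mul_single] at h2 ⊢
    rw [pow_mul_self_eq]
    split_ifs
    · linear_combination -h2 + 2 * hc
    · linear_combination -h2 + 2 * hc
  have hδ0 : δ = 0 := by
    refine eq_zero_of_dvd_sum_pow_mul (j := j) hp1 δ (fun i => ?_) ?_ ⟨_, hsum⟩
    · have h3 := H.add_one_lt i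
      have h4 := H.symm.add_one_lt i
      rw [abs_lt]
      by_cases hi : i = j
      · subst hi; rw [hδj]; omega
      by_cases hi' : i = j + 1
      · subst hi'; rw [hδj1]; omega
      · rw [hδi i hi hi']; omega
    · have h3 := H.add_one_lt j
      have h4 := H.symm.add_one_lt j
      rw [hδj, abs_lt]
      omega
  have hw0 : 2 * c - (w' 0 - w 0) + (if j + 1 = 0 then 1 else 0) = 0 := by
    rw [hδ0] at hsum
    simpa [hq] using hsum.symm
  have e1 : (p : ℤ) - 2 - r j - r' j = 0 := by rw [← hδj, hδ0]; rfl
  have e2 : (r' (j + 1) : ℤ) - r (j + 1) - 1 = 0 := by rw [← hδj1, hδ0]; rfl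
  have e3 : ∀ i, i ≠ j → i ≠ j + 1 → (r' i : ℤ) - r i = 0 := fun i h1 h2 => by
    rw [← hδi i h1 h2, hδ0]; rfl
  -- the parity of `w' - w` propagates from one embedding to the next one
  have hpar : ∀ i, (2 : ℤ) ∣ w' i - w i - (Pi.single (j + 1) 1 : Fin f → ℤ) i := by
    refine forall_of_add_one ?_ fun i hi => ?_
    · by_cases h0 : j + 1 = 0
      · rw [if_pos h0] at hw0
        rw [← h0, Pi.single_eq_same, h0]
        exact ⟨c, by omega⟩
      · rw [if_neg h0] at hw0
        rw [Pi.single_eq_of_ne (Ne.symm h0)]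
        exact ⟨c, by omega⟩
    · have h3 := H.two_dvd hp i
      obtain ⟨a, ha⟩ := hp
      by_cases hij : i = j
      · subst hij
        rw [Pi.single_eq_of_ne hj.symm] at hi
        rw [Pi.single_eq_same]
        omega
      have hij' : i + 1 ≠ j + 1 := fun h => hij (add_right_cancel h)
      rw [Pi.single_eq_of_ne hij']
      by_cases hi1 : i = j + 1
      · subst hi1
        rw [Pi.single_eq_same] at hi
        omega
      · rw [Pi.single_eq_of_ne hi1] at hi
        have := e3 i hij hi1
        omega
  have hz : ∀ i, i ≠ j + 1 → w' i - w i = 0 := fun i hi => by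
    have h3 := hpar (i + 1)
    by_cases hij : i = j
    · subst hij
      rw [Pi.single_eq_same] at h3
      have := H.of_odd (j := i) (by omega)
      omega
    · rw [Pi.single_eq_of_ne fun h => hij (add_right_cancel h), sub_zero] at h3
      have := H.of_even h3
      have := e3 i hij hi
      omega
  have h1 : w' (j + 1) - w (j + 1) = 1 ∨ w' (j + 1) - w (j + 1) = -1 := by
    have h3 := hpar (j + 1 + 1)
    rw [Pi.single_eq_of_ne fun h => hj (add_right_cancel h), sub_zero] at h3
    have := H.of_even h3
    omega
  refine ⟨?_, by omega⟩
  refine h1.imp (fun h => ?_) fun h => ?_ <;> funext i <;> by_cases hi : i = j + 1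
  · subst hi; simp [h]
  · simp [hi, hz i hi]
  · subst hi; simp [h]
  · simp [hi, hz i hi]

/-- If `f ≠ 1`, the exceptional exponents on the upper and on the lower unipotent group do not occur
together. -/
lemma not_modEq_and_modEq (hp : Odd (p : ℤ)) (hf : f ≠ 1) {i j : Fin f}
    (h : ((r' i : ℤ) + 1) * (p : ℤ) ^ (i : ℕ) ≡ graphShift p μ w' - graphShift p μ w
      [ZMOD (p : ℤ) ^ f - 1])
    (h' : ((r j : ℤ) + 1) * (p : ℤ) ^ (j : ℕ) ≡ graphShift p μ w - graphShift p μ w'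
      [ZMOD (p : ℤ) ^ f - 1]) : False := by
  obtain ⟨h1, h2⟩ := H.adjacent_of_modEq hp hf h
  obtain ⟨h3, h4⟩ := H.symm.adjacent_of_modEq hp hf h'
  have hij : i = j := by
    by_contra hij
    have hne : i + 1 ≠ j + 1 := fun h => hij (add_right_cancel h)
    have h5 : w' (i + 1) - w (i + 1) ≠ 0 := by
      rw [← Pi.sub_apply]
      rcases h1 with h1 | h1 <;> rw [h1] <;> simp
    have h6 : w (i + 1) - w' (i + 1) = 0 := by
      rw [← Pi.sub_apply]
      rcases h3 with h3 | h3 <;> rw [h3] <;> simp [hne]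
    omega
  subst hij
  omega

lemma two_mul_sub_of_eq_one (hf : f = 1) (j : Fin f) :
    2 * (graphShift p μ w' - graphShift p μ w) = r' j - r j + ((p : ℤ) - 1) * (w' j - w j) := by
  subst hf
  rw [H.two_mul_sub, Subsingleton.elim j 0]
  simp

omit H [NeZero f] in
lemma adjacentPairings_of_eq_one (hf : f = 1) {j : Fin f} (h : w' j - w j = 1 ∨ w' j - w j = -1) :
    AdjacentPairings w w' := by
  refine ⟨j, h.imp (fun h => ?_) fun h => ?_⟩ <;> funext i <;> rw [eq_of_eq_one hf i j] <;> simp [h]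

/-- For `f = 1` and weights which are not adjacent, the exceptional exponent on the upper unipotent
group only occurs for weights of large dimension. -/
lemma le_of_modEq_of_eq_one (hp : Odd (p : ℤ)) (hf : f = 1) (hadj : ¬ AdjacentPairings w w')
    {j : Fin f} (h : ((r' j : ℤ) + 1) * (p : ℤ) ^ (j : ℕ) ≡ graphShift p μ w' - graphShift p μ w
      [ZMOD (p : ℤ) ^ f - 1]) (i : Fin f) : p ≤ r i + r' i + 1 := by
  have h2 := H.two_mul_sub_of_eq_one hf j
  have h3 := H.add_one_lt j
  have h4 := H.symm.add_one_lt j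
  have hp3 : 3 ≤ p := by
    obtain ⟨a, ha⟩ := hp
    omega
  rw [eq_of_eq_one hf i j]
  have hj : (j : ℕ) = 0 := by have := j.2; omega
  have hpf : (p : ℤ) ^ f = p := by rw [hf, pow_one]
  rw [hj, hpf, pow_zero, mul_one] at h
  obtain ⟨c, hc⟩ := h.dvd
  have h5 : (r j : ℤ) + r' j + 2 = (p - 1) * (w' j - w j - 2 * c) := by
    linear_combination h2 - 2 * hc
  by_cases hw : (2 : ℤ) ∣ w' j - w j
  · obtain ⟨d, hd⟩ := hw
    have h6 : 0 < d - c := by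
      by_contra! hle
      have : ((p : ℤ) - 1) * (w' j - w j - 2 * c) ≤ 0 :=
        mul_nonpos_of_nonneg_of_nonpos (by omega) (by omega)
      omega
    have : ((p : ℤ) - 1) * 2 ≤ (p - 1) * (w' j - w j - 2 * c) :=
      mul_le_mul_of_nonneg_left (by omega) (by omega)
    omega
  · exfalso
    have h6 : w' j - w j - 2 * c = 1 := by
      have hlo : 0 < w' j - w j - 2 * c := by
        by_contra! hle
        have : ((p : ℤ) - 1) * (w' j - w j - 2 * c) ≤ 0 :=
          mul_nonpos_of_nonneg_of_nonpos (by omega) hle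
        omega
      by_contra hne
      have : ((p : ℤ) - 1) * 3 ≤ (p - 1) * (w' j - w j - 2 * c) :=
        mul_le_mul_of_nonneg_left (by omega) (by omega)
      omega
    rw [h6, mul_one] at h5
    have h7 := H.of_odd (j := j) (by rwa [eq_of_eq_one hf (j + 1) j])
    exact hadj (adjacentPairings_of_eq_one hf (j := j) (by omega))

/-- For `f = 1`, complementary weights which are not adjacent do not satisfy the congruence under
which the cocycles may be supported on the coset of the Weyl element. -/
lemma not_modEq_zero_of_eq_one (hf : f = 1) (hadj : ¬ AdjacentPairings w w')
    {j : Fin f} (hr : r j + r' j + 1 = p) :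
    ¬ (r j : ℤ) + (graphShift p μ w' - graphShift p μ w) ≡ 0 [ZMOD (p : ℤ) - 1] := by
  intro h
  have h2 := H.two_mul_sub_of_eq_one hf j
  obtain ⟨c, hc⟩ := h.dvd
  have hp1 : 1 < p := by have := H.add_one_lt j; omega
  have hr' : (r j : ℤ) + r' j + 1 = p := by exact_mod_cast hr
  have h3 : ((p : ℤ) - 1) * (1 + (w' j - w j) + 2 * c) = 0 := by
    linear_combination -h2 - hr' + 2 * -hc
  have h4 : 1 + (w' j - w j) + 2 * c = 0 := (mul_eq_zero.1 h3).resolve_left (by omega)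
  have h7 := H.of_odd (j := j) (by rw [eq_of_eq_one hf (j + 1) j]; omega)
  exact hadj (adjacentPairings_of_eq_one hf (j := j) (by omega))

lemma of_eq_one_of_adjacent (hf : f = 1) (hadj : AdjacentPairings w w') :
    (∀ j, r j + r' j + 3 = p) ∨ ∀ j, r j + r' j + 1 = p := by
  obtain ⟨i, hi⟩ := hadj
  have h1 : w' i - w i = 1 ∨ w' i - w i = -1 := by
    rw [← Pi.sub_apply]
    exact hi.imp (fun h => by rw [h]; simp) (fun h => by rw [h]; simp)
  have h2 := H.of_odd (j := i) (by rw [eq_of_eq_one hf (i + 1) i]; omega)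
  by_cases h3 : r i + r' i + 3 = p
  · exact Or.inl fun j => by rwa [eq_of_eq_one hf j i]
  · exact Or.inr fun j => by rw [eq_of_eq_one hf j i]; omega

/-- For adjacent weights, `r'` arises from `r` by replacing the digit `r_j` in some position `j` by
`s = p - 2 - r_j`, and then changing the digit in position `j + 1`, which is again `j` for `f = 1`,
by one. -/
lemma digits_of_adjacent (hadj : AdjacentPairings w w') : ∃ (j : Fin f) (s : ℕ),
    r j + s + 2 = p ∧ (2 : ℤ) ∣ (w' 0 - w 0) - (if j + 1 = 0 then 1 else 0) ∧
      (r' = Function.update r j s + Pi.single (j + 1) 1 ∨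
        r' + Pi.single (j + 1) 1 = Function.update r j s) := by
  obtain ⟨i, hi⟩ := hadj
  obtain ⟨j, rfl⟩ : ∃ j, i = j + 1 := ⟨i - 1, by simp⟩
  have h1 : w' (j + 1) - w (j + 1) = 1 ∨ w' (j + 1) - w (j + 1) = -1 := by
    rw [← Pi.sub_apply]
    exact hi.imp (fun h => by rw [h]; simp) (fun h => by rw [h]; simp)
  have h0 : ∀ i, i ≠ j + 1 → w' i - w i = 0 := fun i hij => by
    rw [← Pi.sub_apply]
    rcases hi with hi | hi <;> rw [hi] <;> simp [hij]
  have h2 := H.add_one_lt j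
  refine ⟨j, p - 2 - r j, by omega, ?_, ?_⟩
  · by_cases hj : j + 1 = 0
    · rw [if_pos hj, ← hj]; omega
    · rw [if_neg hj, h0 0 (Ne.symm hj)]; simp
  have hj := H.of_odd (j := j) (by omega)
  by_cases hjj : j + 1 = j
  · have hf : f = 1 := by
      by_contra hf
      exact add_one_ne_self_of_ne_one hf j hjj
    rw [hjj] at h1 ⊢
    rcases (show r' j = p - 2 - r j + 1 ∨ r' j + 1 = p - 2 - r j by omega) with h | h
    · left
      funext i
      rw [eq_of_eq_one hf i j]
      simpa using h
    · right
      funext i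
      rw [eq_of_eq_one hf i j]
      simpa using h
  · have hj1 := H.of_even (j := j + 1)
      (by rw [h0 _ fun h => hjj (add_right_cancel h)]; exact dvd_zero _)
    have hji := h0 j (Ne.symm hjj)
    have hi' : ∀ i, i ≠ j → i ≠ j + 1 → r' i = r i := fun i hi1 hi2 => by
      have h3 := H.of_even (j := i)
        (by rw [h0 _ fun h => hi1 (add_right_cancel h)]; exact dvd_zero _)
      rw [h0 i hi2] at h3
      omega
    rcases (show r' (j + 1) = r (j + 1) + 1 ∨ r' (j + 1) + 1 = r (j + 1) by omega) with h | h
    · left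
      funext i
      rw [Pi.add_apply]
      by_cases hi1 : i = j
      · subst hi1
        rw [Function.update_self, Pi.single_eq_of_ne (Ne.symm hjj)]
        omega
      by_cases hi2 : i = j + 1
      · subst hi2
        rw [Function.update_of_ne hi1, Pi.single_eq_same, h]
      · rw [Function.update_of_ne hi1, Pi.single_eq_of_ne hi2, hi' i hi1 hi2, add_zero]
    · right
      funext i
      rw [Pi.add_apply]
      by_cases hi1 : i = j
      · subst hi1
        rw [Function.update_self, Pi.single_eq_of_ne (Ne.symm hjj)]
        omega
      by_cases hi2 : i = j + 1
      · subst hi2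
        rw [Function.update_of_ne hi1, Pi.single_eq_same, h]
      · rw [Function.update_of_ne hi1, Pi.single_eq_of_ne hi2, hi' i hi1 hi2, add_zero]

end GraphDigits

end GraphCombinatorics

/-! ### Extensions of the polynomial models -/

section

open MvPolynomial

section DeterminantExponent

variable {f : ℕ} {p : ℕ} {μ w w' : Fin f → ℤ} {r r' : Fin f → ℕ} {b b' : ℤ}

lemma cast_digitSum (p : ℕ) (r : Fin f → ℕ) :
    (digitSum p r : ℤ) = ∑ j : Fin f, (p : ℤ) ^ (j : ℕ) * r j := by
  simp [digitSum, mul_comm]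

variable [NeZero f]

/-- The determinant exponent of a weight is determined modulo `q + 1` by its digits and its
restriction to the torus; for adjacent weights it is the one of the extension built from
`Sym^{p+s}`. -/
lemma GraphDigits.det_modEq (H : GraphDigits p μ w w' r r') {j : Fin f} {s : ℕ}
    (hs : r j + s + 2 = p) (hw : (2 : ℤ) ∣ (w' 0 - w 0) - (if j + 1 = 0 then 1 else 0))
    (he : weightExp p (p ^ f) r' b' ≡ weightExp p (p ^ f) r b +
      ((p ^ f : ℕ) + 1) * (graphShift p μ w' - graphShift p μ w)
        [ZMOD ((p ^ f : ℕ) : ℤ) ^ 2 - 1]) :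
    (r' = Function.update r j s + Pi.single (j + 1) 1 →
      b' ≡ b - (s + 1) * p ^ (j : ℕ) - (if j + 1 = 0 then 1 else 0) [ZMOD (p ^ f : ℕ) + 1]) ∧
    (r' + Pi.single (j + 1) 1 = Function.update r j s →
      b' ≡ b - (s + 1) * p ^ (j : ℕ) - (if j + 1 = 0 then 1 else 0) + p ^ ((j + 1 : Fin f) : ℕ)
        [ZMOD (p ^ f : ℕ) + 1]) := by
  have hD := H.two_mul_sub
  simp only [mul_sub ((p : ℤ) ^ _), Finset.sum_sub_distrib, ← cast_digitSum] at hD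
  have hQ : (p : ℤ) ^ f - 1 ≠ 0 := by
    have : (1 : ℤ) < (p : ℤ) ^ f := one_lt_pow₀ (by exact_mod_cast (by omega : 1 < p)) (NeZero.ne f)
    omega
  obtain ⟨z, hz⟩ := he.dvd
  obtain ⟨t, ht⟩ := hw
  unfold weightExp at hz
  push_cast at hz ⊢
  have hcarry := pow_mul_self_eq (p := p) j
  rw [← mul_one ((p : ℤ) ^ f - 1), ← mul_zero ((p : ℤ) ^ f - 1), ← mul_ite] at hcarry
  have hu := congrArg (Nat.cast (R := ℤ)) (digitSum_update (p := p) r j s)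
  have hs' : (r j : ℤ) + s + 2 = p := by exact_mod_cast hs
  push_cast at hu
  set ε : ℤ := if j + 1 = 0 then 1 else 0
  set D := graphShift p μ w' - graphShift p μ w
  set Q := (p : ℤ) ^ f
  have h1 : b' - b = -D - (w' 0 - w 0) + (Q + 1) * z := by
    refine mul_left_cancel₀ hQ ?_
    linear_combination hz - hD
  constructor
  · intro h
    have h2 : (digitSum p r' : ℤ) = digitSum p (Function.update r j s) +
        (p : ℤ) ^ ((j + 1 : Fin f) : ℕ) := by
      rw [h, digitSum_add, digitSum_single]; push_cast; ring
    have h3 : 2 * (-D - (w' 0 - w 0)) = 2 * (-(s + 1) * (p : ℤ) ^ (j : ℕ) - ε - (Q + 1) * t) := by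
      linear_combination -hD - h2 - hu + hcarry + (p : ℤ) ^ (j : ℕ) * hs' - (Q + 1) * ht
    refine Int.modEq_iff_dvd.2 ⟨t - z, ?_⟩
    have h4 := mul_left_cancel₀ two_ne_zero h3
    linear_combination -h1 - h4
  · intro h
    have h2 : (digitSum p r' : ℤ) + (p : ℤ) ^ ((j + 1 : Fin f) : ℕ) =
        digitSum p (Function.update r j s) := by
      rw [← h, digitSum_add, digitSum_single]; push_cast; ring
    have h3 : 2 * (-D - (w' 0 - w 0)) = 2 * (-(s + 1) * (p : ℤ) ^ (j : ℕ) - ε +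
        (p : ℤ) ^ ((j + 1 : Fin f) : ℕ) - (Q + 1) * t) := by
      linear_combination -hD - h2 - hu + hcarry + (p : ℤ) ^ (j : ℕ) * hs' - (Q + 1) * ht
    refine Int.modEq_iff_dvd.2 ⟨t - z, ?_⟩
    have h4 := mul_left_cancel₀ two_ne_zero h3
    linear_combination -h1 - h4

end DeterminantExponent

section ExtensionsOfModels

variable {k : Type v} {l F : Type u} [Field k] [Fintype k] [Field l] [Algebra k l] [Field F]
  {f : ℕ} [NeZero f] {p : ℕ} [ExpChar l p]
  {μ w w' : Fin f → ℤ} {r r' : Fin f → ℕ} {b b' : ℤ}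

/-- There is a nonsplit extension between adjacent weights. -/
lemma exists_cocycle_of_adjacent [CharP F p] (hp : p.Prime) (hl : Module.finrank k l = 2)
    (hk : Fintype.card k = p ^ f) (σ : l →+* F) (H : GraphDigits p μ w w' r r')
    (he : weightExp p (p ^ f) r' b' ≡ weightExp p (p ^ f) r b +
      ((p ^ f : ℕ) + 1) * (graphShift p μ w' - graphShift p μ w)
        [ZMOD ((p ^ f : ℕ) : ℤ) ^ 2 - 1]) (hadj : AdjacentPairings w w') :
    ∃ c ∈ extCocycles (polyRep (k := k) p σ r b) (polyRep p σ r' b'),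
      c ∉ extCoboundaries (polyRep (k := k) p σ r b) (polyRep p σ r' b') := by
  obtain ⟨j, s, hs, hw, hr'⟩ := H.digits_of_adjacent hadj
  have hb := H.det_modEq hs hw he
  rw [← hk] at hb
  have hr : ∀ i, r i < p := fun i => (Nat.lt_succ_self _).trans (H.add_one_lt i)
  rcases hr' with h | h
  · have hμ := slotMul_X (σ := σ) hk j (Function.update r j s) (hb.1 h)
    rw [← h] at hμ
    exact ⟨_, slotCocycle_mem hp hl hk hr hs hμ,
      slotCocycle_X_not_mem hp hl hk hs hr H.symm.add_one_lt h hμ⟩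
  · have hμ := slotMul_pderiv (σ := σ) hk j r' (hb.2 h)
    rw [h] at hμ
    exact ⟨_, slotCocycle_mem hp hl hk hr hs hμ,
      slotCocycle_pderiv_not_mem hp hl hk hs hr H.symm.add_one_lt h hμ⟩

/-- The representatives of a class modulo `q - 1` between `1` and `q - 1`. -/
lemma exists_nat_modEq {q : ℕ} (hq : 1 < q) (D : ℤ) :
    ∃ m : ℕ, m ≠ 0 ∧ m < q ∧ (m : ℤ) ≡ D [ZMOD (q : ℤ) - 1] := by
  have h0 : 0 ≤ (D - 1) % ((q : ℤ) - 1) := Int.emod_nonneg _ (by omega)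
  have h1 : (D - 1) % ((q : ℤ) - 1) < q - 1 := Int.emod_lt_of_pos _ (by omega)
  refine ⟨((D - 1) % ((q : ℤ) - 1)).toNat + 1, by omega, by omega, ?_⟩
  rw [Nat.cast_add, Int.toNat_of_nonneg h0, Nat.cast_one]
  have := (Int.mod_modEq (D - 1) ((q : ℤ) - 1)).add_right 1
  rwa [sub_add_cancel] at this

/-- The dimension of the extensions between the polynomial models of `F_U(t_μ(ω))` and
`F_U(t_μ(ω'))`. -/
theorem rank_extClasses_polyRep [Fact p.Prime] [CharP F p] [CharP k p] (hp2 : p ≠ 2)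
    (hl : Module.finrank k l = 2) (hk : Fintype.card k = p ^ f) (σ : l →+* F)
    (H : GraphDigits p μ w w' r r')
    (he : weightExp p (p ^ f) r' b' ≡ weightExp p (p ^ f) r b +
      ((p ^ f : ℕ) + 1) * (graphShift p μ w' - graphShift p μ w)
        [ZMOD ((p ^ f : ℕ) : ℤ) ^ 2 - 1]) :
    (AdjacentPairings w w' →
      Module.rank F (ExtClasses (polyRep (k := k) p σ r b) (polyRep p σ r' b')) = 1) ∧
    (¬ AdjacentPairings w w' →
      Module.rank F (ExtClasses (polyRep (k := k) p σ r b) (polyRep p σ r' b')) = 0) := by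
  have hp : p.Prime := Fact.out
  have hodd : Odd (p : ℤ) := by exact_mod_cast hp.odd_of_ne_two hp2
  have hr := H.add_one_lt
  have hr' := H.symm.add_one_lt
  set DV := polyData (k := k) p σ hp hl r b fun j => (Nat.lt_succ_self _).trans (hr j)
  set DW := polyData (k := k) p σ hp hl r' b' fun j => (Nat.lt_succ_self _).trans (hr' j)
  set D := graphShift p μ w' - graphShift p μ w with hD
  have hq : 1 < p ^ f := Nat.one_lt_pow (NeZero.ne f) hp.one_lt
  obtain ⟨m, hm, hm1, hmD⟩ := exists_nat_modEq hq D
  obtain ⟨m', hm', hm1', hmD'⟩ := exists_nat_modEq hq (-D)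
  have hχ : WeightRatio p σ k r r' b b' m := by
    rw [weightRatio_iff hl, hk]
    refine he.trans (Int.ModEq.add_left _ ?_)
    rw [show ((p ^ f : ℕ) : ℤ) ^ 2 - 1 = ((p ^ f : ℕ) + 1) * ((p ^ f : ℕ) - 1) by ring]
    exact (hmD.symm).mul_left'
  have hχ' : WeightRatio p σ k r' r b' b m' := by
    refine hχ.symm hl ?_
    rw [hk]
    have h1 := (hmD.add hmD').symm.dvd
    simpa using h1
  have hPA : ∀ j, m = (r' j + 1) * p ^ (j : ℕ) →
      ((r' j : ℤ) + 1) * (p : ℤ) ^ (j : ℕ) ≡ D [ZMOD (p : ℤ) ^ f - 1] := fun j hj => by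
    rw [hj] at hmD
    exact_mod_cast hmD
  have hPB : ∀ j, m' = (r j + 1) * p ^ (j : ℕ) → ((r j : ℤ) + 1) * (p : ℤ) ^ (j : ℕ) ≡
      graphShift p μ w - graphShift p μ w' [ZMOD (p : ℤ) ^ f - 1] := fun j hj => by
    rw [hj, hD, neg_sub] at hmD'
    exact_mod_cast hmD'
  constructor
  · intro hadj
    obtain ⟨c, hc, hc'⟩ := exists_cocycle_of_adjacent hp hl hk σ H he hadj
    refine rank_extClasses_eq_one_of_weights DV DW hp2 hk hr hr' hm hm1 hχ hm' hm1' hχ' hc hc' ?_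
    by_cases hf : f = 1
    · exact Or.inr ⟨hf, H.of_eq_one_of_adjacent hf hadj⟩
    · refine Or.inl ⟨hf, ?_⟩
      rintro ⟨⟨i, hi⟩, j, hj⟩
      exact H.not_modEq_and_modEq hodd hf (hPA i hi) (hPB j hj)
  · intro hadj
    have hadj' : ¬ AdjacentPairings w' w := by
      rintro ⟨j, h⟩
      refine hadj ⟨j, h.symm.imp (fun h => ?_) fun h => ?_⟩
      · rw [← neg_sub, h, ← Pi.single_neg, neg_neg]
      · rw [← neg_sub, h, ← Pi.single_neg]
    refine rank_extClasses_eq_zero_of_weights DV DW hp2 hk hr hr' hm hm1 hχ hm' hm1' hχ' ?_ ?_ ?_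
    · rintro ⟨j, hj⟩
      by_cases hf : f = 1
      · exact ⟨hf, H.le_of_modEq_of_eq_one hodd hf hadj (hPA j hj)⟩
      · exact absurd ⟨j + 1, (H.adjacent_of_modEq hodd hf (hPA j hj)).1⟩ hadj
    · rintro ⟨j, hj⟩
      by_cases hf : f = 1
      · refine ⟨hf, fun i => ?_⟩
        rw [add_comm (r i)]
        exact H.symm.le_of_modEq_of_eq_one hodd hf hadj' (hPB j hj) i
      · exact absurd ⟨j + 1, (H.symm.adjacent_of_modEq hodd hf (hPB j hj)).1⟩ hadj'
    · intro hf hsum hK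
      refine H.not_modEq_zero_of_eq_one hf hadj (hsum 0) ?_
      rw [hk] at hK
      have hpf : p ^ f = p := by rw [hf, pow_one]
      have hd : digitSum p r = r 0 := by
        rw [digitSum, Finset.sum_eq_single (0 : Fin f)]
        · simp
        · intro j _ hj
          exact absurd (eq_of_eq_one hf j 0) hj
        · simp
      rw [hpf] at hK he
      have h1 := (he.symm.trans hK).dvd
      unfold weightExp at h1
      rw [hd] at h1
      obtain ⟨z, hz⟩ := h1
      refine Int.modEq_iff_dvd.2 ⟨z - b, ?_⟩
      refine mul_left_cancel₀ (show (p : ℤ) + 1 ≠ 0 by omega) ?_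
      linear_combination hz

end ExtensionsOfModels

end

/-! ### Extensions of Serre weights -/

section SerreWeights

variable {f : ℕ} {p : ℕ}

lemma adjacent_iff (om om' : XU f) :
    Adjacent om om' ↔ AdjacentPairings (pairU om) (pairU om') := by
  have hrho : ∀ i j : Fin f, pairU (rhoU i) j = (Pi.single i 1 : Fin f → ℤ) j := fun i j => by
    by_cases h : j = i
    · subst h; simp [pairU, rhoU]
    · simp [pairU, rhoU, h]
  have h0 : ∀ x : XU f, x ∈ X0U (f := f) ↔ ∀ j, pairU x j = 0 := fun x => by
    simp only [← pairH_inclU]; rfl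
  have hsub : ∀ (x y : XU f) j, pairU (x - y) j = pairU x j - pairU y j := fun x y j => by
    simp only [pairU, Pi.sub_apply, Prod.fst_sub, Prod.snd_sub]; ring
  have hadd : ∀ (x y : XU f) j, pairU (x + y) j = pairU x j + pairU y j := fun x y j => by
    simp only [pairU, Pi.add_apply, Prod.fst_add, Prod.snd_add]; ring
  refine exists_congr fun i => ?_
  rw [or_comm, h0, h0, funext_iff, funext_iff, Pi.single_neg]
  refine or_congr (forall_congr' fun j => ?_) (forall_congr' fun j => ?_)
  · rw [hadd, hsub, hrho, Pi.sub_apply]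
    constructor <;> intro h <;> linarith
  · rw [hsub, hsub, hrho, Pi.sub_apply, Pi.neg_apply]
    constructor <;> intro h <;> linarith

lemma pairU_of_mem_LambdaWtMu {mu om : XU f} (h : wtU om ∈ LambdaWtMu p (inclU mu)) (j : Fin f) :
    0 ≤ pairU mu j + pairU om j ∧ pairU mu j + pairU om j < p - 1 := by
  have h1 := h j
  rw [map_add] at h1
  change 0 ≤ pairH (inclU mu j) + pairH (inclU om j) ∧
    pairH (inclU mu j) + pairH (inclU om j) < p - 1 at h1
  rwa [pairH_inclU, pairH_inclU] at h1

lemma weightExp_toNat_pairU {lam : XU f} (h : ∀ j, 0 ≤ pairU lam j) :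
    weightExp p (p ^ f) (fun j => ((lam j).1 - (lam j).2).toNat)
      (∑ j : Fin f, (lam j).2 * (p : ℤ) ^ (j : ℕ)) = charExp p (p ^ f : ℕ) (inclU lam) := by
  rw [weightExp, charExp_apply, cast_digitSum, Finset.mul_sum, ← Finset.sum_add_distrib]
  refine Finset.sum_congr rfl fun j _ => ?_
  rw [Int.toNat_of_nonneg (show 0 ≤ (lam j).1 - (lam j).2 from h j)]
  change _ = (p : ℤ) ^ (j : ℕ) * ((lam j).1 - (p ^ f : ℕ) * (lam j).2 + ((p ^ f : ℕ) + 1) * 0)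
  ring

variable [Fact p.Prime]

lemma exists_regular_classU_eq [NeZero f] {mu om : XU f} (h : wtU om ∈ LambdaWtMu p (inclU mu)) :
    ∃ lam : XU f, lam ∈ XregU p ∧ classU p lam = tMu p mu (inclU om) := by
  obtain ⟨lam, hlam⟩ := exists_classU_eq (p := p) mu om
  refine ⟨lam, fun j => ?_, hlam⟩
  rw [pairH_inclU, pairU_of_classU_eq hlam]
  have := pairU_of_mem_LambdaWtMu h j
  exact graphDigit_nonneg this.1 this.2

variable {k : Type v} {l F : Type u} [Field k] [Fintype k] [Field l] [Algebra k l] [CharP l p]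
  [Field F]

lemma dimExt1_serreWeight_eq_rank (σ : l →+* F) (lam lam' : XU f) :
    dimExt1 (serreWeight k p σ lam) (serreWeight k p σ lam') =
      Module.rank F (ExtClasses
        (polyRep (k := k) p σ (fun j => ((lam j).1 - (lam j).2).toNat)
          (∑ j : Fin f, (lam j).2 * (p : ℤ) ^ (j : ℕ)))
        (polyRep (k := k) p σ (fun j => ((lam' j).1 - (lam' j).2).toNat)
          (∑ j : Fin f, (lam' j).2 * (p : ℤ) ^ (j : ℕ)))) := by
  rw [dimExt1_congr (Rep.mkIso (serreEquiv p σ lam)) (Rep.mkIso (serreEquiv p σ lam')),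
    dimExt1_eq_rank]

end SerreWeights

theorem mainTheorem8 {p : ℕ} [Fact p.Prime] (hp : p ≠ 2) {f : ℕ} [NeZero f]
    {k : Type v} {l F : Type u} [Field k] [Fintype k] [Field l] [Algebra k l] [CharP l p] [Field F]
    (hk : Fintype.card k = p ^ f) (hl : Module.finrank k l = 2) (σ₀' : l →+* F)
    (mu om om' : XU f)
    (hom : wtU om ∈ LambdaWtMu p (inclU mu)) (hom' : wtU om' ∈ LambdaWtMu p (inclU mu)) :
    (∃ lam : XU f, lam ∈ XregU p ∧ classU p lam = tMu p mu (inclU om)) ∧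
    (∃ lam' : XU f, lam' ∈ XregU p ∧ classU p lam' = tMu p mu (inclU om')) ∧
    ∀ lam lam' : XU f, lam ∈ X1U p → lam' ∈ X1U p →
      classU p lam = tMu p mu (inclU om) → classU p lam' = tMu p mu (inclU om') →
      (Adjacent om om' →
        dimExt1 (serreWeight k p σ₀' lam) (serreWeight k p σ₀' lam') = 1) ∧
      (¬ Adjacent om om' →
        dimExt1 (serreWeight k p σ₀' lam) (serreWeight k p σ₀' lam') = 0) := by
  refine ⟨exists_regular_classU_eq hom, exists_regular_classU_eq hom',
    fun lam lam' hlam hlam' hc hc' => ?_⟩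
  have : CharP F p := charP_of_injective_ringHom σ₀'.injective p
  have : CharP k p := (algebraMap k l).charP (algebraMap k l).injective p
  have h0 : ∀ j, 0 ≤ pairU lam j := fun j => by rw [← pairH_inclU]; exact (hlam j).1
  have h0' : ∀ j, 0 ≤ pairU lam' j := fun j => by rw [← pairH_inclU]; exact (hlam' j).1
  have H : GraphDigits p (pairU mu) (pairU om) (pairU om')
      (fun j => ((lam j).1 - (lam j).2).toNat) (fun j => ((lam' j).1 - (lam' j).2).toNat) :=
    ⟨fun j => (pairU_of_mem_LambdaWtMu hom j).1, fun j => (pairU_of_mem_LambdaWtMu hom j).2,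
      fun j => (pairU_of_mem_LambdaWtMu hom' j).1, fun j => (pairU_of_mem_LambdaWtMu hom' j).2,
      fun j => by rw [← pairU_of_classU_eq hc]; exact Int.toNat_of_nonneg (h0 j),
      fun j => by rw [← pairU_of_classU_eq hc']; exact Int.toNat_of_nonneg (h0' j)⟩
  have key := rank_extClasses_polyRep hp hl hk σ₀' H
    (b := ∑ j : Fin f, (lam j).2 * (p : ℤ) ^ (j : ℕ))
    (b' := ∑ j : Fin f, (lam' j).2 * (p : ℤ) ^ (j : ℕ)) (by
      rw [weightExp_toNat_pairU h0, weightExp_toNat_pairU h0']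
      refine (charExp_of_classU_eq hc').trans ?_
      have h1 := (charExp_of_classU_eq hc).symm.add_right
        (((p ^ f : ℕ) + 1) * (graphShift p (pairU mu) (pairU om') -
          graphShift p (pairU mu) (pairU om)))
      rwa [add_assoc, ← mul_add, add_sub_cancel] at h1)
  rw [adjacent_iff, dimExt1_serreWeight_eq_rank]
  exact key
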